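/- **Setting.** Let $\mathbb A=\mathbb R/\mathbb Z\times[0,1]$ with universal covering $\pi:\tilde{\mathbb A}=\mathbb R\times[0,1]\to\mathbb A$, boundary components $B_i=\mathbb R/\mathbb Z\times\{i\}$, $T(x,y)=(x+1,y)$ and $J(x,y)=(-x,y)$. Let $f$ be a $C^\infty$ pseudo-rotation, i.e. a $C^\infty$ diffeomorphism of $\mathbb A$ that preserves $dx\wedge dy$, is isotopic to the identity and has no periodic points; let $\alpha\in(0,1)$ be its rotation number and $F$ the lift of $f$ with rotation number $\alpha$, i.e. $\lim_k (p_1F^k(z)-p_1(z))/k=\alpha$ for all $z$, where $p_1$ is the first coordinate. Write $F^{a,b}=T^bF^a$. Put $\alpha_0=\alpha$, $\alpha_{j+1}=1/\alpha_j-\lfloor1/\alpha_j\rfloor$, $a_{j+1}=\lfloor1/\alpha_j\rfloor$, $q_0=1$, $q_1=a_1$, $q_{j+2}=q_j+q_{j+1}a_{j+2}$, $p_0=0$, and let $p_j$ be the integer closest to $q_j\alpha$ for $j\ge1$. A simple curve is the image of a continuous injective path from $B_0$ to $B_1$ whose interior avoids the boundary (similarly in $\tilde{\mathbb A}$). A simple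 curve $\gamma$ is a Brouwer curve for $g:\mathbb A\to\mathbb A$ if $\gamma\cap g(\gamma)=\emptyset$, and a $Q$-good Brouwer curve for $g$ if it is a Brouwer curve for $g$ and for each of $g,g^2,\dots,g^{Q-1}$. An admissible coordinate for the closed region $\mathcal R$ with left side $\gamma$ and right side $g(\gamma)$, with respect to $g$ (where $\gamma$ is a Brouwer curve for $g$), is an orientation preserving $C^\infty$ diffeomorphism $\phi$ with constant Jacobian from an open neighbourhood $\mathcal U$ of $[0,1]^2$ in $\tilde{\mathbb A}$ onto an open neighbourhood of $\mathcal R$ in $\mathbb A$, such that $\phi(\{0\}\times[0,1])=\gamma$, $\phi(\{1\}\times[0,1])=g(\gamma)$, $\phi([0,1]\times\{i\})\subset B_i$, and $g\phi=\phi T$ on a neighbourhood $\mathcal U_L\subset \mathcal U\cap T^{-1}\mathcal U$ of $\{0\}\times[0,1]$. The analogous definition applies in $\tilde{\mathbb A}$. Finally $\|\phi\|_{\mathrm{Diff}^r(E)}$ is the supremum of the Euclidean norms of all partial derivatives of orders $1,\dots,r$ of $\phi$ on $E$ and of $\phi^{-1}$ on $\phi(E)$. Let $n\ge1$ be odd,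 let $\sigma$ be a smooth Brouwer curve for $f^{q_{n-1}}$ with a lift $\tilde\sigma\subset\tilde{\mathbb A}$, and let $H$ be an admissible coordinate, with respect to $S_0:=F^{q_{n-1},-p_{n-1}}$, for the closed region of $\tilde{\mathbb A}$ bounded by $(\tilde\sigma,S_0(\tilde\sigma))$, extended to the $C^\infty$ diffeomorphism $H$ of $\tilde{\mathbb A}$ with $S_0H=HT$. Let $f^{q_n,-p_n}_H:\mathbb A\to\mathbb A$ be the renormalization of $f$, i.e. the map with lift $(HJ)^{-1}F^{q_n,-p_n}HJ$. **Proposition.** For each $r\in\mathbb N$, $r\ge1$, there is an increasing function $G_r:\mathbb R_+^3\times\mathbb N\to\mathbb R_+$ depending only on $r$ such that the following holds for all $f$, $n$, $\sigma$, $\tilde\sigma$, $H$ as above. Suppose that $f^{q_n,-p_n}_H$ has an $a_{n+1}$-good Brouwer curve $\gamma'$. Let $\tilde\gamma'\subset\tilde{\mathbb A}$ be any lift of $\gamma'$, and put $\tilde\gamma:=HJ(\tilde\gamma')$ and $\gamma:=\pi(\tilde\gamma)$. Then: 1. $\gamma$ is a $q_{n+1}$-good Brouwer curve for $f$. In particular,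 $\gamma$ is a Brouwer curve for $f^{q_n}$. 2. If $\Phi'$ is an admissible coordinate for the closed region bounded by $(\gamma',f^{q_n,-p_n}_H(\gamma'))$ with respect to $f^{q_n,-p_n}_H$, then the closed region bounded by $(f^{q_n}(\gamma),\gamma)$ has an admissible coordinate $\Phi$ with respect to $f^{-q_n}$, and if the lift $\tilde\gamma'$ is chosen so that its end point on $\mathbb R\times\{0\}$ lies in $[0,1]\times\{0\}$, then $\Phi$ can be chosen with $$\|\Phi\|_{\mathrm{Diff}^r([0,1]^2)}\le G_r\big(\|\Phi'\|_{\mathrm{Diff}^r([0,1]^2)},\ \|H\|_{\mathrm{Diff}^r([0,1]^2)},\ \|f\|_{\mathrm{Diff}^r(\mathbb A)},\ q_{n-1}\big).$$ -/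

import Mathlib

open Set Filter Topology
open scoped ContDiff NNReal ENNReal

noncomputable section

namespace PseudoRotation

/-! ### Continued fraction data of a number in `(0,1)` -/

/-- The Gauss map `x ↦ 1/x - ⌊1/x⌋` (with value `0` at `0`). -/
def gauss (x : ℝ) : ℝ := 1 / x - ⌊1 / x⌋

/-- `α_n = 𝒢ⁿ(α)`. -/
def alphaSeq (α : ℝ) (n : ℕ) : ℝ := gauss^[n] α

/-- The partial quotients `a_0 = 0`, `a_{n+1} = ⌊1/α_n⌋`. -/
def aSeq (α : ℝ) : ℕ → ℕ
  | 0 => 0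
  | n + 1 => ⌊1 / alphaSeq α n⌋₊

/-- The denominators `q_0 = 1`, `q_1 = ⌊1/α⌋`, `q_{n+2} = q_n + q_{n+1} a_{n+2}`. -/
def qSeq (α : ℝ) : ℕ → ℕ
  | 0 => 1
  | 1 => ⌊1 / α⌋₊
  | n + 2 => qSeq α n + qSeq α (n + 1) * aSeq α (n + 2)

/-- The numerators: `p_0 = 0` and `p_n` is the integer closest to `q_n α` for `n ≥ 1`. -/
def pSeq (α : ℝ) : ℕ → ℤ
  | 0 => 0
  | n + 1 => round ((qSeq α (n + 1) : ℝ) * α)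

/-! ### The annulus and its universal covering -/

/-- The closed annulus `ℝ/ℤ × [0,1]`. -/
abbrev Annulus : Type := UnitAddCircle × unitInterval

/-- The universal covering `ℝ × [0,1]` of the annulus. -/
abbrev Strip : Type := ℝ × unitInterval

/-- The Euclidean plane. -/
abbrev Plane : Type := EuclideanSpace ℝ (Fin 2)

/-- The covering projection. -/
def proj (z : Strip) : Annulus := ((z.1 : UnitAddCircle), z.2)

/-- The deck transformation `T(x,y) = (x+1,y)`. -/
def deckT : Strip ≃ₜ Strip := (Homeomorph.addRight (1 : ℝ)).prodCongr (Homeomorph.refl _)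

/-- The reflection `J(x,y) = (-x,y)`. -/
def reflJ : Strip ≃ₜ Strip := (Homeomorph.neg ℝ).prodCongr (Homeomorph.refl _)

/-- `F` is a lift of `f`. -/
def IsLift (F : Strip → Strip) (f : Annulus → Annulus) : Prop := ∀ z, proj (F z) = f (proj z)

/-- The preimage of a point of the annulus in the fundamental domain `[0,1) × [0,1]`. -/
def rep (a : Annulus) : Strip := ((AddCircle.equivIco (1 : ℝ) 0 a.1 : ℝ), a.2)

theorem proj_rep (a : Annulus) : proj (rep a) = a :=
  Prod.ext AddCircle.coe_equivIco rfl

/-- The map of the annulus induced by a map `G` of the strip that commutes with `T`. -/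
def descend (G : Strip → Strip) (a : Annulus) : Annulus := proj (G (rep a))

theorem isLift_descend {G : Strip → Strip} (hG : ∀ z, G (deckT z) = deckT (G z)) :
    IsLift G (descend G) := by
  have hT : ∀ z, proj (deckT z) = proj z := fun z =>
    Prod.ext (AddCircle.coe_add_period (1 : ℝ) z.1) rfl
  have hn : ∀ (n : ℕ) (z : Strip), proj (G (z.1 + n, z.2)) = proj (G z) := by
    intro n
    induction n with
    | zero => intro z; simp
    | succ k ih =>
      intro z
      have h : ((z.1 + (k + 1 : ℕ), z.2) : Strip) = deckT (z.1 + k, z.2) :=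
        Prod.ext (by push_cast; exact (add_assoc _ _ _).symm) rfl
      rw [h, hG, hT, ih]
  intro z
  have hz : proj (rep (proj z)) = proj z := proj_rep _
  have h1 : (((rep (proj z)).1 - z.1 : ℝ) : UnitAddCircle) = 0 := by
    rw [AddCircle.coe_sub, sub_eq_zero]; exact congrArg Prod.fst hz
  obtain ⟨m, hm⟩ := (AddCircle.coe_eq_zero_iff (1 : ℝ)).mp h1
  have hm' : (rep (proj z)).1 = z.1 + m := by
    simp only [zsmul_eq_mul, mul_one] at hm; linarith
  have h2 : (rep (proj z)).2 = z.2 := rfl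
  show proj (G z) = proj (G (rep (proj z)))
  rcases Int.eq_nat_or_neg m with ⟨n, rfl | rfl⟩
  · rw [← hn n z]; congr 2
    exact Prod.ext (by rw [hm']; push_cast; rfl) h2.symm
  · rw [← hn n (rep (proj z))]; congr 2
    exact Prod.ext (by rw [hm']; push_cast; ring) h2.symm

/-! ### Smoothness and `C^r` measurements, in the coordinates of the plane -/

/-- The inclusion of the strip in the plane. -/
def toPlane (z : Strip) : Plane := !₂[z.1, (z.2 : ℝ)]

/-- A left inverse of `toPlane`. -/
def ofPlane (w : Plane) : Strip := (w 0, projIcc 0 1 zero_le_one (w 1))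

/-- The strip as a subset of the plane. -/
def stripSet : Set Plane := range toPlane

/-- A map of the strip, read as a map between subsets of the plane
(only its restriction to `stripSet` is relevant). -/
def coordRep (G : Strip → Strip) (w : Plane) : Plane := toPlane (G (ofPlane w))

/-- A local lift near `z` of a map from the strip to the annulus: the lift of `φ w`
whose first coordinate is within `1/2` of that of a fixed preimage of `φ z`. -/
def localLift (φ : Strip → Annulus) (z w : Strip) : Strip :=
  ((AddCircle.equivIoc (1 : ℝ) ((rep (φ z)).1 - 1 / 2) (φ w).1 : ℝ), (φ w).2)

/-- `G` is `C^∞` at `z`, up to the boundary of the strip. -/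
def SmoothAt (G : Strip → Strip) (z : Strip) : Prop :=
  ContDiffWithinAt ℝ ∞ (coordRep G) stripSet (toPlane z)

/-- A map into the annulus is `C^∞` at `z` if its local lift is. -/
def SmoothAtA (φ : Strip → Annulus) (z : Strip) : Prop := SmoothAt (localLift φ z) z

/-- The Jacobian determinant of `G` at `z`. -/
def jac (G : Strip → Strip) (z : Strip) : ℝ :=
  (fderivWithin ℝ (coordRep G) stripSet (toPlane z)).det

/-- The Jacobian determinant at `z` of a map into the annulus. -/
def jacA (φ : Strip → Annulus) (z : Strip) : ℝ := jac (localLift φ z) z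

/-- The partial derivative of order `k` of `G` at `z`, in the coordinate directions
`i 0, …, i (k-1)`. -/
def partialD (G : Strip → Strip) {k : ℕ} (i : Fin k → Fin 2) (z : Strip) : Plane :=
  iteratedFDerivWithin ℝ k (coordRep G) stripSet (toPlane z)
    (fun j => EuclideanSpace.single (i j) (1 : ℝ))

/-- `‖G‖_{C^r(E)}`: the supremum over `E` of the Euclidean norms of all partial derivatives
of orders `1, …, r`. -/
def crSize (r : ℕ) (G : Strip → Strip) (E : Set Strip) : ℝ≥0∞ :=
  ⨆ z ∈ E, ⨆ k ∈ Icc 1 r, ⨆ i : Fin k → Fin 2, ‖partialD G i z‖ₑ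

/-- `‖φ‖_{C^r(E)}` for a map into the annulus, measured with local lifts. -/
def crSizeA (r : ℕ) (φ : Strip → Annulus) (E : Set Strip) : ℝ≥0∞ :=
  ⨆ z ∈ E, ⨆ k ∈ Icc 1 r, ⨆ i : Fin k → Fin 2, ‖partialD (localLift φ z) i z‖ₑ

/-- The unit square `[0,1]²` in the strip. -/
def square : Set Strip := {z | z.1 ∈ Icc (0 : ℝ) 1}

/-- `‖H‖_{Diff^r([0,1]²)}` for a diffeomorphism `H` of the strip. -/
def diffSizeStrip (r : ℕ) (H : Strip ≃ₜ Strip) : ℝ≥0∞ :=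
  max (crSize r H square) (crSize r H.symm (H '' square))

/-- `‖f‖_{Diff^r(𝔸)}` for a diffeomorphism `f` of the annulus. -/
def diffSizeAnnulus (r : ℕ) (f : Annulus ≃ₜ Annulus) : ℝ≥0∞ :=
  max (crSizeA r (f ∘ proj) univ) (crSizeA r (f.symm ∘ proj) univ)

/-- `‖Φ‖_{Diff^r([0,1]²)}` for a diffeomorphism `Φ` from a neighbourhood of `[0,1]²` in the strip
onto an open subset of the annulus. -/
def diffSizeChart (r : ℕ) (Φ : OpenPartialHomeomorph Strip Annulus) : ℝ≥0∞ :=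
  max (crSizeA r Φ square) (crSize r (Φ.symm ∘ proj) (proj ⁻¹' (Φ '' square)))

/-! ### Pseudo-rotations and rotation numbers -/

/-- `f` is isotopic to the identity. -/
def IsotopicToId (f : Annulus ≃ₜ Annulus) : Prop :=
  ∃ h : unitInterval → (Annulus ≃ₜ Annulus),
    Continuous (fun p : unitInterval × Annulus => h p.1 p.2) ∧
    h 0 = Homeomorph.refl _ ∧ h 1 = f

/-- A (`C^∞`-smooth) pseudo-rotation: a diffeomorphism of the annulus that preserves the area form
`dx ∧ dy`, is isotopic to the identity and has no periodic points. -/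
structure IsPseudoRotation (f : Annulus ≃ₜ Annulus) : Prop where
  smooth : ∀ z, SmoothAtA (f ∘ proj) z
  smooth_symm : ∀ z, SmoothAtA (f.symm ∘ proj) z
  area : ∀ z, jacA (f ∘ proj) z = 1
  isotopic : IsotopicToId f
  no_periodic : ∀ k : ℕ, 0 < k → ∀ x, (f ^ k) x ≠ x

/-- `ρ` is the rotation number of the lift `F`: the asymptotic translation of its trajectories. -/
def HasRotationNumber (F : Strip ≃ₜ Strip) (ρ : ℝ) : Prop :=
  ∀ z, Tendsto (fun k : ℕ => (((F ^ k) z).1 - z.1) / k) atTop (𝓝 ρ)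

/-! ### Curves -/

/-- A simple curve in the annulus that connects the two boundary circles. -/
def IsSimpleCurveA (γ : Set Annulus) : Prop :=
  ∃ c : unitInterval → Annulus, Continuous c ∧ Function.Injective c ∧
    (c 0).2 = 0 ∧ (c 1).2 = 1 ∧ (∀ t ∈ Ioo (0 : unitInterval) 1, (c t).2 ∈ Ioo 0 1) ∧ γ = range c

/-- A simple curve in the strip that connects the two boundary lines. -/
def IsSimpleCurve (γ : Set Strip) : Prop :=
  ∃ c : unitInterval → Strip, Continuous c ∧ Function.Injective c ∧
    (c 0).2 = 0 ∧ (c 1).2 = 1 ∧ (∀ t ∈ Ioo (0 : unitInterval) 1, (c t).2 ∈ Ioo 0 1) ∧ γ = range c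

/-- The simple curve `γt` in the strip is a lift of the curve `γ` in the annulus. -/
def IsCurveLift (γt : Set Strip) (γ : Set Annulus) : Prop := IsSimpleCurve γt ∧ proj '' γt = γ

/-- The union of the components of the complement of `γ` that contain points with arbitrarily
negative first coordinate. -/
def leftSide (γ : Set Strip) : Set Strip :=
  {z | z ∉ γ ∧ ∀ M : ℝ, ∃ w ∈ connectedComponentIn γᶜ z, w.1 < M}

/-- The union of the components of the complement of `γ` that contain points with arbitrarily
large first coordinate. -/
def rightSide (γ : Set Strip) : Set Strip :=
  {z | z ∉ γ ∧ ∀ M : ℝ, ∃ w ∈ connectedComponentIn γᶜ z, M < w.1}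

/-- `γ₁` is to the left of `γ₂`. -/
def LeftOf (γ₁ γ₂ : Set Strip) : Prop := Disjoint γ₁ γ₂ ∧ γ₁ ⊆ leftSide γ₂

/-- The closed region of the strip bounded by `(γ₁, γ₂)`, where `γ₁` is to the left of `γ₂`. -/
def stripRegion (γ₁ γ₂ : Set Strip) : Set Strip := {z | z ∉ leftSide γ₁ ∧ z ∉ rightSide γ₂}

/-- The closed region of the annulus with left side `γ₁` and right side `γ₂`: the projection of the
region bounded by lifts `γt₁ < γt₂ < T γt₁`. -/
def annulusRegion (γ₁ γ₂ : Set Annulus) : Set Annulus :=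
  {a | ∃ γt₁ γt₂ : Set Strip, IsCurveLift γt₁ γ₁ ∧ IsCurveLift γt₂ γ₂ ∧
    LeftOf γt₁ γt₂ ∧ LeftOf γt₂ (deckT '' γt₁) ∧ a ∈ proj '' stripRegion γt₁ γt₂}

/-- `γ` is a Brouwer curve for `f`. -/
def IsBrouwerCurve (f : Annulus → Annulus) (γ : Set Annulus) : Prop :=
  IsSimpleCurveA γ ∧ Disjoint γ (f '' γ)

/-- `γ` is a `Q`-good Brouwer curve for `f`: a Brouwer curve for `f` that is also a Brouwer curve
for `f, f², …, f^{Q-1}`. -/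
def IsGoodBrouwerCurve (f : Annulus → Annulus) (Q : ℕ) (γ : Set Annulus) : Prop :=
  IsBrouwerCurve f γ ∧ ∀ j : ℕ, 1 ≤ j → j < Q → IsBrouwerCurve (f^[j]) γ

/-! ### Admissible coordinates -/

/-- `φ`, an orientation preserving diffeomorphism from an open neighbourhood of `[0,1]²` in the strip
onto an open neighbourhood of the region `R` bounded by `(γ, f(γ))`, is an admissible coordinate for
`(R, f)`. -/
structure IsAdmissible (f : Annulus → Annulus) (γ : Set Annulus)
    (φ : OpenPartialHomeomorph Strip Annulus) : Prop where
  brouwer : IsBrouwerCurve f γ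
  square_subset : square ⊆ φ.source
  region_subset : annulusRegion γ (f '' γ) ⊆ φ.target
  smooth : ∀ z ∈ φ.source, SmoothAtA φ z
  smooth_symm : ∀ z, proj z ∈ φ.target → SmoothAt (φ.symm ∘ proj) z
  jacobian : ∃ c : ℝ, 0 < c ∧ ∀ z ∈ φ.source, jacA φ z = c
  left_edge : φ '' {z | z.1 = 0} = γ
  right_edge : φ '' {z | z.1 = 1} = f '' γ
  bottom_edge : ∀ z ∈ square, z.2 = 0 → (φ z).2 = 0
  top_edge : ∀ z ∈ square, z.2 = 1 → (φ z).2 = 1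
  equivariant : ∃ UL : Set Strip, IsOpen UL ∧ {z | z.1 = 0} ⊆ UL ∧ UL ⊆ φ.source ∧
    deckT '' UL ⊆ φ.source ∧ ∀ z ∈ UL, f (φ z) = φ (deckT z)

/-- The analogous notion in the strip: `φ` is an admissible coordinate for `(R, F)`, where
`F(γ)` is to the right of `γ` and `R` is the region bounded by `(γ, F(γ))`. -/
structure IsAdmissibleLift (F : Strip → Strip) (γ : Set Strip)
    (φ : OpenPartialHomeomorph Strip Strip) : Prop where
  leftOf : LeftOf γ (F '' γ)
  square_subset : square ⊆ φ.source
  region_subset : stripRegion γ (F '' γ) ⊆ φ.target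
  smooth : ∀ z ∈ φ.source, SmoothAt φ z
  smooth_symm : ∀ z ∈ φ.target, SmoothAt φ.symm z
  jacobian : ∃ c : ℝ, 0 < c ∧ ∀ z ∈ φ.source, jac φ z = c
  left_edge : φ '' {z | z.1 = 0} = γ
  right_edge : φ '' {z | z.1 = 1} = F '' γ
  bottom_edge : ∀ z ∈ square, z.2 = 0 → (φ z).2 = 0
  top_edge : ∀ z ∈ square, z.2 = 1 → (φ z).2 = 1
  equivariant : ∃ UL : Set Strip, IsOpen UL ∧ {z | z.1 = 0} ⊆ UL ∧ UL ⊆ φ.source ∧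
    deckT '' UL ⊆ φ.source ∧ ∀ z ∈ UL, F (φ z) = φ (deckT z)

/-! ### Renormalization -/

/-- `F^{a,b} = T^b F^a`. -/
def liftPow (F : Strip ≃ₜ Strip) (a b : ℤ) : Strip ≃ₜ Strip := deckT ^ b * F ^ a

/-- The lift `F^{a,b}_H = (HJ)⁻¹ F^{a,b} (HJ)` of the renormalization. -/
def renormLift (F H : Strip ≃ₜ Strip) (a b : ℤ) : Strip ≃ₜ Strip :=
  (H * reflJ)⁻¹ * liftPow F a b * (H * reflJ)

/-- The renormalization `f^{a,b}_H` of the annulus map with lift `F`. -/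
def renorm (F H : Strip ≃ₜ Strip) (a b : ℤ) : Annulus → Annulus := descend (renormLift F H a b)

/-- The set-up of the renormalization at level `m = n - 1`: `σ` is a Brouwer curve for `f^{q_m}`,
`σt` is a lift of it, and `H` is a diffeomorphism of the whole strip that is an admissible coordinate
for `F^{q_m,-p_m}` on the region bounded by `(σt, F^{q_m,-p_m}(σt))`, extended so that
`F^{q_m,-p_m} H = H T` on the whole strip. -/
structure IsRenormChart (f : Annulus ≃ₜ Annulus) (F : Strip ≃ₜ Strip) (α : ℝ) (m : ℕ)
    (σ : Set Annulus) (σt : Set Strip) (H : Strip ≃ₜ Strip) : Prop where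
  brouwer : IsBrouwerCurve ⇑(f ^ qSeq α m) σ
  lift : IsCurveLift σt σ
  admissible :
    IsAdmissibleLift (liftPow F (qSeq α m) (-pSeq α m)) σt H.toOpenPartialHomeomorph
  conj : ∀ z, liftPow F (qSeq α m) (-pSeq α m) (H z) = H (deckT z)

end PseudoRotation

end

open PseudoRotation

namespace PseudoRotation

/-! ### Continued fractions -/

/-! Put S₀ = F^{q_{n-1},-p_{n-1}}, S₁ = F^{q_n,-p_n} and β_j = |q_j α - p_j|. As n is odd, S₀ moves
the bottom line to the right with translation number β_{n-1}, and S₁ moves it to the left with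
translation number β_n < β_{n-1}. Since p_n q_{n-1} - p_{n-1} q_n = 1, each F^{a,b} is S₀^k S₁^j for
exactly one pair (k, j). The map HJ identifies the annulus with the quotient of the strip by S₀, and
the renormalization is the map induced by S₁. So the hypothesis on γ' says that γ̃ misses S₀^k
S₁^j(γ̃) whenever (k, j) ≠ 0 and 0 ≤ j < a_{n+1} (or j = 1).

Goodness of γ. It suffices that γ̃ misses F^{a,b}(γ̃) for (a, b) ≠ 0 and |a| < q_{n+1} = q_{n-1} +
a_{n+1} q_n. Write a = k q_{n-1} + j q_n; passing to the inverse, j ≥ 0. Small j is the hypothesis.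
If j ≥ a_{n+1}, the bound on a forces k ≤ 0, so the map is a product of copies of S₀⁻¹ and S₁, which
both send γ̃ to its left. Such maps are closed under composition (`GoodLift.leftOf_mul`), which
yields disjointness (`GoodLift.disjointLifts`). The order of disjoint curves is read off from their
end points on the bottom line (`leftOf_of_base_lt`), where the rotation number decides it
(`goodLift_of_isPseudoRotation`). The planar topology behind this is one crossing lemma,
`exists_eq_of_crossing`.

The chart. Lift Φ' to a map Ψ into the strip and let ρ(x,y) = (1-x,y). Then Φ = π ∘ HJ ∘ Ψ ∘ ρ; the
reflections J and ρ cancel, so orientation is preserved. Equivariance of Ψ is known a priori only up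
to an integer translation, which rotation numbers and injectivity force to be trivial
(`LiftedChart.stripChart`). A clopen argument shows that the image of the square contains the region
between S₁(γ̃) and γ̃ (`StripChart.stripRegion_subset`), and the order of the translates of γ̃ makes
π injective on that image (`StripChart.injOn_proj`).

The bound. The chain rule controls Φ once H is controlled on JΨ([0,1]²). The normalization of the
lift of γ' and the mean value inequality confine this set to boundedly many unit squares, and on the
k-th one H = S₀^k H T^{-k} costs at most |k| q_{n-1} iterations of F or F⁻¹ (`ConjTo.derivBound`,
`LiftedChart.diffSizeChart_le`). -/

/-- The errors `β_n = α_0 α_1 ⋯ α_n = |q_n α - p_n|`. -/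
noncomputable def betaSeq (α : ℝ) : ℕ → ℝ
  | 0 => α
  | n + 1 => betaSeq α n * alphaSeq α (n + 1)

/-- The numerators given by the recursion formula. -/
noncomputable def numSeq (α : ℝ) : ℕ → ℤ
  | 0 => 0
  | 1 => 1
  | n + 2 => numSeq α n + numSeq α (n + 1) * aSeq α (n + 2)

theorem alphaSeq_succ (α : ℝ) (n : ℕ) : alphaSeq α (n + 1) = gauss (alphaSeq α n) :=
  Function.iterate_succ_apply' _ _ _

theorem alphaSeq_mem {α : ℝ} (hi : Irrational α) (h : α ∈ Ioo (0 : ℝ) 1) (n : ℕ) :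
    Irrational (alphaSeq α n) ∧ alphaSeq α n ∈ Ioo (0 : ℝ) 1 := by
  induction n with
  | zero => exact ⟨hi, h⟩
  | succ n ih =>
    obtain ⟨hn, -⟩ := ih
    rw [alphaSeq_succ, gauss]
    have h1 : Irrational (1 / alphaSeq α n) := by rw [one_div]; exact hn.inv
    have h2 : Irrational (1 / alphaSeq α n - ⌊1 / alphaSeq α n⌋) := h1.sub_intCast _
    refine ⟨h2, lt_of_le_of_ne ?_ h2.ne_zero.symm, ?_⟩
    · linarith [Int.floor_le (1 / alphaSeq α n)]
    · linarith [Int.lt_floor_add_one (1 / alphaSeq α n)]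

section
variable {α : ℝ} (hi : Irrational α) (h : α ∈ Ioo (0 : ℝ) 1)
include hi h

theorem one_le_aSeq (n : ℕ) : 1 ≤ aSeq α (n + 1) := by
  obtain ⟨-, h0, h1⟩ := alphaSeq_mem hi h n
  rw [aSeq, Nat.one_le_floor_iff]
  exact (one_le_div h0).2 h1.le

theorem alphaSeq_mul_succ (n : ℕ) :
    alphaSeq α n * alphaSeq α (n + 1) = 1 - aSeq α (n + 1) * alphaSeq α n := by
  obtain ⟨-, h0, h1⟩ := alphaSeq_mem hi h n
  have : (aSeq α (n + 1) : ℝ) = ⌊1 / alphaSeq α n⌋ :=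
    natCast_floor_eq_intCast_floor (by positivity)
  rw [alphaSeq_succ, gauss, this]
  field_simp

theorem betaSeq_pos (n : ℕ) : 0 < betaSeq α n := by
  induction n with
  | zero => exact h.1
  | succ n ih => exact mul_pos ih (alphaSeq_mem hi h _).2.1

theorem betaSeq_succ_lt (n : ℕ) : betaSeq α (n + 1) < betaSeq α n :=
  mul_lt_of_lt_one_right (betaSeq_pos hi h n) (alphaSeq_mem hi h _).2.2

theorem betaSeq_lt_one (n : ℕ) : betaSeq α n < 1 := by
  induction n with
  | zero => exact h.2
  | succ n ih => exact (betaSeq_succ_lt hi h n).trans ih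

theorem betaSeq_add_two (n : ℕ) :
    betaSeq α (n + 2) = betaSeq α n - aSeq α (n + 2) * betaSeq α (n + 1) := by
  have := alphaSeq_mul_succ hi h (n + 1)
  simp only [betaSeq]
  linear_combination betaSeq α n * this

/-- This makes the nearest integer `pSeq` agree with the recursive numerator `numSeq`. With x = α_n
α_{n+1} ≥ β_{n+1}, both x < α_n and x ≤ 1 - α_n hold, so 2x < 1. -/
theorem betaSeq_succ_lt_half (n : ℕ) : betaSeq α (n + 1) < 1 / 2 := by
  have h1 : betaSeq α n ≤ alphaSeq α n := by
    cases n with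
    | zero => exact le_rfl
    | succ n =>
      exact mul_le_of_le_one_left (alphaSeq_mem hi h _).2.1.le (betaSeq_lt_one hi h n).le
  obtain ⟨-, h0, h2⟩ := alphaSeq_mem hi h n
  obtain ⟨-, h3, h4⟩ := alphaSeq_mem hi h (n + 1)
  have h5 := alphaSeq_mul_succ hi h n
  have h6 : (1 : ℝ) ≤ aSeq α (n + 1) := by exact_mod_cast one_le_aSeq hi h n
  have h7 : betaSeq α (n + 1) ≤ alphaSeq α n * alphaSeq α (n + 1) :=
    mul_le_mul_of_nonneg_right h1 h3.le
  nlinarith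

theorem qSeq_mul_sub_numSeq (n : ℕ) :
    (qSeq α n : ℝ) * α - numSeq α n = (-1) ^ n * betaSeq α n := by
  induction n using Nat.twoStepInduction with
  | zero => simp [qSeq, numSeq, betaSeq]
  | one =>
    have h1 := alphaSeq_mul_succ hi h 0
    have h2 : (qSeq α 1 : ℝ) = aSeq α 1 := rfl
    have h3 : alphaSeq α 0 = α := rfl
    rw [h3] at h1
    simp only [numSeq, betaSeq, h2, h1]
    push_cast
    ring
  | more n h1 h2 =>
    have h3 := betaSeq_add_two hi h n
    simp only [qSeq, numSeq, h3]
    push_cast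
    linear_combination h1 + aSeq α (n + 2) * h2

theorem pSeq_eq_numSeq (n : ℕ) : pSeq α n = numSeq α n := by
  cases n with
  | zero => rfl
  | succ n =>
    have h1 := qSeq_mul_sub_numSeq hi h (n + 1)
    have h2 := betaSeq_succ_lt_half hi h n
    have h3 := betaSeq_pos hi h (n + 1)
    rw [pSeq, round_eq, Int.floor_eq_iff]
    rcases neg_one_pow_eq_or ℝ (n + 1) with h4 | h4 <;> rw [h4] at h1 <;> constructor <;> linarith

theorem qSeq_mul_sub_pSeq (n : ℕ) :
    (qSeq α n : ℝ) * α - pSeq α n = (-1) ^ n * betaSeq α n := by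
  rw [pSeq_eq_numSeq hi h, qSeq_mul_sub_numSeq hi h]

/-- Unimodularity: the lifts at two consecutive levels generate the whole lattice of the maps
`liftPow F a b`. -/
theorem pSeq_mul_qSeq_sub (n : ℕ) :
    pSeq α (n + 1) * qSeq α n - pSeq α n * qSeq α (n + 1) = (-1) ^ n := by
  simp only [pSeq_eq_numSeq hi h]
  induction n with
  | zero => simp [numSeq, qSeq]
  | succ n ih =>
    simp only [numSeq, qSeq]
    push_cast
    rw [pow_succ]
    linear_combination -ih

theorem one_le_qSeq (n : ℕ) : 1 ≤ qSeq α n := by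
  induction n using Nat.twoStepInduction with
  | zero => exact le_rfl
  | one => exact one_le_aSeq hi h 0
  | more n h1 h2 => exact h1.trans (Nat.le_add_right _ _)

/-- Level 0 is excluded because q_0 = q_1 = 1 when α > 1/2. -/
theorem qSeq_lt_succ {n : ℕ} (hn : 1 ≤ n) : qSeq α n < qSeq α (n + 1) := by
  obtain ⟨m, rfl⟩ : ∃ m, n = m + 1 := ⟨n - 1, by omega⟩
  have h1 := one_le_qSeq hi h m
  have h2 := one_le_aSeq hi h (m + 1)
  show qSeq α (m + 1) < qSeq α m + qSeq α (m + 1) * aSeq α (m + 2)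
  nlinarith [one_le_qSeq hi h (m + 1)]

end

/-! ### Separation of the strip by simple curves -/

/-- Makes open connected subsets of the strip path connected, so that the crossing lemma for paths
applies to components of complements of curves. -/
instance : LocallyPathConnectedSpace unitInterval :=
  (isQuotientMap_projIcc (h := zero_le_one' ℝ)).locallyPathConnectedSpace

/-- A continuous function cannot jump over a gap. Applied to an argument function whose sine or
cosine has a known sign, this replaces a winding number. -/
theorem le_of_forall_notMem_Ioo {f : ℝ → ℝ} (hf : Continuous f) {v w t₀ : ℝ} (hvw : v < w)
    (h : ∀ t, f t ∉ Ioo v w) (h₀ : f t₀ ≤ v) (t : ℝ) : f t ≤ v := by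
  by_contra! ht
  obtain ⟨u, hu1, hu2⟩ := exists_between (lt_min ht hvw)
  obtain ⟨s, hs⟩ := mem_range_of_exists_le_of_exists_ge hf ⟨t₀, h₀.trans hu1.le⟩
    ⟨t, (hu2.trans_le (min_le_left _ _)).le⟩
  exact h s (hs ▸ ⟨hu1, hu2.trans_le (min_le_right _ _)⟩)

theorem le_of_forall_notMem_Ioo' {f : ℝ → ℝ} (hf : Continuous f) {v w t₀ : ℝ} (hvw : v < w)
    (h : ∀ t, f t ∉ Ioo v w) (h₀ : w ≤ f t₀) (t : ℝ) : w ≤ f t := by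
  have := le_of_forall_notMem_Ioo (f := fun t => -f t) hf.neg (neg_lt_neg hvw)
    (fun t ht => h t ⟨by linarith [ht.2], by linarith [ht.1]⟩) (neg_le_neg h₀) t
  linarith

/-- A continuous nowhere vanishing function on the plane has a continuous argument. -/
theorem exists_continuous_arg {g : ℝ × ℝ → ℂ} (hg : Continuous g) (h0 : ∀ p, g p ≠ 0)
    (a : ℝ × ℝ) : ∃ θ : ℝ × ℝ → ℝ, Continuous θ ∧ θ a = (g a).arg ∧
      ∀ p, (g p).re = ‖g p‖ * Real.cos (θ p) ∧ (g p).im = ‖g p‖ * Real.sin (θ p) := by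
  have hmem : ∀ p, g p / ‖g p‖ ∈ Submonoid.unitSphere ℂ := fun p => by
    have : ‖g p‖ ≠ 0 := norm_ne_zero_iff.2 (h0 p)
    simp [Submonoid.unitSphere, this]
  let u : C(ℝ × ℝ, Circle) := ⟨fun p => ⟨g p / ‖g p‖, hmem p⟩, by
    refine Continuous.subtype_mk (hg.div (by fun_prop) fun p => ?_) _
    exact_mod_cast norm_ne_zero_iff.2 (h0 p)⟩
  have hlift : Circle.exp (g a).arg = u a := by
    ext
    have : (‖g a‖ : ℂ) ≠ 0 := by exact_mod_cast norm_ne_zero_iff.2 (h0 a)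
    simp only [Circle.coe_exp]
    show _ = g a / ‖g a‖
    rw [eq_div_iff this, mul_comm, Complex.norm_mul_exp_arg_mul_I]
  -- The plane is simply connected, so the normalized map to the circle lifts through the covering
  -- `Circle.exp`.
  obtain ⟨θ, ⟨h1, h2⟩, -⟩ := Circle.isCoveringMap_exp.existsUnique_continuousMap_lifts u a _ hlift
  refine ⟨θ, θ.continuous, h1, fun p => ?_⟩
  have h3 : (Circle.exp (θ p) : ℂ) = g p / ‖g p‖ := congrArg Subtype.val (congrFun h2 p)
  have h4 : (‖g p‖ : ℂ) ≠ 0 := by exact_mod_cast norm_ne_zero_iff.2 (h0 p)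
  rw [Circle.coe_exp, eq_div_iff h4, Complex.exp_mul_I] at h3
  have hre := congrArg Complex.re h3
  have him := congrArg Complex.im h3
  simp only [Complex.mul_re, Complex.mul_im, Complex.add_re, Complex.add_im, Complex.ofReal_re,
    Complex.ofReal_im, Complex.I_re, Complex.I_im, Complex.cos_ofReal_re, Complex.sin_ofReal_re,
    Complex.cos_ofReal_im, Complex.sin_ofReal_im] at hre him
  constructor <;> linarith

/-- A path in the strip from bottom to top meets a path from far left to far right. -/
theorem exists_eq_of_crossing {c d : unitInterval → Strip} (hc : Continuous c) (hd : Continuous d)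
    (hc0 : (c 0).2 = 0) (hc1 : (c 1).2 = 1) (hd0 : ∀ s, (d 0).1 < (c s).1)
    (hd1 : ∀ s, (c s).1 < (d 1).1) : ∃ s t, c s = d t := by
  by_contra! hne
  let P : ℝ → unitInterval := projIcc 0 1 zero_le_one
  have hP : Continuous P := continuous_projIcc
  have hP0 : P 0 = 0 := projIcc_left zero_le_one
  have hP1 : P 1 = 1 := projIcc_right zero_le_one
  -- If the paths never met, c(s) - d(t) would have a continuous argument θ on the parameter square.
  -- The real part is positive for t = 0 and negative for t = 1; the imaginary part is ≤ 0 for s = 0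
  -- and ≥ 0 for s = 1.
  let g : ℝ × ℝ → ℂ := fun p =>
    ⟨(c (P p.1)).1 - (d (P p.2)).1, ((c (P p.1)).2 : ℝ) - (d (P p.2)).2⟩
  have hg : Continuous g := by
    have : g = fun p => (((c (P p.1)).1 - (d (P p.2)).1 : ℝ) : ℂ) +
        ((((c (P p.1)).2 : ℝ) - (d (P p.2)).2 : ℝ) : ℂ) * Complex.I := by
      funext p; apply Complex.ext <;> simp [g]
    rw [this]; fun_prop
  have hg0 : ∀ p, g p ≠ 0 := by
    intro p hp
    refine hne (P p.1) (P p.2) (Prod.ext ?_ (Subtype.ext ?_))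
    · have := congrArg Complex.re hp; simp [g] at this; linarith
    · have := congrArg Complex.im hp; simp [g] at this; linarith
  obtain ⟨θ, hθ, hstart, hpol⟩ := exists_continuous_arg hg hg0 (0, 0)
  have hn : ∀ p, 0 < ‖g p‖ := fun p => norm_pos_iff.2 (hg0 p)
  have hcosL : ∀ s, 0 < Real.cos (θ (s, 0)) := fun s => by
    have h1 : 0 < (g (s, 0)).re := by
      simp only [g, hP0]; linarith [hd0 (P s)]
    rw [(hpol _).1] at h1
    exact pos_of_mul_pos_right h1 (hn _).le
  have hcosR : ∀ s, Real.cos (θ (s, 1)) < 0 := fun s => by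
    have h1 : (g (s, 1)).re < 0 := by
      simp only [g, hP1]; linarith [hd1 (P s)]
    rw [(hpol _).1] at h1
    exact (pos_iff_neg_of_mul_neg h1).1 (hn _)
  have hsinB : ∀ t, Real.sin (θ (0, t)) ≤ 0 := fun t => by
    have h1 : (g (0, t)).im ≤ 0 := by
      simp only [g, hP0, hc0]; simpa using (d (P t)).2.2.1
    rw [(hpol _).2] at h1
    by_contra! h
    nlinarith [mul_pos (hn (0, t)) h]
  have hsinT : ∀ t, 0 ≤ Real.sin (θ (1, t)) := fun t => by
    have h1 : 0 ≤ (g (1, t)).im := by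
      simp only [g, hP1, hc1]; simpa using (d (P t)).2.2.2
    rw [(hpol _).2] at h1
    by_contra! h
    nlinarith [mul_pos (hn (1, t)) (neg_pos.2 h)]
  have hpi := Real.pi_pos
  have h00 : |θ (0, 0)| < Real.pi / 2 := by
    rw [hstart, Complex.abs_arg_lt_pi_div_two_iff, (hpol _).1]
    exact Or.inl (mul_pos (hn _) (hcosL 0))
  obtain ⟨h00a, h00b⟩ := abs_lt.1 h00
  have h00c : θ (0, 0) ≤ 0 := by
    by_contra! h
    exact (hsinB 0).not_gt (Real.sin_pos_of_pos_of_lt_pi h (by linarith))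
  have cosneg : ∀ x, x ∈ Ioo (Real.pi / 2) (Real.pi + Real.pi / 2) → Real.cos x < 0 := fun x hx =>
    Real.cos_neg_of_pi_div_two_lt_of_lt hx.1 hx.2
  have hL := hθ.comp (Continuous.prodMk continuous_id (continuous_const (y := (0 : ℝ))))
  -- The positive cosine along t = 0 keeps θ in the window around 0 where it starts; the sine on the
  -- edges s = 1 and s = 0 then gives θ(1,1) ≥ 0 and θ(0,1) ≤ 0.
  have hL1 : θ (1, 0) ≤ Real.pi / 2 :=
    le_of_forall_notMem_Ioo hL (v := Real.pi / 2) (w := Real.pi + Real.pi / 2) (t₀ := 0)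
      (by linarith) (fun t ht => (cosneg _ ht).not_gt (hcosL t)) h00b.le 1
  have hL2 : -(Real.pi / 2) ≤ θ (1, 0) :=
    le_of_forall_notMem_Ioo' hL (w := -(Real.pi / 2)) (v := -(Real.pi + Real.pi / 2)) (t₀ := 0)
      (by linarith) (fun t ht => (cosneg (-θ (t, 0)) ⟨lt_neg_of_lt_neg ht.2,
        neg_lt_of_neg_lt ht.1⟩).not_gt (by rw [Real.cos_neg]; exact hcosL t))
      h00a.le 1
  have h10 : 0 ≤ θ (1, 0) := by
    by_contra! h
    exact (hsinT 0).not_gt (Real.sin_neg_of_neg_of_neg_pi_lt h (by linarith))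
  have h11 : 0 ≤ θ (1, 1) :=
    le_of_forall_notMem_Ioo' (hθ.comp (Continuous.prodMk (continuous_const (y := (1 : ℝ)))
      continuous_id)) (v := -Real.pi) (w := 0) (t₀ := 0) (by linarith)
      (fun t ht => (hsinT t).not_gt (Real.sin_neg_of_neg_of_neg_pi_lt ht.2 ht.1)) h10 1
  have h01 : θ (0, 1) ≤ 0 :=
    le_of_forall_notMem_Ioo (hθ.comp (Continuous.prodMk (continuous_const (y := (0 : ℝ)))
      continuous_id)) (v := 0) (w := Real.pi) (t₀ := 0) (by linarith)
      (fun t ht => (hsinB t).not_gt (Real.sin_pos_of_pos_of_lt_pi ht.1 ht.2)) h00c 1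
  -- Along t = 1 the argument changes from ≤ 0 to ≥ 0; where it vanishes the cosine is 1, against
  -- `hcosR`.
  obtain ⟨s, hs⟩ := mem_range_of_exists_le_of_exists_ge
    (hθ.comp (Continuous.prodMk continuous_id (continuous_const (y := (1 : ℝ)))))
    ⟨0, h01⟩ ⟨1, h11⟩
  have := hcosR s
  rw [show θ (s, 1) = 0 from hs, Real.cos_zero] at this
  linarith

/-- The point of the bottom line at which a simple curve starts. -/
noncomputable def base (γ : Set Strip) : ℝ := sInf {x | (x, (0 : unitInterval)) ∈ γ}

section curve
variable {γ γ₁ γ₂ γ₃ : Set Strip}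

theorem IsSimpleCurve.isCompact (h : IsSimpleCurve γ) : IsCompact γ := by
  obtain ⟨c, hc, -, -, -, -, rfl⟩ := h
  exact isCompact_range hc

theorem IsSimpleCurve.isConnected (h : IsSimpleCurve γ) : IsConnected γ := by
  obtain ⟨c, hc, -, -, -, -, rfl⟩ := h
  exact isConnected_range hc

/-- A simple curve meets the bottom line only at its starting point, so the infimum defining `base`
is taken over a singleton. -/
theorem IsSimpleCurve.mem_iff (h : IsSimpleCurve γ) {x : ℝ} :
    (x, (0 : unitInterval)) ∈ γ ↔ x = base γ := by
  obtain ⟨c, hc, hinj, h0, h1, hI, rfl⟩ := h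
  have key : ∀ y : ℝ, (y, (0 : unitInterval)) ∈ range c ↔ y = (c 0).1 := by
    intro y
    constructor
    · rintro ⟨t, ht⟩
      have ht2 : (c t).2 = 0 := by rw [ht]
      rcases eq_or_ne t 0 with rfl | ht0
      · rw [ht]
      rcases eq_or_ne t 1 with rfl | ht1
      · rw [h1] at ht2; exact absurd ht2 one_ne_zero
      · have := (hI t ⟨unitInterval.pos_iff_ne_zero.2 ht0, unitInterval.lt_one_iff_ne_one.2 ht1⟩).1
        exact absurd ht2 this.ne'
    · rintro rfl
      exact ⟨0, Prod.ext rfl h0⟩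
  have : base (range c) = (c 0).1 := by
    rw [base, show {x | (x, (0 : unitInterval)) ∈ range c} = {(c 0).1} from Set.ext key, csInf_singleton]
  rw [this, key]

theorem IsSimpleCurve.base_mem (h : IsSimpleCurve γ) : (base γ, (0 : unitInterval)) ∈ γ :=
  h.mem_iff.2 rfl

theorem IsSimpleCurve.exists_bound (h : IsSimpleCurve γ) : ∃ M : ℝ, ∀ z ∈ γ, |z.1| < M := by
  obtain ⟨M, hM⟩ := h.isCompact.exists_bound_of_continuousOn (f := fun z : Strip => z.1)
    continuous_fst.continuousOn
  exact ⟨M + 1, fun z hz => (hM z hz).trans_lt (lt_add_one M)⟩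

theorem subset_leftSide {C : Set Strip} (hC : IsPreconnected C) (hd : Disjoint C γ) {z : Strip}
    (hz : z ∈ C) (hl : z ∈ leftSide γ) : C ⊆ leftSide γ := by
  intro w hw
  have h1 : C ⊆ γᶜ := disjoint_left.1 hd
  have h2 : w ∈ connectedComponentIn γᶜ z := hC.subset_connectedComponentIn hz h1 hw
  refine ⟨h1 hw, ?_⟩
  rw [← connectedComponentIn_eq h2]
  exact hl.2

theorem subset_rightSide {C : Set Strip} (hC : IsPreconnected C) (hd : Disjoint C γ) {z : Strip}
    (hz : z ∈ C) (hl : z ∈ rightSide γ) : C ⊆ rightSide γ := by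
  intro w hw
  have h1 : C ⊆ γᶜ := disjoint_left.1 hd
  have h2 : w ∈ connectedComponentIn γᶜ z := hC.subset_connectedComponentIn hz h1 hw
  refine ⟨h1 hw, ?_⟩
  rw [← connectedComponentIn_eq h2]
  exact hl.2

theorem leftSide_connectedComponentIn_subset {z : Strip} (hl : z ∈ leftSide γ) :
    connectedComponentIn γᶜ z ⊆ leftSide γ :=
  subset_leftSide isPreconnected_connectedComponentIn
    (disjoint_left.2 fun _ h => connectedComponentIn_subset _ _ h)
    (mem_connectedComponentIn hl.1) hl

theorem rightSide_connectedComponentIn_subset {z : Strip} (hl : z ∈ rightSide γ) :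
    connectedComponentIn γᶜ z ⊆ rightSide γ :=
  subset_rightSide isPreconnected_connectedComponentIn
    (disjoint_left.2 fun _ h => connectedComponentIn_subset _ _ h)
    (mem_connectedComponentIn hl.1) hl

theorem isOpen_leftSide (h : IsClosed γ) : IsOpen (leftSide γ) :=
  isOpen_iff_mem_nhds.2 fun _ hz => mem_of_superset
    (h.isOpen_compl.connectedComponentIn.mem_nhds (mem_connectedComponentIn hz.1))
    (leftSide_connectedComponentIn_subset hz)

theorem isOpen_rightSide (h : IsClosed γ) : IsOpen (rightSide γ) :=
  isOpen_iff_mem_nhds.2 fun _ hz => mem_of_superset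
    (h.isOpen_compl.connectedComponentIn.mem_nhds (mem_connectedComponentIn hz.1))
    (rightSide_connectedComponentIn_subset hz)

/-- Components of the complement of a closed set are open, so a limit point off γ shares a component
with points of the side. -/
theorem closure_leftSide_subset (h : IsClosed γ) : closure (leftSide γ) ⊆ leftSide γ ∪ γ := by
  intro z hz
  by_cases hγ : z ∈ γ
  · exact Or.inr hγ
  obtain ⟨w, hw1, hw2⟩ := mem_closure_iff.1 hz _ (h.isOpen_compl.connectedComponentIn (x := z))
    (mem_connectedComponentIn hγ)
  exact Or.inl (subset_leftSide isPreconnected_connectedComponentIn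
    (disjoint_left.2 fun _ h => connectedComponentIn_subset _ _ h) hw1 hw2
    (mem_connectedComponentIn hγ))

theorem closure_rightSide_subset (h : IsClosed γ) : closure (rightSide γ) ⊆ rightSide γ ∪ γ := by
  intro z hz
  by_cases hγ : z ∈ γ
  · exact Or.inr hγ
  obtain ⟨w, hw1, hw2⟩ := mem_closure_iff.1 hz _ (h.isOpen_compl.connectedComponentIn (x := z))
    (mem_connectedComponentIn hγ)
  exact Or.inl (subset_rightSide isPreconnected_connectedComponentIn
    (disjoint_left.2 fun _ h => connectedComponentIn_subset _ _ h) hw1 hw2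
    (mem_connectedComponentIn hγ))

theorem IsSimpleCurve.mem_leftSide (h : IsSimpleCurve γ) {x : ℝ} (hx : x < base γ) :
    (x, (0 : unitInterval)) ∈ leftSide γ := by
  have hsub : Iic x ×ˢ {(0 : unitInterval)} ⊆ γᶜ := by
    rintro ⟨y, t⟩ ⟨hy, rfl⟩ hm
    exact (hx.trans_le' hy).ne (h.mem_iff.1 hm)
  refine ⟨hsub ⟨mem_Iic.2 le_rfl, rfl⟩, fun M => ⟨(min x (M - 1), 0), ?_, ?_⟩⟩
  · refine (isPreconnected_Iic.prod isPreconnected_singleton).subset_connectedComponentIn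
      ⟨mem_Iic.2 le_rfl, rfl⟩ hsub ⟨min_le_left _ _, rfl⟩
  · exact (min_le_right _ _).trans_lt (by linarith)

theorem IsSimpleCurve.mem_rightSide (h : IsSimpleCurve γ) {x : ℝ} (hx : base γ < x) :
    (x, (0 : unitInterval)) ∈ rightSide γ := by
  have hsub : Ici x ×ˢ {(0 : unitInterval)} ⊆ γᶜ := by
    rintro ⟨y, t⟩ ⟨hy, rfl⟩ hm
    exact (hx.trans_le hy).ne' (h.mem_iff.1 hm)
  refine ⟨hsub ⟨mem_Ici.2 le_rfl, rfl⟩, fun M => ⟨(max x (M + 1), 0), ?_, ?_⟩⟩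
  · refine (isPreconnected_Ici.prod isPreconnected_singleton).subset_connectedComponentIn
      ⟨mem_Ici.2 le_rfl, rfl⟩ hsub ⟨le_max_left _ _, rfl⟩
  · exact (lt_add_one M).trans_le (le_max_right _ _)

/-- A component reaching both ends of the strip would contain a path from far left to far right that
avoids γ, against the crossing lemma. -/
theorem IsSimpleCurve.disjoint_sides (h : IsSimpleCurve γ) :
    Disjoint (leftSide γ) (rightSide γ) := by
  rw [disjoint_left]
  intro z hl hr
  obtain ⟨M, hM⟩ := h.exists_bound
  obtain ⟨w₁, hw₁, hM₁⟩ := hl.2 (-M)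
  obtain ⟨w₂, hw₂, hM₂⟩ := hr.2 M
  have hopen : IsOpen (connectedComponentIn γᶜ z) :=
    h.isCompact.isClosed.isOpen_compl.connectedComponentIn
  have hpath := (hopen.isConnected_iff_isPathConnected.1
    (isConnected_connectedComponentIn_iff.2 hl.1)).joinedIn w₁ hw₁ w₂ hw₂
  obtain ⟨d, hd⟩ := hpath
  obtain ⟨c, hc, -, h0, h1, -, rfl⟩ := h
  obtain ⟨s, t, hst⟩ := exists_eq_of_crossing hc d.continuous h0 h1
    (fun s => by rw [d.source]; linarith [(abs_lt.1 (hM _ ⟨s, rfl⟩)).1])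
    (fun s => by rw [d.target]; linarith [(abs_lt.1 (hM _ ⟨s, rfl⟩)).2])
  exact connectedComponentIn_subset _ _ (hd t) ⟨s, hst⟩

/-- The order of disjoint curves is one-dimensional: a connected curve stays on the side of γ₂ on
which its base point lies. This reduces all order questions to the dynamics on the bottom line. -/
theorem leftOf_of_base_lt (h₁ : IsSimpleCurve γ₁) (h₂ : IsSimpleCurve γ₂) (hd : Disjoint γ₁ γ₂)
    (hb : base γ₁ < base γ₂) : LeftOf γ₁ γ₂ :=
  ⟨hd, subset_leftSide h₁.isConnected.isPreconnected hd h₁.base_mem (h₂.mem_leftSide hb)⟩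

theorem LeftOf.base_lt (h : LeftOf γ₁ γ₂) (h₁ : IsSimpleCurve γ₁) (h₂ : IsSimpleCurve γ₂) :
    base γ₁ < base γ₂ := by
  rcases lt_trichotomy (base γ₁) (base γ₂) with hb | hb | hb
  · exact hb
  · exact absurd (h₂.mem_iff.2 hb) (disjoint_left.1 h.1 h₁.base_mem)
  · exact absurd (h₂.mem_rightSide hb) (disjoint_left.1 h₂.disjoint_sides (h.2 h₁.base_mem))

theorem LeftOf.subset_rightSide (h : LeftOf γ₁ γ₂) (h₁ : IsSimpleCurve γ₁)
    (h₂ : IsSimpleCurve γ₂) : γ₂ ⊆ rightSide γ₁ :=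
  PseudoRotation.subset_rightSide h₂.isConnected.isPreconnected h.1.symm h₂.base_mem
    (h₁.mem_rightSide (h.base_lt h₁ h₂))

/-- The content is the disjointness of γ₁ and γ₃, which lie on opposite sides of γ₂. -/
theorem LeftOf.trans (h : LeftOf γ₁ γ₂) (h' : LeftOf γ₂ γ₃) (h₁ : IsSimpleCurve γ₁)
    (h₂ : IsSimpleCurve γ₂) (h₃ : IsSimpleCurve γ₃) : LeftOf γ₁ γ₃ :=
  leftOf_of_base_lt h₁ h₃
    (h₂.disjoint_sides.mono h.2 (h'.subset_rightSide h₂ h₃))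
    ((h.base_lt h₁ h₂).trans (h'.base_lt h₂ h₃))

theorem LeftOf.rightSide_subset (h : LeftOf γ₁ γ₂) (h₂ : IsSimpleCurve γ₂) :
    rightSide γ₂ ⊆ rightSide γ₁ := by
  intro z hz
  have h3 : connectedComponentIn γ₂ᶜ z ⊆ γ₁ᶜ := fun w hw hw' =>
    disjoint_left.1 h₂.disjoint_sides (h.2 hw') (rightSide_connectedComponentIn_subset hz hw)
  refine ⟨h3 (mem_connectedComponentIn hz.1), fun M => ?_⟩
  obtain ⟨w, hw, hM⟩ := hz.2 M
  exact ⟨w, isPreconnected_connectedComponentIn.subset_connectedComponentIn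
    (mem_connectedComponentIn hz.1) h3 hw, hM⟩

end curve

/-! ### Calculus on the strip -/

@[simp] theorem ofPlane_toPlane (z : Strip) : ofPlane (toPlane z) = z := by
  obtain ⟨x, y⟩ := z
  simp [ofPlane, toPlane]

theorem continuous_toPlane : Continuous toPlane := by
  unfold toPlane
  refine (PiLp.continuous_toLp 2 _).comp (continuous_pi fun i => ?_)
  fin_cases i
  · exact continuous_fst
  · exact continuous_subtype_val.comp continuous_snd

theorem continuous_ofPlane : Continuous ofPlane := by
  unfold ofPlane
  exact ((EuclideanSpace.proj (𝕜 := ℝ) (0 : Fin 2)).continuous).prodMk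
    (continuous_projIcc.comp (EuclideanSpace.proj (𝕜 := ℝ) (1 : Fin 2)).continuous)

theorem isEmbedding_toPlane : IsEmbedding toPlane :=
  Topology.IsEmbedding.of_leftInverse (fun z => ofPlane_toPlane z) continuous_ofPlane
    continuous_toPlane

theorem map_toPlane_nhds (z : Strip) : map toPlane (𝓝 z) = 𝓝[stripSet] (toPlane z) :=
  isEmbedding_toPlane.map_nhds_eq z

@[simp] theorem toPlane_mem (z : Strip) : toPlane z ∈ stripSet := mem_range_self z

theorem mem_stripSet {w : Plane} : w ∈ stripSet ↔ w 1 ∈ Icc (0 : ℝ) 1 := by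
  constructor
  · rintro ⟨z, rfl⟩; exact z.2.2
  · intro h
    refine ⟨(w 0, ⟨w 1, h⟩), ?_⟩
    ext i; fin_cases i <;> rfl

theorem stripSet_eq_preimage :
    stripSet = (EuclideanSpace.proj (𝕜 := ℝ) (1 : Fin 2)) ⁻¹' Icc (0 : ℝ) 1 :=
  ext fun _ => mem_stripSet

theorem convex_stripSet : Convex ℝ stripSet := by
  rw [stripSet_eq_preimage]
  exact (convex_Icc 0 1).linear_preimage (EuclideanSpace.proj (𝕜 := ℝ) (1 : Fin 2)).toLinearMap

theorem uniqueDiffOn_stripSet : UniqueDiffOn ℝ stripSet := by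
  refine uniqueDiffOn_convex convex_stripSet ⟨!₂[0, 1 / 2], ?_⟩
  refine mem_interior.2 ⟨(EuclideanSpace.proj (𝕜 := ℝ) (1 : Fin 2)) ⁻¹' Ioo (0 : ℝ) 1, ?_, ?_, ?_⟩
  · rw [stripSet_eq_preimage]; exact preimage_mono Ioo_subset_Icc_self
  · exact isOpen_Ioo.preimage (EuclideanSpace.proj (𝕜 := ℝ) (1 : Fin 2)).continuous
  · simp; norm_num

@[simp] theorem coordRep_toPlane (G : Strip → Strip) (z : Strip) :
    coordRep G (toPlane z) = toPlane (G z) := by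
  simp [coordRep]

theorem coordRep_mem (G : Strip → Strip) (w : Plane) : coordRep G w ∈ stripSet := mem_range_self _

theorem coordRep_comp (G F : Strip → Strip) : coordRep (G ∘ F) = coordRep G ∘ coordRep F := by
  funext w; simp [coordRep]

theorem coordRep_eventuallyEq {G₁ G₂ : Strip → Strip} {z : Strip} (h : G₁ =ᶠ[𝓝 z] G₂) :
    coordRep G₁ =ᶠ[𝓝[stripSet] (toPlane z)] coordRep G₂ := by
  rw [← map_toPlane_nhds, EventuallyEq, eventually_map]
  filter_upwards [h] with w hw
  simp [hw]

/-- The affine map `(x, y) ↦ (e x + m, y)`. -/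
def affineX (e m : ℝ) (z : Strip) : Strip := (e * z.1 + m, z.2)

theorem continuous_affineX (e m : ℝ) : Continuous (affineX e m) := by
  unfold affineX; fun_prop

/-- The iterated derivative of a map of the strip. -/
noncomputable def itD (k : ℕ) (G : Strip → Strip) (z : Strip) :
    ContinuousMultilinearMap ℝ (fun _ : Fin k => Plane) Plane :=
  iteratedFDerivWithin ℝ k (coordRep G) stripSet (toPlane z)

/-- The derivative of a map of the strip. -/
noncomputable def der (G : Strip → Strip) (z : Strip) : Plane →L[ℝ] Plane :=
  fderivWithin ℝ (coordRep G) stripSet (toPlane z)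

/-- Lifts of one map differ by translations, so derivatives of positive order do not depend on the
lift. -/
theorem iteratedFDerivWithin_add_const_of_ne {E F : Type*} [NormedAddCommGroup E]
    [NormedSpace ℝ E] [NormedAddCommGroup F] [NormedSpace ℝ F] {s : Set E}
    (hs : UniqueDiffOn ℝ s) {x : E} (hx : x ∈ s) {k : ℕ} (hk : k ≠ 0) (f : E → F) (c : F) :
    iteratedFDerivWithin ℝ k (fun y => f y + c) s x = iteratedFDerivWithin ℝ k f s x := by
  obtain ⟨k, rfl⟩ := Nat.exists_eq_succ_of_ne_zero hk
  rw [Nat.succ_eq_add_one, iteratedFDerivWithin_succ_eq_comp_right hs hx,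
    iteratedFDerivWithin_succ_eq_comp_right hs hx]
  simp only [Function.comp, fderivWithin_add_const]

section congr
variable {G₁ G₂ : Strip → Strip} {z : Strip} {m : ℝ}

theorem coordRep_shift (h : G₁ =ᶠ[𝓝 z] affineX 1 m ∘ G₂) :
    coordRep G₁ =ᶠ[𝓝[stripSet] (toPlane z)] fun w => coordRep G₂ w + !₂[m, 0] := by
  refine (coordRep_eventuallyEq h).trans (Eventually.of_forall fun w => ?_)
  ext i
  fin_cases i <;> simp [coordRep, toPlane, affineX]

theorem SmoothAt.congr_shift (hG : SmoothAt G₂ z) (h : G₁ =ᶠ[𝓝 z] affineX 1 m ∘ G₂) :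
    SmoothAt G₁ z :=
  ContDiffWithinAt.congr_of_eventuallyEq (hG.add contDiffWithinAt_const) (coordRep_shift h)
    ((coordRep_shift h).eq_of_nhdsWithin (toPlane_mem z))

theorem der_congr_shift (h : G₁ =ᶠ[𝓝 z] affineX 1 m ∘ G₂) : der G₁ z = der G₂ z := by
  rw [der, (coordRep_shift h).fderivWithin_eq ((coordRep_shift h).eq_of_nhdsWithin (toPlane_mem z)),
    fderivWithin_add_const, der]

theorem jac_congr_shift (h : G₁ =ᶠ[𝓝 z] affineX 1 m ∘ G₂) : jac G₁ z = jac G₂ z :=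
  congrArg ContinuousLinearMap.det (der_congr_shift h)

theorem itD_congr_shift (h : G₁ =ᶠ[𝓝 z] affineX 1 m ∘ G₂) {k : ℕ} (hk : k ≠ 0) :
    itD k G₁ z = itD k G₂ z := by
  rw [itD, (coordRep_shift h).iteratedFDerivWithin_eq
    ((coordRep_shift h).eq_of_nhdsWithin (toPlane_mem z)),
    iteratedFDerivWithin_add_const_of_ne uniqueDiffOn_stripSet (toPlane_mem z) hk, itD]

theorem affineX_one_zero : affineX 1 0 = id := by
  funext z; simp [affineX]

theorem eventuallyEq_shift_zero (h : G₁ =ᶠ[𝓝 z] G₂) : G₁ =ᶠ[𝓝 z] affineX 1 0 ∘ G₂ := by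
  rwa [affineX_one_zero, Function.id_comp]

theorem SmoothAt.congr (hG : SmoothAt G₂ z) (h : G₁ =ᶠ[𝓝 z] G₂) : SmoothAt G₁ z :=
  hG.congr_shift (eventuallyEq_shift_zero h)

end congr

section comp
variable {G F : Strip → Strip} {z : Strip}

theorem SmoothAt.comp (hG : SmoothAt G (F z)) (hF : SmoothAt F z) : SmoothAt (G ∘ F) z := by
  rw [SmoothAt, coordRep_comp]
  refine ContDiffWithinAt.comp (t := stripSet) _ ?_ hF fun w _ => coordRep_mem F w
  rw [coordRep_toPlane]; exact hG

theorem SmoothAt.differentiableWithinAt (hG : SmoothAt G z) :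
    DifferentiableWithinAt ℝ (coordRep G) stripSet (toPlane z) :=
  ContDiffWithinAt.differentiableWithinAt hG (by simp)

theorem SmoothAt.hasFDerivWithinAt (hG : SmoothAt G z) :
    HasFDerivWithinAt (coordRep G) (der G z) stripSet (toPlane z) :=
  hG.differentiableWithinAt.hasFDerivWithinAt

theorem der_comp (hG : SmoothAt G (F z)) (hF : SmoothAt F z) :
    der (G ∘ F) z = (der G (F z)).comp (der F z) := by
  have h1 := hG.differentiableWithinAt
  rw [← coordRep_toPlane] at h1
  rw [der, coordRep_comp, fderivWithin_comp (t := stripSet) _ h1 hF.differentiableWithinAt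
    (fun w _ => coordRep_mem F w) (uniqueDiffOn_stripSet _ (toPlane_mem z)), coordRep_toPlane]
  rfl

theorem jac_comp (hG : SmoothAt G (F z)) (hF : SmoothAt F z) :
    jac (G ∘ F) z = jac G (F z) * jac F z := by
  show (der (G ∘ F) z).det = (der G (F z)).det * (der F z).det
  rw [der_comp hG hF]
  exact LinearMap.det_comp _ _

end comp

section affine

/-- The linear part of `affineX`. -/
noncomputable def affineL (e : ℝ) : Plane →L[ℝ] Plane :=
  LinearMap.toContinuousLinearMap
    { toFun := fun w => !₂[e * w 0, w 1]
      map_add' := fun v w => by ext i; fin_cases i <;> simp [mul_add]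
      map_smul' := fun c w => by ext i; fin_cases i <;> simp; ring }

theorem coordRep_affineX {e m : ℝ} {w : Plane} (hw : w ∈ stripSet) :
    coordRep (affineX e m) w = affineL e w + !₂[m, 0] := by
  obtain ⟨z, rfl⟩ := hw
  rw [coordRep_toPlane]
  ext i
  fin_cases i <;> simp [toPlane, affineX, affineL]

theorem smoothAt_affineX (e m : ℝ) (z : Strip) : SmoothAt (affineX e m) z :=
  ContDiffWithinAt.congr ((affineL e).contDiff.contDiffWithinAt.add contDiffWithinAt_const)
    (fun _ hw => coordRep_affineX hw) (coordRep_affineX (toPlane_mem z))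

theorem der_affineX (e m : ℝ) (z : Strip) : der (affineX e m) z = affineL e := by
  rw [der, fderivWithin_congr (fun _ hw => coordRep_affineX hw)
    (coordRep_affineX (toPlane_mem z)), fderivWithin_add_const]
  exact (affineL e).fderivWithin (uniqueDiffOn_stripSet _ (toPlane_mem z))

theorem det_plane (A : Plane →L[ℝ] Plane) :
    A.det = (A (EuclideanSpace.single 0 1)) 0 * (A (EuclideanSpace.single 1 1)) 1 -
      (A (EuclideanSpace.single 1 1)) 0 * (A (EuclideanSpace.single 0 1)) 1 := by
  rw [ContinuousLinearMap.det, ← LinearMap.det_toMatrix (EuclideanSpace.basisFun (Fin 2) ℝ).toBasis,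
    Matrix.det_fin_two]
  simp [LinearMap.toMatrix_apply]

theorem jac_affineX (e m : ℝ) (z : Strip) : jac (affineX e m) z = e := by
  show (der (affineX e m) z).det = e
  rw [der_affineX, det_plane]
  simp [affineL]

theorem norm_affineL_le {e : ℝ} (he : |e| = 1) : ‖affineL e‖ ≤ 1 := by
  refine ContinuousLinearMap.opNorm_le_bound _ zero_le_one fun w => ?_
  rw [one_mul, EuclideanSpace.norm_eq, EuclideanSpace.norm_eq]
  apply Real.sqrt_le_sqrt
  simp [affineL, Fin.sum_univ_two, mul_pow, ← sq_abs e, he]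

/-- The first derivative is a reflection or the identity, and the higher ones vanish. -/
theorem norm_itD_affineX_le {e : ℝ} (he : |e| = 1) (m : ℝ) (z : Strip) {k : ℕ} (hk : k ≠ 0) :
    ‖itD k (affineX e m) z‖ ≤ 1 := by
  obtain ⟨k, rfl⟩ := Nat.exists_eq_succ_of_ne_zero hk
  have h1 : EqOn (fderivWithin ℝ (coordRep (affineX e m)) stripSet) (fun _ => affineL e)
      stripSet := by
    rintro _ ⟨z, rfl⟩
    exact der_affineX e m z
  rw [itD, Nat.succ_eq_add_one, ← norm_iteratedFDerivWithin_fderivWithin uniqueDiffOn_stripSet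
    (toPlane_mem z), iteratedFDerivWithin_congr h1 (toPlane_mem z)]
  rcases Nat.eq_zero_or_pos k with rfl | hk
  · rw [norm_iteratedFDerivWithin_zero]; exact norm_affineL_le he
  · rw [iteratedFDerivWithin_const_of_ne hk.ne']; simp

end affine

/-! ### Boundary behaviour -/

section boundary
variable {G : Strip → Strip} {z : Strip}

theorem SmoothAt.hasDerivAt_fst (hG : SmoothAt G z) (i : Fin 2) :
    HasDerivAt (fun x : ℝ => toPlane (G (x, z.2)) i)
      (der G z (EuclideanSpace.single 0 1) i) z.1 := by
  have h1 : HasDerivAt (fun x : ℝ => toPlane (x, z.2)) (EuclideanSpace.single 0 1) z.1 := by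
    have h2 : (fun x : ℝ => toPlane (x, z.2)) =
        fun x => x • EuclideanSpace.single 0 (1 : ℝ) + toPlane (0, z.2) := by
      funext x; ext i; fin_cases i <;> simp [toPlane]
    rw [h2]
    simpa using ((hasDerivAt_id z.1).smul_const (EuclideanSpace.single (0 : Fin 2) (1 : ℝ))).add_const
      (toPlane (0, z.2))
  have h3 := (hG.hasFDerivWithinAt.comp_hasDerivWithinAt (t := stripSet) z.1 (s := univ)
    h1.hasDerivWithinAt (fun _ _ => toPlane_mem _))
  rw [hasDerivWithinAt_univ] at h3
  have h4 := (EuclideanSpace.proj (𝕜 := ℝ) i).hasFDerivAt.comp_hasDerivAt z.1 h3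
  simpa [Function.comp_def] using h4

theorem SmoothAt.hasDerivWithinAt_snd (hG : SmoothAt G z) (i : Fin 2) :
    HasDerivWithinAt (fun y : ℝ => toPlane (G (z.1, projIcc 0 1 zero_le_one y)) i)
      (der G z (EuclideanSpace.single 1 1) i) (Icc 0 1) z.2 := by
  have h1 : HasDerivAt (fun y : ℝ => (!₂[z.1, y] : Plane)) (EuclideanSpace.single 1 1) z.2 := by
    have h2 : (fun y : ℝ => (!₂[z.1, y] : Plane)) =
        fun y => y • EuclideanSpace.single 1 (1 : ℝ) + !₂[z.1, 0] := by
      funext x; ext i; fin_cases i <;> simp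
    rw [h2]
    simpa using ((hasDerivAt_id (z.2 : ℝ)).smul_const (EuclideanSpace.single (1 : Fin 2)
      (1 : ℝ))).add_const (!₂[z.1, 0] : Plane)
  have h3 := (HasFDerivWithinAt.comp_hasDerivWithinAt (t := stripSet) (l := coordRep G) (z.2 : ℝ)
    (s := Icc 0 1) hG.hasFDerivWithinAt
    h1.hasDerivWithinAt (fun y hy => mem_stripSet.2 (by simpa using hy)))
  have h4 := (EuclideanSpace.proj (𝕜 := ℝ) i).hasFDerivAt.comp_hasDerivWithinAt (z.2 : ℝ) h3
  exact h4

theorem jac_eq (G : Strip → Strip) (z : Strip) :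
    jac G z = der G z (EuclideanSpace.single 0 1) 0 * der G z (EuclideanSpace.single 1 1) 1 -
      der G z (EuclideanSpace.single 1 1) 0 * der G z (EuclideanSpace.single 0 1) 1 :=
  det_plane _

/-- At boundary points of the strip the normal derivative is one-sided, and minimality determines
only its sign. -/
theorem HasDerivWithinAt.nonneg_of_left {f : ℝ → ℝ} {f' : ℝ}
    (h : HasDerivWithinAt f f' (Icc 0 1) 0) (hm : ∀ y, f 0 ≤ f y) : 0 ≤ f' := by
  have h1 := (hasDerivWithinAt_iff_tendsto_slope' (by simp)).1 (h.mono Ioc_subset_Icc_self)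
  have : (𝓝[Ioc (0 : ℝ) 1] 0).NeBot := by
    rw [nhdsWithin_Ioc_eq_nhdsGT zero_lt_one]; infer_instance
  refine ge_of_tendsto h1 (eventually_nhdsWithin_of_forall fun y hy => ?_)
  rw [slope_def_field]
  exact div_nonneg (by linarith [hm y]) (by linarith [hy.1])

theorem HasDerivWithinAt.nonpos_of_right {f : ℝ → ℝ} {f' : ℝ}
    (h : HasDerivWithinAt f f' (Icc 0 1) 1) (hm : ∀ y, f 1 ≤ f y) : f' ≤ 0 := by
  have h1 := (hasDerivWithinAt_iff_tendsto_slope' (by simp)).1 (h.mono Ico_subset_Icc_self)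
  have : (𝓝[Ico (0 : ℝ) 1] 1).NeBot := by
    rw [nhdsWithin_Ico_eq_nhdsLT zero_lt_one]; infer_instance
  refine le_of_tendsto h1 (eventually_nhdsWithin_of_forall fun y hy => ?_)
  rw [slope_def_field]
  exact div_nonpos_of_nonneg_of_nonpos (by linarith [hm y]) (by linarith [hy.2])

/-- A value on the boundary of the strip is an extremum of the second coordinate, and the horizontal
direction is two-sided even at boundary points. -/
theorem SmoothAt.der_fst_snd_eq_zero (hG : SmoothAt G z) (h0 : (G z).2 = 0 ∨ (G z).2 = 1) :
    der G z (EuclideanSpace.single 0 1) 1 = 0 := by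
  rcases h0 with h0 | h0
  · refine IsLocalMin.hasDerivAt_eq_zero (Eventually.of_forall fun x => ?_) (hG.hasDerivAt_fst 1)
    simpa [toPlane, h0] using (G (x, z.2)).2.2.1
  · refine IsLocalMax.hasDerivAt_eq_zero (Eventually.of_forall fun x => ?_) (hG.hasDerivAt_fst 1)
    simpa [toPlane, h0] using (G (x, z.2)).2.2.2

/-- A local diffeomorphism maps interior points to interior points. -/
theorem SmoothAt.interior_of_jac_ne_zero (hG : SmoothAt G z) (hj : jac G z ≠ 0)
    (hz : z.2 ∈ Ioo (0 : unitInterval) 1) : (G z).2 ∈ Ioo (0 : unitInterval) 1 := by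
  have hIcc : Icc (0 : ℝ) 1 ∈ 𝓝 (z.2 : ℝ) := Icc_mem_nhds hz.1 hz.2
  have h2 := (hG.hasDerivWithinAt_snd 1).hasDerivAt hIcc
  have hz2 : projIcc 0 1 zero_le_one (z.2 : ℝ) = z.2 := projIcc_val _ _
  have key : ¬ ((G z).2 = 0 ∨ (G z).2 = 1) := by
    intro h0
    apply hj
    rw [jac_eq, hG.der_fst_snd_eq_zero h0]
    have h3 : der G z (EuclideanSpace.single 1 1) 1 = 0 := by
      rcases h0 with h0 | h0
      · refine IsLocalMin.hasDerivAt_eq_zero (Eventually.of_forall fun y => ?_) h2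
        simpa [toPlane, h0, hz2] using (G (z.1, projIcc 0 1 zero_le_one y)).2.2.1
      · refine IsLocalMax.hasDerivAt_eq_zero (Eventually.of_forall fun y => ?_) h2
        simpa [toPlane, h0, hz2] using (G (z.1, projIcc 0 1 zero_le_one y)).2.2.2
    rw [h3]; ring
  push Not at key
  exact ⟨unitInterval.pos_iff_ne_zero.2 key.1, unitInterval.lt_one_iff_ne_one.2 key.2⟩

/-- At a bottom point sent to the bottom line the derivative is triangular with normal entry ≥ 0, so
a positive determinant makes the tangential entry positive. -/
theorem SmoothAt.exists_deriv_pos {x : ℝ} (hG : SmoothAt G (x, 0)) (hj : 0 < jac G (x, 0))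
    (h0 : (G (x, 0)).2 = 0) : ∃ d, 0 < d ∧ HasDerivAt (fun x => (G (x, 0)).1) d x := by
  refine ⟨_, ?_, hG.hasDerivAt_fst 0⟩
  have h2 : 0 ≤ der G (x, 0) (EuclideanSpace.single 1 1) 1 :=
    HasDerivWithinAt.nonneg_of_left (hG.hasDerivWithinAt_snd 1) fun y => by
      simpa [toPlane, h0] using (G (x, projIcc 0 1 zero_le_one y)).2.2.1
  rw [jac_eq, hG.der_fst_snd_eq_zero (Or.inl h0), mul_zero, sub_zero] at hj
  exact pos_of_mul_pos_left hj h2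

/-- On the top line the inward normal is reversed. This excludes orientation preserving lifts that
commute with T and exchange the boundary lines. -/
theorem SmoothAt.exists_deriv_neg {x : ℝ} (hG : SmoothAt G (x, 1)) (hj : 0 < jac G (x, 1))
    (h0 : (G (x, 1)).2 = 0) : ∃ d < 0, HasDerivAt (fun x => (G (x, 1)).1) d x := by
  refine ⟨_, ?_, hG.hasDerivAt_fst 0⟩
  have h2 : der G (x, 1) (EuclideanSpace.single 1 1) 1 ≤ 0 :=
    HasDerivWithinAt.nonpos_of_right (hG.hasDerivWithinAt_snd 1) fun y => by
      simpa [toPlane, h0] using (G (x, projIcc 0 1 zero_le_one y)).2.2.1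
  rw [jac_eq, hG.der_fst_snd_eq_zero (Or.inl h0), mul_zero, sub_zero] at hj
  by_contra! h
  nlinarith [mul_nonneg h (neg_nonneg.2 h2)]

end boundary

/-! ### Local lifts -/

theorem exists_int_of_proj_eq {z w : Strip} (h : proj z = proj w) : ∃ m : ℤ, z = affineX 1 m w := by
  have h1 : ((z.1 - w.1 : ℝ) : UnitAddCircle) = 0 := by
    rw [AddCircle.coe_sub, sub_eq_zero]; exact congrArg Prod.fst h
  obtain ⟨m, hm⟩ := (AddCircle.coe_eq_zero_iff (1 : ℝ)).mp h1
  have h2 : z.2 = w.2 := (Prod.ext_iff.1 h).2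
  refine ⟨m, Prod.ext ?_ h2⟩
  simp only [zsmul_eq_mul, mul_one] at hm
  simp only [affineX]; linarith

@[simp] theorem proj_affineX_one (m : ℤ) (z : Strip) : proj (affineX 1 m z) = proj z := by
  refine Prod.ext ?_ rfl
  show (((1 * z.1 + m : ℝ)) : UnitAddCircle) = z.1
  rw [one_mul, AddCircle.coe_add, add_eq_left, AddCircle.coe_eq_zero_iff]
  exact ⟨m, by simp⟩

theorem continuous_proj : Continuous proj :=
  ((AddCircle.continuous_mk' (1 : ℝ)).comp continuous_fst).prodMk continuous_snd

/-- The cut of `localLift` is half a unit away from its value at z, so near z it is a translate of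
any continuous lift. Smoothness, Jacobians and C^r sizes can thus be computed with a lift of choice.
-/
theorem localLift_eventuallyEq {φ : Strip → Annulus} {G : Strip → Strip} {z : Strip}
    (hG : ContinuousAt G z) (h : φ =ᶠ[𝓝 z] proj ∘ G) :
    ∃ m : ℤ, localLift φ z =ᶠ[𝓝 z] affineX 1 m ∘ G := by
  have h1 : proj (rep (φ z)) = proj (G z) := by rw [proj_rep, h.eq_of_nhds]; rfl
  obtain ⟨m, hm⟩ := exists_int_of_proj_eq h1
  refine ⟨m, ?_⟩
  set a := (rep (φ z)).1 with ha
  have hc : ContinuousAt (fun w => (affineX 1 m (G w)).1) z :=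
    continuousAt_fst.comp ((continuous_affineX 1 m).continuousAt.comp hG)
  have hz : (affineX 1 m (G z)).1 ∈ Ioo (a - 1 / 2) (a - 1 / 2 + 1) := by
    rw [← hm]; constructor <;> linarith
  filter_upwards [h, hc.preimage_mem_nhds (isOpen_Ioo.mem_nhds hz)] with w hw hw2
  have h3 : φ w = proj (affineX 1 m (G w)) := by rw [proj_affineX_one]; exact hw
  refine Prod.ext ?_ ?_
  · simp only [localLift, h3]
    exact congrArg Subtype.val (AddCircle.equivIoc_coe_eq (Ioo_subset_Ioc_self hw2))
  · simp only [localLift, h3]; rfl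

theorem affineX_neg_comp_self (m : ℝ) : affineX 1 (-m) ∘ affineX 1 m = id := by
  funext z; simp [affineX]

section localLift
variable {φ : Strip → Annulus} {G : Strip → Strip} {z : Strip}
  (hG : ContinuousAt G z) (h : φ =ᶠ[𝓝 z] proj ∘ G)
include hG h

theorem smoothAtA_iff : SmoothAtA φ z ↔ SmoothAt G z := by
  obtain ⟨m, hm⟩ := localLift_eventuallyEq hG h
  refine ⟨fun hs => hs.congr_shift (m := -m) ?_, fun hs => hs.congr_shift hm⟩
  filter_upwards [hm] with w hw
  rw [Function.comp, hw]
  exact (congrFun (affineX_neg_comp_self m) _).symm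

theorem jacA_eq : jacA φ z = jac G z := by
  obtain ⟨m, hm⟩ := localLift_eventuallyEq hG h
  exact jac_congr_shift hm

theorem itD_localLift {k : ℕ} (hk : k ≠ 0) : itD k (localLift φ z) z = itD k G z := by
  obtain ⟨m, hm⟩ := localLift_eventuallyEq hG h
  exact itD_congr_shift hm hk

end localLift

/-! ### Bounds for derivatives of compositions -/

/-- Reduces to `norm_iteratedFDerivWithin_comp_le` by passing to neighbourhoods on which f and g are
C^n; only derivatives of positive order need to be bounded. -/
theorem norm_iteratedFDerivWithin_comp_le_of_contDiffWithinAt {E F G : Type*}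
    [NormedAddCommGroup E] [NormedSpace ℝ E] [NormedAddCommGroup F] [NormedSpace ℝ F]
    [NormedAddCommGroup G] [NormedSpace ℝ G] {g : F → G} {f : E → F} {s : Set E} {t : Set F}
    {x : E} {n : ℕ} (hn : n ≠ 0) (hg : ContDiffWithinAt ℝ ∞ g t (f x))
    (hf : ContDiffWithinAt ℝ ∞ f s x) (ht : UniqueDiffOn ℝ t) (hs : UniqueDiffOn ℝ s)
    (hst : MapsTo f s t) (hx : x ∈ s) {C D : ℝ} (hC0 : 0 ≤ C)
    (hC : ∀ i, 1 ≤ i → i ≤ n → ‖iteratedFDerivWithin ℝ i g t (f x)‖ ≤ C)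
    (hD : ∀ i, 1 ≤ i → i ≤ n → ‖iteratedFDerivWithin ℝ i f s x‖ ≤ D ^ i) :
    ‖iteratedFDerivWithin ℝ n (g ∘ f) s x‖ ≤ n.factorial * C * D ^ n := by
  have hfx : f x ∈ t := hst hx
  have hle : ((n : ℕ) : WithTop ℕ∞) ≤ (∞ : WithTop ℕ∞) := by exact_mod_cast le_top
  have hne : ((n : ℕ) : WithTop ℕ∞) = (∞ : WithTop ℕ∞) → (∞ : WithTop ℕ∞) = ⊤ := by
    intro h; exact absurd h (by exact_mod_cast ENat.natCast_ne_top n)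
  obtain ⟨V, hVo, hxV, hV⟩ := hg.contDiffOn' hle hne
  obtain ⟨U, hUo, hxU, hU⟩ := hf.contDiffOn' hle hne
  rw [insert_eq_of_mem hfx] at hV
  rw [insert_eq_of_mem hx] at hU
  have hpre : f ⁻¹' V ∈ 𝓝[s] x := hf.continuousWithinAt.preimage_mem_nhdsWithin (hVo.mem_nhds hxV)
  obtain ⟨W, hWo, hxW, hW⟩ := mem_nhdsWithin.1 hpre
  have hsub : s ∩ (U ∩ W) ⊆ s ∩ U := fun y hy => ⟨hy.1, hy.2.1⟩
  have hUW : IsOpen (U ∩ W) := hUo.inter hWo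
  -- Subtracting the value g(f x) makes the term of order zero vanish at f x and changes no
  -- derivative.
  let g' : F → G := fun y => g y + -g (f x)
  have key := norm_iteratedFDerivWithin_comp_le (g := g') (f := f) (n := n) (s := s ∩ (U ∩ W))
    (t := t ∩ V) (x := x) (N := n) (hV.add contDiffOn_const) (hU.mono hsub) le_rfl
    (ht.inter hVo) (hs.inter hUW) (fun y hy => ⟨hst hy.1, hW ⟨hy.2.2, hy.1⟩⟩) ⟨hx, hxU, hxW⟩
    (C := C) (D := D) (fun i hi => by
      rw [iteratedFDerivWithin_inter_open hVo hxV]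
      rcases Nat.eq_zero_or_pos i with rfl | hi0
      · simpa [g'] using hC0
      · rw [iteratedFDerivWithin_add_const_of_ne ht hfx hi0.ne']
        exact hC i hi0 hi)
    (fun i hi1 hi => by rw [iteratedFDerivWithin_inter_open hUW ⟨hxU, hxW⟩]; exact hD i hi1 hi)
  rw [iteratedFDerivWithin_inter_open hUW ⟨hxU, hxW⟩] at key
  rwa [show g' ∘ f = fun y => (g ∘ f) y + -g (f x) from rfl,
    iteratedFDerivWithin_add_const_of_ne hs hx hn] at key

/-- `G` is smooth at `z`, with derivatives of orders `1, …, r` bounded by `C`. -/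
def DerivBound (r : ℕ) (C : ℝ≥0) (G : Strip → Strip) (z : Strip) : Prop :=
  SmoothAt G z ∧ ∀ k, 1 ≤ k → k ≤ r → ‖itD k G z‖ ≤ C

/-- The bound for a composition. -/
noncomputable def compBound (r : ℕ) (C D : ℝ≥0) : ℝ≥0 := r.factorial * C * (1 + D) ^ r

theorem compBound_mono (r : ℕ) {C C' D D' : ℝ≥0} (h : C ≤ C') (h' : D ≤ D') :
    compBound r C D ≤ compBound r C' D' := by
  unfold compBound; gcongr

theorem le_compBound (r : ℕ) (C D : ℝ≥0) : C ≤ compBound r C D := by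
  have h1 : (1 : ℝ≥0) ≤ r.factorial := by exact_mod_cast r.factorial_pos
  have h2 : (1 : ℝ≥0) ≤ (1 + D) ^ r := one_le_pow₀ (le_self_add)
  calc C = 1 * C * 1 := by ring
    _ ≤ _ := by unfold compBound; gcongr

section
variable {r : ℕ} {C D : ℝ≥0} {G F G₁ G₂ : Strip → Strip} {z : Strip} {m : ℝ}

theorem DerivBound.mono (h : DerivBound r C G z) (hCD : C ≤ D) : DerivBound r D G z :=
  ⟨h.1, fun k h1 h2 => (h.2 k h1 h2).trans (by exact_mod_cast hCD)⟩

theorem DerivBound.congr_shift (h : DerivBound r C G₂ z) (he : G₁ =ᶠ[𝓝 z] affineX 1 m ∘ G₂) :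
    DerivBound r C G₁ z :=
  ⟨h.1.congr_shift he, fun k h1 h2 => by
    rw [itD_congr_shift he (by omega)]; exact h.2 k h1 h2⟩

theorem DerivBound.congr (h : DerivBound r C G₂ z) (he : G₁ =ᶠ[𝓝 z] G₂) : DerivBound r C G₁ z :=
  h.congr_shift (eventuallyEq_shift_zero he)

theorem DerivBound.comp (hG : DerivBound r C G (F z)) (hF : DerivBound r D F z) :
    DerivBound r (compBound r C D) (G ∘ F) z := by
  refine ⟨hG.1.comp hF.1, fun k h1 h2 => ?_⟩
  -- The composition estimate needs bounds of the form D^i; as 1 + D ≥ 1, its i-th power dominates D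
  -- for every i ≥ 1.
  have hD1 : (1 : ℝ) ≤ 1 + D := by simp
  have h3 := norm_iteratedFDerivWithin_comp_le_of_contDiffWithinAt (n := k) (by omega)
    (g := coordRep G) (f := coordRep F) (x := toPlane z) (by rw [coordRep_toPlane]; exact hG.1) hF.1
    uniqueDiffOn_stripSet uniqueDiffOn_stripSet (fun w _ => coordRep_mem F w) (toPlane_mem z)
    C.2 (D := 1 + D) (fun i hi1 hi2 => by
      rw [coordRep_toPlane]; exact hG.2 i hi1 (hi2.trans h2))
    (fun i hi1 hi2 => (hF.2 i hi1 (hi2.trans h2)).trans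
      ((le_add_of_nonneg_left zero_le_one).trans (le_self_pow₀ hD1 (by omega))))
  rw [itD, coordRep_comp]
  refine h3.trans ?_
  simp only [compBound, NNReal.coe_mul, NNReal.coe_natCast, NNReal.coe_pow, NNReal.coe_add,
    NNReal.coe_one]
  have h4 : (k.factorial : ℝ) ≤ r.factorial := by exact_mod_cast Nat.factorial_le h2
  have h5 : (1 + (D : ℝ)) ^ k ≤ (1 + D) ^ r := pow_le_pow_right₀ hD1 h2
  exact mul_le_mul (mul_le_mul_of_nonneg_right h4 C.2) h5 (by positivity) (by positivity)

theorem derivBound_affineX {e : ℝ} (he : |e| = 1) (m : ℝ) (z : Strip) :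
    DerivBound r 1 (affineX e m) z :=
  ⟨smoothAt_affineX e m z, fun _ h1 _ => norm_itD_affineX_le he m z (by omega)⟩

/-- The bound for the iterates of a map. -/
noncomputable def iterBound (r : ℕ) (A : ℝ≥0) : ℕ → ℝ≥0
  | 0 => 1
  | m + 1 => compBound r (iterBound r A m) A

theorem iterBound_mono (r : ℕ) {A A' : ℝ≥0} {m m' : ℕ} (h : A ≤ A') (h' : m ≤ m') :
    iterBound r A m ≤ iterBound r A' m' := by
  have h1 : iterBound r A m ≤ iterBound r A m' :=
    monotone_nat_of_le_succ (f := iterBound r A) (fun n => le_compBound r _ _) h'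
  refine h1.trans ?_
  induction m' with
  | zero => exact le_rfl
  | succ n ih =>
    clear h1 h'
    have : ∀ n, iterBound r A n ≤ iterBound r A' n := fun n => by
      induction n with
      | zero => exact le_rfl
      | succ n ih => exact compBound_mono r ih h
    exact this _

theorem DerivBound.iterate (h : ∀ z, DerivBound r C G z) (m : ℕ) (z : Strip) :
    DerivBound r (iterBound r C m) (G^[m]) z := by
  induction m generalizing z with
  | zero =>
    rw [Function.iterate_zero, ← affineX_one_zero]
    exact derivBound_affineX (by simp) 0 z
  | succ n ih =>
    rw [Function.iterate_succ]
    exact (ih (G z)).comp (h z)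

end

/-! ### Comparison with the `C^r` sizes -/

theorem enorm_partialD_le (G : Strip → Strip) {k : ℕ} (i : Fin k → Fin 2) (z : Strip) :
    ‖partialD G i z‖ₑ ≤ ‖itD k G z‖ₑ := by
  have h : ‖partialD G i z‖ ≤ ‖itD k G z‖ := by
    refine (ContinuousMultilinearMap.le_opNorm _ _).trans ?_
    simp [itD]
  simpa only [← ofReal_norm] using ENNReal.ofReal_le_ofReal h

/-- Expansion in the standard basis has 2^k terms. This passes from the partial derivatives in
`crSize` to operator norms. -/
theorem norm_le_of_forall_single {k : ℕ}
    (m : ContinuousMultilinearMap ℝ (fun _ : Fin k => Plane) Plane) {C : ℝ} (hC : 0 ≤ C)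
    (h : ∀ i : Fin k → Fin 2, ‖m fun j => EuclideanSpace.single (i j) (1 : ℝ)‖ ≤ C) :
    ‖m‖ ≤ 2 ^ k * C := by
  refine ContinuousMultilinearMap.opNorm_le_bound (by positivity) fun v => ?_
  have hv : v = fun j => ∑ i : Fin 2, v j i • EuclideanSpace.single i (1 : ℝ) := by
    funext j; ext l; fin_cases l <;> simp [Fin.sum_univ_two]
  have h1 : m v = ∑ i : Fin k → Fin 2, (∏ j, v j (i j)) •
      m fun j => EuclideanSpace.single (i j) (1 : ℝ) := by
    conv_lhs => rw [hv]
    have := m.toMultilinearMap.map_sum (α := fun _ => Fin 2)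
      (fun j i => v j i • EuclideanSpace.single i (1 : ℝ))
    refine this.trans (Finset.sum_congr rfl fun i _ => ?_)
    exact m.map_smul_univ (fun j => v j (i j)) _
  rw [h1]
  refine (norm_sum_le _ _).trans ?_
  have h2 : ∀ i : Fin k → Fin 2, ‖(∏ j, v j (i j)) •
      m fun j => EuclideanSpace.single (i j) (1 : ℝ)‖ ≤ C * ∏ j, ‖v j‖ := fun i => by
    rw [norm_smul, norm_prod, mul_comm]
    gcongr with j
    · exact h i
    · exact PiLp.norm_apply_le _ _
  refine (Finset.sum_le_sum fun i _ => h2 i).trans ?_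
  simp
  ring_nf
  rfl

section
variable {r : ℕ} {C : ℝ≥0} {E : Set Strip} {φ : Strip → Annulus} {G : Strip → Strip} {z : Strip}

theorem enorm_itD_le (h : DerivBound r C G z) {k : ℕ} (hk : k ∈ Icc 1 r) : ‖itD k G z‖ₑ ≤ C := by
  rw [← ofReal_norm, ENNReal.ofReal_le_iff_le_toReal ENNReal.coe_ne_top]
  exact h.2 k hk.1 hk.2

theorem crSize_le (h : ∀ z ∈ E, DerivBound r C G z) : crSize r G E ≤ C :=
  iSup₂_le fun z hz => iSup₂_le fun _ hk => iSup_le fun i =>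
    (enorm_partialD_le G i z).trans (enorm_itD_le (h z hz) hk)

theorem crSizeA_le (h : ∀ z ∈ E, ∃ G, ContinuousAt G z ∧ φ =ᶠ[𝓝 z] proj ∘ G ∧ DerivBound r C G z) :
    crSizeA r φ E ≤ C :=
  iSup₂_le fun z hz => iSup₂_le fun k hk => iSup_le fun i => by
    obtain ⟨G, hG, hφ, hb⟩ := h z hz
    refine (enorm_partialD_le _ i z).trans ?_
    rw [itD_localLift hG hφ (by have := hk.1; omega)]
    exact enorm_itD_le hb hk

theorem derivBound_of_enorm_partialD_le (hs : SmoothAt G z)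
    (h : ∀ k ∈ Icc 1 r, ∀ i : Fin k → Fin 2, ‖partialD G i z‖ₑ ≤ C) :
    DerivBound r (2 ^ r * C) G z := by
  refine ⟨hs, fun k h1 h2 => ?_⟩
  refine (norm_le_of_forall_single _ C.2 fun i => ?_).trans
    (b := (2 : ℝ) ^ k * C) ?_
  · have := h k ⟨h1, h2⟩ i
    rw [← ofReal_norm, ENNReal.ofReal_le_iff_le_toReal ENNReal.coe_ne_top] at this
    exact this
  · push_cast
    gcongr
    norm_num

theorem enorm_partialD_le_iSup {G : Strip → Strip → Strip} (hz : z ∈ E) {k : ℕ}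
    (hk : k ∈ Icc 1 r) (i : Fin k → Fin 2) : ‖partialD (G z) i z‖ₑ ≤
      ⨆ z ∈ E, ⨆ k ∈ Icc 1 r, ⨆ i : Fin k → Fin 2, ‖partialD (G z) i z‖ₑ :=
  (le_iSup (fun i : Fin k → Fin 2 => ‖partialD (G z) i z‖ₑ) i).trans
    ((le_iSup₂ (f := fun k (_ : k ∈ Icc 1 r) => ⨆ i : Fin k → Fin 2, ‖partialD (G z) i z‖ₑ)
      k hk).trans (le_iSup₂ (f := fun z (_ : z ∈ E) => ⨆ k ∈ Icc 1 r, ⨆ i : Fin k → Fin 2,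
        ‖partialD (G z) i z‖ₑ) z hz))

theorem derivBound_of_crSize_le (h : crSize r G E ≤ C) (hz : z ∈ E) (hs : SmoothAt G z) :
    DerivBound r (2 ^ r * C) G z :=
  derivBound_of_enorm_partialD_le hs fun _ hk i =>
    (enorm_partialD_le_iSup (G := fun _ => G) hz hk i).trans h

theorem derivBound_of_crSizeA_le (h : crSizeA r φ E ≤ C) (hz : z ∈ E) (hG : ContinuousAt G z)
    (hφ : φ =ᶠ[𝓝 z] proj ∘ G) (hs : SmoothAt G z) : DerivBound r (2 ^ r * C) G z := by
  obtain ⟨m, hm⟩ := localLift_eventuallyEq hG hφ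
  have h1 : DerivBound r (2 ^ r * C) (localLift φ z) z :=
    derivBound_of_enorm_partialD_le (hs.congr_shift hm) fun k hk i =>
      (enorm_partialD_le_iSup (G := fun z => localLift φ z) hz hk i).trans h
  refine h1.congr_shift (m := -m) ?_
  filter_upwards [hm] with w hw
  rw [Function.comp, hw]
  exact (congrFun (affineX_neg_comp_self m) _).symm

/-- Compactness makes the sizes of the given data finite. This matters because `ENNReal.toNNReal`
sends `⊤` to 0. -/
theorem exists_derivBound (r : ℕ) {K : Set Strip} (hK : IsCompact K) (h : ∀ z ∈ K, SmoothAt G z) :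
    ∃ C, ∀ z ∈ K, DerivBound r C G z := by
  have h1 : ∀ k : ℕ, ContinuousOn (fun z => itD k G z) K := fun k z hz => by
    have h2 : ContDiffWithinAt ℝ 0 (iteratedFDerivWithin ℝ k (coordRep G) stripSet) stripSet
        (toPlane z) := (h z hz).iteratedFDerivWithin_right (m := 0) uniqueDiffOn_stripSet
          (by rw [zero_add]; exact_mod_cast le_top) (toPlane_mem z)
    have h3 : Tendsto _ (𝓝[stripSet] _) (𝓝 _) := h2.continuousWithinAt
    rw [← map_toPlane_nhds, tendsto_map'_iff] at h3
    exact ContinuousAt.continuousWithinAt h3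
  choose B hB using fun k => hK.exists_bound_of_continuousOn (h1 k)
  refine ⟨∑ k ∈ Finset.range (r + 1), (B k).toNNReal, fun z hz => ⟨h z hz, fun k _ hk => ?_⟩⟩
  refine (hB k z hz).trans ((Real.le_coe_toNNReal _).trans ?_)
  exact_mod_cast Finset.single_le_sum (f := fun k => (B k).toNNReal) (fun _ _ => zero_le)
    (Finset.mem_range.2 (by omega))

end

/-! ### Lifts of pseudo-rotations -/

theorem mul_apply_homeo (G K : Strip ≃ₜ Strip) (z : Strip) : (G * K) z = G (K z) := rfl

theorem inv_apply_self_homeo (G : Strip ≃ₜ Strip) (z : Strip) : G⁻¹ (G z) = z :=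
  G.symm_apply_apply z

theorem apply_inv_self_homeo (G : Strip ≃ₜ Strip) (z : Strip) : G (G⁻¹ z) = z :=
  G.apply_symm_apply z

theorem deckT_apply (z : Strip) : deckT z = affineX 1 1 z :=
  Prod.ext (by simp [deckT, affineX]) rfl

@[simp] theorem proj_deckT (z : Strip) : proj (deckT z) = proj z := by
  have h := proj_affineX_one 1 z
  rwa [Int.cast_one, ← deckT_apply] at h

theorem reflJ_apply (z : Strip) : reflJ z = affineX (-1) 0 z :=
  Prod.ext (by simp [reflJ, affineX]) rfl

theorem affineX_one_add (m n : ℝ) (z : Strip) :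
    affineX 1 m (affineX 1 n z) = affineX 1 (m + n) z := by
  simp [affineX, add_comm, add_left_comm]

theorem deckT_zpow_apply (b : ℤ) (z : Strip) : (deckT ^ b) z = affineX 1 b z := by
  induction b generalizing z with
  | zero => simp [affineX]
  | succ n ih =>
    rw [zpow_add_one, mul_apply_homeo, ih, deckT_apply, affineX_one_add]
    push_cast; rfl
  | pred n ih =>
    have h : deckT⁻¹ z = affineX 1 (-1) z := by
      apply deckT.injective
      rw [apply_inv_self_homeo, deckT_apply, affineX_one_add]
      simp [affineX_one_zero]
    rw [zpow_sub_one, mul_apply_homeo, ih, h, affineX_one_add]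
    push_cast; rfl

/-- The difference of two lifts is continuous and integer-valued, hence constant on a preconnected
set. -/
theorem exists_int_shift_on {X : Type*} [TopologicalSpace X] {s : Set X} (hs : IsPreconnected s)
    {g h : X → Strip} (hg : ContinuousOn g s) (hh : ContinuousOn h s)
    (hp : ∀ x ∈ s, proj (g x) = proj (h x)) : ∃ m : ℤ, ∀ x ∈ s, g x = affineX 1 m (h x) := by
  rcases s.eq_empty_or_nonempty with rfl | ⟨x₀, hx₀⟩
  · exact ⟨0, fun x hx => absurd hx (notMem_empty x)⟩
  choose! m hm using fun x hx => exists_int_of_proj_eq (hp x hx)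
  refine ⟨m x₀, fun x hx => ?_⟩
  rw [hm x hx]
  congr 2
  have hd : ContinuousOn (fun x => (g x).1 - (h x).1) s :=
    (continuous_fst.comp_continuousOn hg).sub (continuous_fst.comp_continuousOn hh)
  have hval : ∀ x ∈ s, (g x).1 - (h x).1 = m x := fun x hx => by
    conv_lhs => rw [hm x hx]
    simp [affineX]
  have key : ∀ x ∈ s, ∀ y ∈ s, ¬ m x < m y := fun x hx y hy hlt => by
    have hlt' : (m x : ℝ) + 1 ≤ m y := by exact_mod_cast hlt
    obtain ⟨w, hw, hw'⟩ := hs.intermediate_value hx hy hd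
      (show (m x : ℝ) + 1 / 2 ∈ _ by
        simp only [hval x hx, hval y hy, mem_Icc]; constructor <;> linarith)
    simp only [hval w hw] at hw'
    have h1 : (2 * m w : ℝ) = 2 * m x + 1 := by linarith
    have h2 : 2 * m w = 2 * m x + 1 := by exact_mod_cast h1
    omega
  exact le_antisymm (not_lt.1 (key _ hx₀ _ hx)) (not_lt.1 (key _ hx _ hx₀))

theorem exists_int_shift {X : Type*} [TopologicalSpace X] [PreconnectedSpace X]
    {g h : X → Strip} (hg : Continuous g) (hh : Continuous h)
    (hp : ∀ x, proj (g x) = proj (h x)) : ∃ m : ℤ, ∀ x, g x = affineX 1 m (h x) := by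
  obtain ⟨m, hm⟩ := exists_int_shift_on isPreconnected_univ hg.continuousOn hh.continuousOn
    fun x _ => hp x
  exact ⟨m, fun x => hm x (mem_univ x)⟩

theorem exists_mem_square (z : Strip) : ∃ (m : ℤ) (w : Strip), w ∈ square ∧ z = affineX 1 m w :=
  ⟨⌊z.1⌋, (Int.fract z.1, z.2), ⟨Int.fract_nonneg _, (Int.fract_lt_one _).le⟩,
    Prod.ext (by simp [affineX]) rfl⟩

theorem isCompact_square : IsCompact square := by
  have : square = Icc (0 : ℝ) 1 ×ˢ univ := by ext z; simp [square]
  rw [this]; exact isCompact_Icc.prod isCompact_univ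

/-- The homeomorphisms of the strip that preserve both boundary lines. -/
def bdryGroup : Subgroup (Strip ≃ₜ Strip) where
  carrier := {G | ∀ z, ((G z).2 = 0 ↔ z.2 = 0) ∧ ((G z).2 = 1 ↔ z.2 = 1)}
  mul_mem' := fun {G K} hG hK z => ⟨(hG (K z)).1.trans (hK z).1, (hG (K z)).2.trans (hK z).2⟩
  one_mem' := fun _ => ⟨Iff.rfl, Iff.rfl⟩
  inv_mem' := fun {G} hG z => by
    have := hG (G⁻¹ z)
    rw [apply_inv_self_homeo] at this
    exact ⟨this.1.symm, this.2.symm⟩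

theorem deckT_mem_bdryGroup : deckT ∈ bdryGroup := fun _ => ⟨Iff.rfl, Iff.rfl⟩

theorem reflJ_mem_bdryGroup : reflJ ∈ bdryGroup := fun _ => ⟨Iff.rfl, Iff.rfl⟩

theorem interior_of_mem_bdryGroup {G : Strip ≃ₜ Strip} (hG : G ∈ bdryGroup) {z : Strip}
    (hz : z.2 ∈ Ioo (0 : unitInterval) 1) : (G z).2 ∈ Ioo (0 : unitInterval) 1 :=
  ⟨unitInterval.pos_iff_ne_zero.2 fun h => hz.1.ne' ((hG z).1.1 h),
    unitInterval.lt_one_iff_ne_one.2 fun h => hz.2.ne ((hG z).2.1 h)⟩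

theorem surjective_of_map_add_one {g : ℝ → ℝ} (hg : Continuous g) (h : ∀ x, g (x + 1) = g x + 1) :
    Function.Surjective g := by
  have hper : Function.Periodic (fun x => g x - x) 1 := fun x => by simp only [h]; ring
  have hn : ∀ n : ℤ, g n = g 0 + n := fun n => by
    have := hper.int_mul_eq n
    simp only [mul_one, sub_zero] at this
    linarith
  intro y
  obtain ⟨a, ha⟩ := exists_int_lt (y - g 0)
  obtain ⟨b, hb⟩ := exists_int_gt (y - g 0)
  exact mem_range_of_exists_le_of_exists_ge hg ⟨a, by rw [hn]; linarith⟩ ⟨b, by rw [hn]; linarith⟩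

section
variable {f : Annulus ≃ₜ Annulus} {F : Strip ≃ₜ Strip} {α : ℝ}

theorem lift_shift {d : ℤ} (h : ∀ z, F (deckT z) = affineX 1 d (F z)) (m : ℤ) (z : Strip) :
    F (affineX 1 m z) = affineX 1 ((d * m : ℤ) : ℝ) (F z) := by
  induction m generalizing z with
  | zero => simp [affineX_one_zero]
  | succ n ih =>
    have : affineX 1 ((n + 1 : ℤ) : ℝ) z = affineX 1 (n : ℤ) (deckT z) := by
      rw [deckT_apply, affineX_one_add]; push_cast; rfl
    rw [this, ih, h, affineX_one_add]; push_cast; ring_nf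
  | pred n ih =>
    have h1 := h (affineX 1 ((-n - 1 : ℤ) : ℝ) z)
    have : deckT (affineX 1 ((-n - 1 : ℤ) : ℝ) z) = affineX 1 ((-n : ℤ) : ℝ) z := by
      rw [deckT_apply, affineX_one_add]; push_cast; ring_nf
    rw [this, ih] at h1
    have h2 := congrArg (affineX 1 (-d)) h1
    rw [affineX_one_add, affineX_one_add] at h2
    rw [show ((-d : ℝ) + d) = 0 by ring, affineX_one_zero, id] at h2
    rw [← h2]; push_cast; ring_nf

theorem abs_le_one_of_pow_bounded {d : ℤ}
    (h : Tendsto (fun k : ℕ => ((d : ℝ) ^ k - 1) / k) atTop (𝓝 0)) : |d| ≤ 1 := by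
  by_contra! hd
  have h1 := (Metric.tendsto_atTop.1 h) 1 one_pos
  obtain ⟨N, hN⟩ := h1
  have h2 := hN (N + 1) (by omega)
  rw [Real.dist_eq, sub_zero, abs_div, Nat.abs_cast, div_lt_one (by positivity)] at h2
  have h3 : (2 : ℝ) ^ (N + 1) ≤ |(d : ℝ)| ^ (N + 1) := by
    have : (2 : ℝ) ≤ |(d : ℝ)| := by exact_mod_cast hd
    gcongr
  have h4 : |(d : ℝ)| ^ (N + 1) - 1 ≤ |(d : ℝ) ^ (N + 1) - 1| := by
    rw [← abs_pow]
    simpa using abs_sub_abs_le_abs_sub ((d : ℝ) ^ (N + 1)) 1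
  have h5 : ((N + 1 : ℕ) : ℝ) + 1 ≤ 2 ^ (N + 1) := by exact_mod_cast Nat.lt_two_pow_self
  linarith

/-- F T = T^d F for an integer degree d, as F ∘ T and F have the same projection up to `f`. If |d| ≥
2, the orbits of z and T z separate exponentially; d = 0 contradicts injectivity; d = -1 forces α =
-α. In each remaining case d = 1. -/
theorem lift_comm (hF : IsLift F f) (hρ : HasRotationNumber F α) (hα : α ≠ 0) (z : Strip) :
    F (deckT z) = deckT (F z) := by
  obtain ⟨d, hd⟩ := exists_int_shift (g := fun z => F (deckT z)) (h := F)
    (F.continuous.comp deckT.continuous) F.continuous fun z => by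
      rw [hF, hF, proj_deckT]
  have hiter : ∀ (k : ℕ) (z : Strip), (F ^ k) (deckT z) = affineX 1 ((d ^ k : ℤ) : ℝ) ((F ^ k) z) := by
    intro k
    induction k with
    | zero => intro z; simp [deckT_apply]
    | succ k ih =>
      intro z
      rw [pow_succ', mul_apply_homeo, ih, lift_shift hd, mul_apply_homeo, pow_succ']
  have h1 : |d| ≤ 1 := by
    apply abs_le_one_of_pow_bounded
    have h2 := (hρ (deckT (0, 0))).sub (hρ (0, 0))
    rw [sub_self] at h2
    refine h2.congr fun k => ?_
    rw [hiter, ← sub_div]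
    simp [affineX, deckT_apply]
    ring
  have h2 : d ≠ 0 := by
    rintro rfl
    have h3 := hd (0, 0)
    rw [Int.cast_zero, affineX_one_zero] at h3
    have h4 := congrArg Prod.fst (F.injective h3)
    simp [deckT_apply, affineX] at h4
  have h3 : d ≠ -1 := by
    rintro rfl
    -- For d = -1 this function is periodic, hence bounded. Along an orbit u/k tends to 0, but it
    -- also tends to α + α.
    let u : Strip → ℝ := fun z => (F z).1 + z.1
    have hu : Continuous u := (continuous_fst.comp F.continuous).add continuous_fst
    obtain ⟨C, hC⟩ := isCompact_square.exists_bound_of_continuousOn hu.continuousOn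
    have hC' : ∀ z, |u z| ≤ C := fun z => by
      obtain ⟨m, w, hw, rfl⟩ := exists_mem_square z
      have : u (affineX 1 m w) = u w := by
        simp only [u, lift_shift hd]
        simp [affineX]; ring
      rw [this]; exact hC w hw
    have h4 := hρ (0, 0)
    simp only [sub_zero] at h4
    have h5 := h4.comp (tendsto_add_atTop_nat 1)
    have hk : Tendsto (fun k : ℕ => ((k + 1 : ℕ) : ℝ) / k) atTop (𝓝 1) := by
      have := (tendsto_const_nhds (x := (1 : ℝ))).add tendsto_one_div_atTop_nhds_zero_nat
      rw [add_zero] at this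
      refine this.congr' ?_
      filter_upwards [eventually_gt_atTop 0] with k hk
      have : (k : ℝ) ≠ 0 := by exact_mod_cast hk.ne'
      field_simp; push_cast; ring
    have h6 := h4.add (h5.mul hk)
    have h7 : Tendsto (fun k : ℕ => C / (k : ℝ)) atTop (𝓝 0) := tendsto_const_div_atTop_nhds_zero_nat C
    have h8 := squeeze_zero_norm' (f := fun k : ℕ => u ((F ^ k) (0, 0)) / k) (a := fun k => C / (k : ℝ))
      (Eventually.of_forall fun k => by
        rw [norm_div, Real.norm_eq_abs, Real.norm_natCast]
        exact div_le_div_of_nonneg_right (hC' _) (by positivity)) h7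
    have h9 := tendsto_nhds_unique (h8.congr' ?_) h6
    · rw [mul_one] at h9
      exact hα (by linarith)
    · filter_upwards [eventually_gt_atTop 0] with k hk
      have hk1 : (k : ℝ) ≠ 0 := by exact_mod_cast hk.ne'
      have hk2 : ((k + 1 : ℕ) : ℝ) ≠ 0 := by positivity
      simp only [Function.comp, u]
      rw [div_mul_div_cancel₀ hk2, ← add_div, pow_succ', mul_apply_homeo, add_comm]
  have h4 : d = 1 := by
    have := abs_le.1 h1
    omega
  rw [hd, h4, deckT_apply, Int.cast_one]

theorem lift_smooth (hf : IsPseudoRotation f) (hF : IsLift F f) (z : Strip) :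
    SmoothAt F z ∧ SmoothAt F.symm z ∧ jac F z = 1 := by
  have h1 : (f ∘ proj) = proj ∘ F := funext fun z => (hF z).symm
  have h2 : (f.symm ∘ proj) = proj ∘ F.symm := funext fun z => by
    apply f.injective
    rw [Function.comp, f.apply_symm_apply, Function.comp, ← hF, F.apply_symm_apply]
  exact ⟨(smoothAtA_iff F.continuous.continuousAt h1.eventuallyEq).1 (hf.smooth z),
    (smoothAtA_iff F.symm.continuous.continuousAt h2.eventuallyEq).1 (hf.smooth_symm z),
    (jacA_eq F.continuous.continuousAt h1.eventuallyEq).symm.trans (hf.area z)⟩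

theorem constant_of_bdry {g : ℝ → unitInterval} (hg : Continuous g)
    (h : ∀ x, g x = 0 ∨ g x = 1) : (∀ x, g x = 0) ∨ ∀ x, g x = 1 := by
  by_contra! hne
  obtain ⟨⟨a, ha⟩, b, hb⟩ := hne
  have ha := (h a).resolve_left ha
  have hb := (h b).resolve_right hb
  obtain ⟨x, hx⟩ := mem_range_of_exists_le_of_exists_ge (c := (1 / 2 : ℝ))
    (continuous_subtype_val.comp hg) ⟨b, by simp [hb]⟩ ⟨a, by simp [ha]; norm_num⟩
  rcases h x with h | h <;> simp [h] at hx

/-- Interior points have interior images, so F⁻¹ sends each boundary line into a boundary line. An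
exchange of the lines would make F decreasing on the top line, which is incompatible with commuting
with T. -/
theorem mem_bdryGroup_of_lift (hcomm : ∀ z, F (deckT z) = deckT (F z)) (hs : ∀ z, SmoothAt F z)
    (hj : ∀ z, 0 < jac F z) : F ∈ bdryGroup := by
  have hsymm : ∀ z, F.symm (deckT z) = deckT (F.symm z) := fun z => by
    apply F.injective; rw [hcomm, F.apply_symm_apply, F.apply_symm_apply]
  have hbd : ∀ w : Strip, w.2 = 0 ∨ w.2 = 1 → (F.symm w).2 = 0 ∨ (F.symm w).2 = 1 := by
    intro w hw
    by_contra! h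
    have := (hs (F.symm w)).interior_of_jac_ne_zero (hj _).ne'
      ⟨unitInterval.pos_iff_ne_zero.2 h.1, unitInterval.lt_one_iff_ne_one.2 h.2⟩
    rw [F.apply_symm_apply] at this
    rcases hw with hw | hw <;> rw [hw] at this
    · exact lt_irrefl _ this.1
    · exact lt_irrefl _ this.2
  have hsurj : ∀ (i j : unitInterval), (∀ x : ℝ, (F.symm (x, i)).2 = j) → ∀ y, ∃ x : ℝ,
      F.symm (x, i) = (y, j) := by
    intro i j h y
    obtain ⟨x, hx⟩ := surjective_of_map_add_one (g := fun x => (F.symm (x, i)).1) (by fun_prop)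
      (fun x => by
        have := hsymm (x, i)
        simp only [deckT_apply, affineX, one_mul] at this
        simp [this]) y
    exact ⟨x, Prod.ext hx (h x)⟩
  have hb0 := constant_of_bdry (g := fun x => (F.symm (x, 0)).2) (by fun_prop)
    fun x => hbd (x, 0) (Or.inl rfl)
  have hb1 := constant_of_bdry (g := fun x => (F.symm (x, 1)).2) (by fun_prop)
    fun x => hbd (x, 1) (Or.inr rfl)
  rcases hb0 with h0 | h0
  · have h1 : ∀ x : ℝ, (F.symm (x, 1)).2 = 1 := by
      refine hb1.resolve_left fun h1 => ?_
      obtain ⟨x, hx⟩ := hsurj 0 0 h0 (F.symm (0, 1)).1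
      have h2 : F.symm (x, 0) = F.symm (0, 1) := hx.trans (Prod.ext rfl (h1 0).symm)
      have := congrArg Prod.snd (F.symm.injective h2)
      exact zero_ne_one this
    refine fun z => ⟨⟨fun h => ?_, fun h => ?_⟩, ⟨fun h => ?_, fun h => ?_⟩⟩
    · have := h0 (F z).1
      rwa [show ((F z).1, (0 : unitInterval)) = F z from Prod.ext rfl h.symm,
        F.symm_apply_apply] at this
    · obtain ⟨x, hx⟩ := hsurj 0 0 h0 z.1
      have h2 : z = F.symm (x, 0) := hx.symm ▸ Prod.ext rfl h
      rw [h2, F.apply_symm_apply]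
    · have := h1 (F z).1
      rwa [show ((F z).1, (1 : unitInterval)) = F z from Prod.ext rfl h.symm,
        F.symm_apply_apply] at this
    · obtain ⟨x, hx⟩ := hsurj 1 1 h1 z.1
      have h2 : z = F.symm (x, 1) := hx.symm ▸ Prod.ext rfl h
      rw [h2, F.apply_symm_apply]
  · exfalso
    have h2 : ∀ y : ℝ, (F (y, 1)).2 = 0 := fun y => by
      obtain ⟨x, hx⟩ := hsurj 0 1 h0 y
      rw [← hx, F.apply_symm_apply]
    have hanti : StrictAnti fun y : ℝ => (F (y, 1)).1 :=
      strictAnti_of_deriv_neg fun y => by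
        obtain ⟨d, hd, hd'⟩ := (hs (y, 1)).exists_deriv_neg (hj _) (h2 y)
        rw [hd'.deriv]; exact hd
    have h3 := hcomm (0, 1)
    have h4 := hanti (zero_lt_one' ℝ)
    simp only [deckT_apply, affineX, one_mul, zero_add] at h3
    simp only [h3] at h4
    linarith

/-- The properties of lifts of pseudo-rotations that are used below. -/
structure GoodLift (f : Annulus ≃ₜ Annulus) (F : Strip ≃ₜ Strip) (α : ℝ) : Prop where
  lift : IsLift F f
  comm : ∀ z, F (deckT z) = deckT (F z)
  smooth : ∀ z, SmoothAt F z
  smooth_symm : ∀ z, SmoothAt F.symm z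
  bdry : F ∈ bdryGroup
  irrational : Irrational α
  pos : ∀ a b : ℤ, 0 < a * α + b → ∀ x : ℝ, x < (liftPow F a b (x, 0)).1
  neg : ∀ a b : ℤ, a * α + b < 0 → ∀ x : ℝ, (liftPow F a b (x, 0)).1 < x

/-- An injective continuous function of the line is strictly monotone, and commuting with T excludes
the decreasing case. -/
theorem strictMono_bottom (hcomm : ∀ z, F (deckT z) = deckT (F z)) (hb : F ∈ bdryGroup) :
    StrictMono fun x : ℝ => (F (x, 0)).1 := by
  have hinj : Function.Injective fun x : ℝ => (F (x, 0)).1 := fun x y h => by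
    have : F (x, 0) = F (y, 0) := Prod.ext h (((hb (x, 0)).1.2 rfl).trans ((hb (y, 0)).1.2 rfl).symm)
    exact congrArg Prod.fst (F.injective this)
  refine ((show Continuous fun x : ℝ => (F (x, 0)).1 by fun_prop).strictMono_of_inj
    hinj).resolve_right fun h => ?_
  have h1 := h (zero_lt_one' ℝ)
  have h3 := hcomm (0, 0)
  simp only [deckT_apply, affineX, one_mul, zero_add] at h3
  simp only [h3] at h1
  linarith

/-- The action of a lift on the bottom boundary line. -/
noncomputable def bottomLift (hcomm : ∀ z, F (deckT z) = deckT (F z)) (hb : F ∈ bdryGroup) :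
    CircleDeg1Lift where
  toFun x := (F (x, 0)).1
  monotone' := (strictMono_bottom hcomm hb).monotone
  map_add_one' x := by
    have h3 := hcomm (x, 0)
    simp only [deckT_apply, affineX, one_mul] at h3
    rw [h3]

theorem bottomLift_spec (hcomm : ∀ z, F (deckT z) = deckT (F z)) (hb : F ∈ bdryGroup) (x : ℝ) :
    F (x, 0) = (bottomLift hcomm hb x, 0) :=
  Prod.ext rfl ((hb (x, 0)).1.2 rfl)

theorem symm_comm (hcomm : ∀ z, F (deckT z) = deckT (F z)) (z : Strip) :
    F⁻¹ (deckT z) = deckT (F⁻¹ z) := by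
  apply F.injective; rw [hcomm, apply_inv_self_homeo, apply_inv_self_homeo]

/-- The action of a lift on the bottom boundary line, as an invertible map. -/
noncomputable def bottomUnit (hcomm : ∀ z, F (deckT z) = deckT (F z)) (hb : F ∈ bdryGroup) :
    CircleDeg1Liftˣ where
  val := bottomLift hcomm hb
  inv := bottomLift (F := F⁻¹) (symm_comm hcomm) (inv_mem hb)
  val_inv := by
    ext x
    have h : (bottomLift hcomm hb (bottomLift (F := F⁻¹) (symm_comm hcomm) (inv_mem hb) x), (0 : unitInterval)) =
        (x, 0) := by
      rw [← bottomLift_spec, ← bottomLift_spec (F := F⁻¹), apply_inv_self_homeo]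
    exact congrArg Prod.fst h
  inv_val := by
    ext x
    have h : (bottomLift (F := F⁻¹) (symm_comm hcomm) (inv_mem hb) (bottomLift hcomm hb x), (0 : unitInterval)) =
        (x, 0) := by
      rw [← bottomLift_spec (F := F⁻¹), ← bottomLift_spec, inv_apply_self_homeo]
    exact congrArg Prod.fst h

theorem zpow_bottom (hcomm : ∀ z, F (deckT z) = deckT (F z)) (hb : F ∈ bdryGroup) (a : ℤ) (x : ℝ) :
    (F ^ a) (x, 0) = (((bottomUnit hcomm hb ^ a : CircleDeg1Liftˣ) : CircleDeg1Lift) x, 0) := by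
  induction a generalizing x with
  | zero => rfl
  | succ n ih =>
    rw [zpow_add_one, zpow_add_one, mul_apply_homeo, bottomLift_spec hcomm hb, ih]
    rfl
  | pred n ih =>
    rw [zpow_sub_one, zpow_sub_one, mul_apply_homeo,
      bottomLift_spec (F := F⁻¹) (symm_comm hcomm) (inv_mem hb), ih]
    rfl

/-- On the bottom line F acts with translation number α and F^{a,b} with a α + b; a nonzero sign of
the latter decides the direction in which every point moves. -/
theorem goodLift_of_isPseudoRotation (hf : IsPseudoRotation f) (hF : IsLift F f)
    (hρ : HasRotationNumber F α) (hα : α ∈ Ioo (0 : ℝ) 1) : GoodLift f F α := by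
  have hcomm := lift_comm hF hρ hα.1.ne'
  have hsm := lift_smooth hf hF
  have hb : F ∈ bdryGroup :=
    mem_bdryGroup_of_lift hcomm (fun z => (hsm z).1) fun z => by rw [(hsm z).2.2]; exact one_pos
  have hτ : (bottomLift hcomm hb).translationNumber = α := by
    apply CircleDeg1Lift.translationNumber_eq_of_tendsto₀
    refine (hρ (0, 0)).congr fun k => ?_
    have := zpow_bottom hcomm hb k 0
    rw [zpow_natCast, zpow_natCast] at this
    rw [this]
    simp only [sub_zero, ← CircleDeg1Lift.coe_pow, Units.val_pow_eq_pow_val]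
    rfl
  have hτz : ∀ a : ℤ, ((bottomUnit hcomm hb ^ a : CircleDeg1Liftˣ) :
      CircleDeg1Lift).translationNumber = a * α := fun a => by
    rw [CircleDeg1Lift.translationNumber_zpow]; exact congrArg _ hτ
  have hbot : ∀ (a b : ℤ) (x : ℝ), (liftPow F a b (x, 0)).1 =
      ((bottomUnit hcomm hb ^ a : CircleDeg1Liftˣ) : CircleDeg1Lift) x + b := fun a b x => by
    rw [liftPow, mul_apply_homeo, zpow_bottom hcomm hb, deckT_zpow_apply]
    simp [affineX]
  refine ⟨hF, hcomm, fun z => (hsm z).1, fun z => (hsm z).2.1, hb, ?_, fun a b h x => ?_,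
    fun a b h x => ?_⟩
  -- A rational translation number gives a periodic point on the boundary circle.
  · rintro ⟨q, rfl⟩
    have hcont : Continuous (bottomLift hcomm hb) :=
      show Continuous fun x : ℝ => (F (x, 0)).1 by fun_prop
    have h1 : (bottomLift hcomm hb).translationNumber = (q.num : ℝ) / q.den := by
      rw [hτ]; exact Rat.cast_def q
    obtain ⟨x, hx⟩ := (CircleDeg1Lift.translationNumber_eq_rat_iff _ hcont q.pos).1 h1
    have h2 := zpow_bottom hcomm hb q.den x
    rw [zpow_natCast, zpow_natCast, Units.val_pow_eq_pow_val] at h2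
    have h2' : (F ^ q.den) (x, 0) = affineX 1 q.num (x, 0) :=
      h2.trans (Prod.ext (by rw [affineX, one_mul]; exact hx) rfl)
    have h3 : ∀ (k : ℕ) z, proj ((F ^ k) z) = (f ^ k) (proj z) := fun k => by
      induction k with
      | zero => intro z; rfl
      | succ k ih => intro z; rw [pow_succ, pow_succ, mul_apply_homeo, ih, hF]; rfl
    refine hf.no_periodic q.den q.pos (proj (x, 0)) ?_
    rw [← h3, h2', proj_affineX_one]
  · have := CircleDeg1Lift.lt_map_of_int_lt_translationNumber _ (n := -b)
      (by rw [hτz a]; push_cast; linarith) x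
    rw [hbot]; push_cast at this; linarith
  · have := CircleDeg1Lift.map_lt_of_translationNumber_lt_int _ (n := -b)
      (by rw [hτz a]; push_cast; linarith) x
    rw [hbot]; push_cast at this; linarith

end

/-! ### Curves and their lifts -/

/-- Maps from the strip to the annulus lift to the universal covering. -/
theorem exists_lift_strip {φ : Strip → Annulus} (hφ : Continuous φ) {z₀ w₀ : Strip}
    (h : proj w₀ = φ z₀) :
    ∃ G : Strip → Strip, Continuous G ∧ G z₀ = w₀ ∧ ∀ z, proj (G z) = φ z := by
  -- Clamping the second coordinate extends the map to the plane, where the lifting theorem for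
  -- coverings applies.
  let u : C(ℝ × ℝ, UnitAddCircle) := ⟨fun p => (φ (p.1, projIcc 0 1 zero_le_one p.2)).1, by
    have : Continuous (projIcc (0 : ℝ) 1 zero_le_one) := continuous_projIcc
    fun_prop⟩
  have hu : ∀ z : Strip, u (z.1, z.2) = (φ z).1 := fun z => by
    show (φ (z.1, projIcc 0 1 zero_le_one (z.2 : ℝ))).1 = _
    rw [projIcc_val]
  have h0 : ((w₀.1 : ℝ) : UnitAddCircle) = u (z₀.1, z₀.2) := by
    rw [hu, ← h]; rfl
  obtain ⟨θ, ⟨h1, h2⟩, -⟩ :=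
    (AddCircle.isCoveringMap_coe (1 : ℝ)).existsUnique_continuousMap_lifts u (z₀.1, (z₀.2 : ℝ)) w₀.1 h0
  refine ⟨fun z => (θ (z.1, z.2), (φ z).2), ?_, Prod.ext h1 ?_, fun z => Prod.ext ?_ rfl⟩
  · exact (θ.continuous.comp (by fun_prop)).prodMk (continuous_snd.comp hφ)
  · exact (congrArg Prod.snd h.symm :)
  · exact (congrFun h2 (z.1, (z.2 : ℝ))).trans (hu z)

section
variable {γ : Set Annulus} {γt γt₁ γt₂ : Set Strip}

/-- All lifts of γ are integer translates of one lift: any parametrization of another lift projects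
to a continuous reparametrization of c, since c is an embedding, and then the integer difference is
constant. -/
theorem exists_lift_param (h : IsSimpleCurveA γ) : ∃ c : unitInterval → Strip,
    Function.Injective (proj ∘ c) ∧
      ∀ γt, IsCurveLift γt γ → ∃ m : ℤ, γt = affineX 1 m '' range c := by
  obtain ⟨c, hc, hinj, -, -, -, rfl⟩ := h
  obtain ⟨G, hG, -, hGc⟩ := exists_lift_strip (φ := fun z => c z.2) (hc.comp continuous_snd)
    (z₀ := (0, 0)) (w₀ := rep (c 0)) (proj_rep _)
  have hGc' : proj ∘ (fun t => G (0, t)) = c := funext fun t => hGc (0, t)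
  refine ⟨fun t => G (0, t), by rw [hGc']; exact hinj, ?_⟩
  rintro γt ⟨⟨d, hd, -, -, -, -, rfl⟩, hproj⟩
  have hmem : ∀ t, proj (d t) ∈ range c := fun t => by
    rw [← hproj]; exact ⟨d t, ⟨t, rfl⟩, rfl⟩
  let e := (hc.isClosedEmbedding hinj).isEmbedding.toHomeomorph
  let s : unitInterval → unitInterval := fun t => e.symm ⟨proj (d t), hmem t⟩
  have hs : Continuous s :=
    e.symm.continuous.comp ((continuous_proj.comp hd).subtype_mk _)
  have hcs : ∀ t, c (s t) = proj (d t) := fun t =>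
    congrArg Subtype.val (e.apply_symm_apply ⟨proj (d t), hmem t⟩)
  obtain ⟨m, hm⟩ := exists_int_shift (g := d) (h := fun t => G (0, s t)) hd (by fun_prop)
    (fun t => by rw [hGc]; exact (hcs t).symm)
  refine ⟨m, Subset.antisymm ?_ ?_⟩
  · rintro _ ⟨t, rfl⟩
    exact ⟨_, ⟨s t, rfl⟩, (hm t).symm⟩
  · rintro _ ⟨_, ⟨x, rfl⟩, rfl⟩
    have hx : c x ∈ proj '' range d := by rw [hproj]; exact ⟨x, rfl⟩
    obtain ⟨_, ⟨t, rfl⟩, ht⟩ := hx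
    have : s t = x := hinj ((hcs t).trans ht)
    exact ⟨t, by rw [hm, this]⟩

theorem affineX_one_injective (m : ℝ) : Function.Injective (affineX 1 m) :=
  Function.LeftInverse.injective (g := affineX 1 (-m)) (congrFun (affineX_neg_comp_self m))

theorem IsCurveLift.injOn (h : IsCurveLift γt γ) (hγ : IsSimpleCurveA γ) : InjOn proj γt := by
  obtain ⟨c, hc, hl⟩ := exists_lift_param hγ
  obtain ⟨m, rfl⟩ := hl γt h
  rintro _ ⟨_, ⟨s, rfl⟩, rfl⟩ _ ⟨_, ⟨t, rfl⟩, rfl⟩ hst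
  rw [proj_affineX_one, proj_affineX_one] at hst
  rw [hc hst]

theorem IsCurveLift.exists_eq_shift (h₁ : IsCurveLift γt₁ γ) (h₂ : IsCurveLift γt₂ γ)
    (hγ : IsSimpleCurveA γ) : ∃ m : ℤ, γt₂ = affineX 1 m '' γt₁ := by
  obtain ⟨c, hc, hl⟩ := exists_lift_param hγ
  obtain ⟨m₁, rfl⟩ := hl γt₁ h₁
  obtain ⟨m₂, rfl⟩ := hl γt₂ h₂
  refine ⟨m₂ - m₁, ?_⟩
  rw [← image_comp]
  congr 1
  funext z
  rw [Function.comp, affineX_one_add]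
  push_cast; ring_nf

theorem IsSimpleCurve.isSimpleCurveA (h : IsSimpleCurve γt) (hinj : InjOn proj γt) :
    IsSimpleCurveA (proj '' γt) := by
  obtain ⟨c, hc, hci, h0, h1, hI, rfl⟩ := h
  exact ⟨proj ∘ c, continuous_proj.comp hc,
    fun s t hst => hci (hinj ⟨s, rfl⟩ ⟨t, rfl⟩ hst), h0, h1, hI, (range_comp _ _).symm⟩

theorem IsSimpleCurve.image {G : Strip ≃ₜ Strip} (hG : G ∈ bdryGroup) (h : IsSimpleCurve γt) :
    IsSimpleCurve (G '' γt) := by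
  obtain ⟨c, hc, hci, h0, h1, hI, rfl⟩ := h
  exact ⟨G ∘ c, G.continuous.comp hc, G.injective.comp hci, (hG _).1.2 h0, (hG _).2.2 h1,
    fun t ht => interior_of_mem_bdryGroup hG (hI t ht), (range_comp _ _).symm⟩

theorem base_image {G : Strip ≃ₜ Strip} (hG : G ∈ bdryGroup) (h : IsSimpleCurve γt) :
    base (G '' γt) = (G (base γt, 0)).1 := by
  have h1 : G (base γt, 0) ∈ G '' γt := mem_image_of_mem _ h.base_mem
  have h2 : G (base γt, 0) = ((G (base γt, 0)).1, (0 : unitInterval)) :=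
    Prod.ext rfl ((hG _).1.2 rfl)
  rw [h2] at h1
  exact ((h.image hG).mem_iff.1 h1).symm

end

/-! ### The lattice of lifts of iterates -/

section
variable {f : Annulus ≃ₜ Annulus} {F : Strip ≃ₜ Strip} {α : ℝ}

theorem commute_deckT (hcomm : ∀ z, F (deckT z) = deckT (F z)) : Commute deckT F :=
  Homeomorph.ext fun z => (hcomm z).symm

theorem liftPow_mul (hcomm : ∀ z, F (deckT z) = deckT (F z)) (a b a' b' : ℤ) :
    liftPow F a b * liftPow F a' b' = liftPow F (a + a') (b + b') := by
  have h := ((commute_deckT hcomm).zpow_zpow b' a).eq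
  simp only [liftPow, zpow_add]
  calc deckT ^ b * F ^ a * (deckT ^ b' * F ^ a')
      = deckT ^ b * (F ^ a * deckT ^ b') * F ^ a' := by group
    _ = _ := by rw [← h]; group

theorem liftPow_mul_apply (hcomm : ∀ z, F (deckT z) = deckT (F z)) (a b a' b' : ℤ) (z : Strip) :
    liftPow F a b (liftPow F a' b' z) = liftPow F (a + a') (b + b') z := by
  rw [← liftPow_mul hcomm]; rfl

theorem liftPow_zero : liftPow F 0 0 = 1 := by simp [liftPow]

theorem liftPow_neg (hcomm : ∀ z, F (deckT z) = deckT (F z)) (a b : ℤ) :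
    liftPow F (-a) (-b) = (liftPow F a b)⁻¹ := by
  refine eq_inv_of_mul_eq_one_left ?_
  rw [liftPow_mul hcomm, neg_add_cancel, neg_add_cancel, liftPow_zero]

theorem liftPow_zpow (hcomm : ∀ z, F (deckT z) = deckT (F z)) (a b k : ℤ) :
    liftPow F a b ^ k = liftPow F (k * a) (k * b) := by
  induction k with
  | zero => simp [liftPow_zero]
  | succ n ih => rw [zpow_add_one, ih, liftPow_mul hcomm]; ring_nf
  | pred n ih => rw [zpow_sub_one, ih, ← liftPow_neg hcomm, liftPow_mul hcomm]; ring_nf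

theorem liftPow_mem_bdryGroup (hF : F ∈ bdryGroup) (a b : ℤ) : liftPow F a b ∈ bdryGroup :=
  mul_mem (zpow_mem deckT_mem_bdryGroup _) (zpow_mem hF _)

theorem liftPow_comm (hcomm : ∀ z, F (deckT z) = deckT (F z)) (a b : ℤ) (z : Strip) :
    liftPow F a b (deckT z) = deckT (liftPow F a b z) := by
  have h : liftPow F a b * deckT = deckT * liftPow F a b := by
    have h1 : deckT = liftPow F 0 1 := by simp [liftPow]
    rw [h1, liftPow_mul hcomm, liftPow_mul hcomm]; ring_nf
  exact congrArg (fun G : Strip ≃ₜ Strip => G z) h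

theorem homeo_pow_apply {X : Type*} [TopologicalSpace X] (g : X ≃ₜ X) (k : ℕ) (x : X) :
    (g ^ k) x = g^[k] x := by
  induction k generalizing x with
  | zero => rfl
  | succ k ih => rw [pow_succ, Function.iterate_succ_apply, ← ih]; rfl

theorem proj_liftPow (hF : IsLift F f) (k : ℕ) (b : ℤ) (z : Strip) :
    proj (liftPow F k b z) = f^[k] (proj z) := by
  rw [liftPow, mul_apply_homeo, deckT_zpow_apply, proj_affineX_one, zpow_natCast]
  induction k generalizing z with
  | zero => rfl
  | succ k ih => rw [pow_succ, mul_apply_homeo, ih, hF, Function.iterate_succ_apply]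

/-- `γ` is disjoint from its images under the non-trivial lifts of the iterates `f^a`, `|a| < N`. -/
structure DisjointLifts (F : Strip ≃ₜ Strip) (N : ℕ) (γ : Set Strip) : Prop where
  simple : IsSimpleCurve γ
  disjoint : ∀ a b : ℤ, (a, b) ≠ 0 → |a| < N → Disjoint γ (liftPow F a b '' γ)

theorem DisjointLifts.injOn {N : ℕ} {γ : Set Strip} (h : DisjointLifts F N γ) (hN : 0 < N) :
    InjOn proj γ := by
  intro z hz w hw hzw
  obtain ⟨m, hm⟩ := exists_int_of_proj_eq hzw
  rcases eq_or_ne m 0 with rfl | hm0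
  · rwa [Int.cast_zero, affineX_one_zero] at hm
  · refine absurd ?_ (disjoint_left.1 (h.disjoint 0 m (by simpa using hm0) (by simpa using hN)) hz)
    exact ⟨w, hw, by rw [hm, ← deckT_zpow_apply]; simp [liftPow]⟩

/-- The lifts of f^j(γ) are the curves F^{j,m}(γ̃), so an intersection in the annulus is one of γ̃
with some F^{j,m}(γ̃). -/
theorem DisjointLifts.isBrouwerCurve {N : ℕ} {γ : Set Strip} (h : DisjointLifts F N γ)
    (hF : IsLift F f) {j : ℕ} (hj : 0 < j) (hjN : j < N) : IsBrouwerCurve f^[j] (proj '' γ) := by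
  refine ⟨h.simple.isSimpleCurveA (h.injOn (by omega)), disjoint_left.2 ?_⟩
  rintro _ ⟨z, hz, rfl⟩ ⟨_, ⟨w, hw, rfl⟩, hzw⟩
  rw [← proj_liftPow hF j 0] at hzw
  obtain ⟨m, hm⟩ := exists_int_of_proj_eq hzw.symm
  refine disjoint_left.1 (h.disjoint j m ?_ ?_) hz ⟨w, hw, ?_⟩
  · simp; omega
  · simpa using hjN
  · rw [hm, ← deckT_zpow_apply, ← mul_apply_homeo]; simp [liftPow]

section order
variable (hF : GoodLift f F α) {γ : Set Strip} (hγ : IsSimpleCurve γ)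
include hF hγ

theorem GoodLift.leftOf_of_neg {a b : ℤ} (hd : Disjoint γ (liftPow F a b '' γ))
    (h : a * α + b < 0) : LeftOf (liftPow F a b '' γ) γ := by
  have hG := liftPow_mem_bdryGroup hF.bdry a b
  refine leftOf_of_base_lt (hγ.image hG) hγ hd.symm ?_
  rw [base_image hG hγ]
  exact hF.neg a b h _

end order

theorem GoodLift.leftOf_image (hF : GoodLift f F α) {γ₁ γ₂ : Set Strip} (h₁ : IsSimpleCurve γ₁)
    (h₂ : IsSimpleCurve γ₂) (h : LeftOf γ₁ γ₂) (a b : ℤ) :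
    LeftOf (liftPow F a b '' γ₁) (liftPow F a b '' γ₂) := by
  have hG := liftPow_mem_bdryGroup hF.bdry a b
  refine leftOf_of_base_lt (h₁.image hG) (h₂.image hG)
    ((disjoint_image_iff (liftPow F a b).injective).2 h.1) ?_
  rw [base_image hG h₁, base_image hG h₂]
  exact strictMono_bottom (liftPow_comm hF.comm a b) hG (h.base_lt h₁ h₂)

/-- If S and S' move γ to the left, then S S'(γ) < S(γ) < γ. Disjointness from S S'(γ) is a
conclusion here and not an assumption. -/
theorem GoodLift.leftOf_mul (hF : GoodLift f F α) {γ : Set Strip} (hγ : IsSimpleCurve γ)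
    {a b a' b' : ℤ} (h : LeftOf (liftPow F a b '' γ) γ) (h' : LeftOf (liftPow F a' b' '' γ) γ) :
    LeftOf (liftPow F (a + a') (b + b') '' γ) γ := by
  have h1 := hF.leftOf_image (hγ.image (liftPow_mem_bdryGroup hF.bdry a' b')) hγ h' a b
  rw [← image_comp, show ⇑(liftPow F a b) ∘ ⇑(liftPow F a' b') =
    ⇑(liftPow F a b * liftPow F a' b') from rfl, liftPow_mul hF.comm] at h1
  exact h1.trans h (hγ.image (liftPow_mem_bdryGroup hF.bdry _ _))
    (hγ.image (liftPow_mem_bdryGroup hF.bdry _ _)) hγ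

theorem GoodLift.leftOf_nsmul (hF : GoodLift f F α) {γ : Set Strip} (hγ : IsSimpleCurve γ)
    {a b : ℤ} (h : LeftOf (liftPow F a b '' γ) γ) {k : ℕ} (hk : 0 < k) :
    LeftOf (liftPow F (k * a) (k * b) '' γ) γ := by
  induction k, hk using Nat.le_induction with
  | base => simpa using h
  | succ k hk ih =>
    have := hF.leftOf_mul hγ ih h
    push_cast
    rwa [add_one_mul, add_one_mul]

/-- The combinatorial heart of the renormalization: the lattice generated by
`F^{Q',-P'}` (moving to the right) and `F^{Q,-P}` (moving to the left). -/
theorem GoodLift.disjointLifts (hF : GoodLift f F α) {γ : Set Strip} (hγ : IsSimpleCurve γ)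
    {Q Q' A : ℕ} {P P' : ℤ} (hdet : P * Q' - P' * Q = 1) (hQ' : 0 < Q') (hA : 1 ≤ A)
    (hneg : (Q : ℝ) * α - P < 0) (hpos : 0 < (Q' : ℝ) * α - P')
    (hd : ∀ k j : ℤ, (k, j) ≠ 0 → 0 ≤ j → j < max A 2 →
      Disjoint γ (liftPow F (k * Q' + j * Q) (-(k * P') - j * P) '' γ)) :
    DisjointLifts F (Q' + Q * A) γ := by
  -- The bound `max A 2` makes j = 1 available even when A = 1, so both generators can be ordered.
  have hS1 : LeftOf (liftPow F Q (-P) '' γ) γ := by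
    have h1 := hd 0 1 (by simp) (by simp) (by simp)
    simp only [zero_mul, one_mul, zero_add, neg_zero, zero_sub] at h1
    exact hF.leftOf_of_neg hγ h1 (by push_cast; linarith)
  have hS0 : LeftOf (liftPow F (-Q') P' '' γ) γ := by
    have h1 := hd (-1) 0 (by simp) (by simp) (by simp)
    simp only [zero_mul, neg_mul, one_mul, add_zero, neg_neg, sub_zero] at h1
    exact hF.leftOf_of_neg hγ h1 (by push_cast; linarith)
  have key : ∀ k j : ℤ, (k, j) ≠ 0 → 0 ≤ j → |k * Q' + j * Q| < (Q' + Q * A : ℕ) →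
      Disjoint γ (liftPow F (k * Q' + j * Q) (-(k * P') - j * P) '' γ) := by
    intro k j hkj hj hlt
    rcases lt_or_ge j (max A 2 : ℕ) with hjA | hjA
    · exact hd k j hkj hj (by exact_mod_cast hjA)
    have hjA' : (A : ℤ) ≤ j := by
      refine le_trans ?_ hjA; exact_mod_cast le_max_left A 2
    -- With j ≥ A, a positive k would give k Q' + j Q ≥ Q' + A Q.
    have hk : k ≤ 0 := by
      by_contra! hk
      have h1 := (abs_lt.1 hlt).2
      push_cast at h1
      have h2 : (Q' : ℤ) ≤ k * Q' := le_mul_of_one_le_left (by positivity) hk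
      have h3 : (A : ℤ) * Q ≤ j * Q := by gcongr
      linarith
    obtain ⟨l, rfl⟩ : ∃ l : ℕ, k = -l := ⟨k.natAbs, by omega⟩
    obtain ⟨i, rfl⟩ := Int.eq_ofNat_of_zero_le hj
    have hi : 0 < i := by
      have : (1 : ℤ) ≤ A := by exact_mod_cast hA
      omega
    -- The map is now a product of i copies of F^{Q,-P} and l copies of F^{-Q',P'}, all moving γ to
    -- the left.
    have h1 := hF.leftOf_nsmul hγ hS1 hi
    rcases Nat.eq_zero_or_pos l with rfl | hl
    · simpa using h1.1.symm
    · have h2 := hF.leftOf_mul hγ (hF.leftOf_nsmul hγ hS0 hl) h1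
      simpa [sub_eq_add_neg] using h2.1.symm
  refine ⟨hγ, fun a b hab ha => ?_⟩
  -- The coordinates come from inverting the integer matrix of determinant 1.
  obtain ⟨k, j, ha', hb', hkj⟩ : ∃ k j : ℤ, a = k * Q' + j * Q ∧ b = -(k * P') - j * P ∧
      (k, j) ≠ 0 := by
    refine ⟨a * P + b * Q, -(a * P' + b * Q'), ?_, ?_, fun h => hab ?_⟩
    · linear_combination (-a) * hdet
    · linear_combination (-b) * hdet
    · obtain ⟨h1, h2⟩ := Prod.ext_iff.1 h
      simp only [Prod.fst_zero, Prod.snd_zero] at h1 h2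
      refine Prod.ext ?_ ?_
      · show a = 0
        linear_combination (-a) * hdet + Q' * h1 + Q * h2
      · show b = 0
        linear_combination (-b) * hdet - P' * h1 - P * h2
  rcases le_or_gt 0 j with hj | hj
  · rw [ha', hb']; exact key k j hkj hj (by rwa [← ha'])
  -- For negative j the inverse map is treated, and the disjointness is transported back by F^{a,b}.
  · have h1 := key (-k) (-j) (by simpa [Prod.ext_iff] using hkj) (by omega) (by
      rw [show -k * (Q' : ℤ) + -j * Q = -a by rw [ha']; ring, abs_neg]; exact ha)
    rw [show -k * (Q' : ℤ) + -j * Q = -a by rw [ha']; ring,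
      show -(-k * P') - -j * P = -b by rw [hb']; ring, liftPow_neg hF.comm] at h1
    have h2 := (disjoint_image_iff (liftPow F a b).injective).2 h1
    rw [← image_comp, show ⇑(liftPow F a b) ∘ ⇑(liftPow F a b)⁻¹ = id from
      funext fun z => apply_inv_self_homeo _ z, image_id] at h2
    exact h2.symm

end

/-! ### The renormalization -/

section
variable {f : Annulus ≃ₜ Annulus} {F H : Strip ≃ₜ Strip} {α : ℝ}

/-- `H` conjugates `T` to `S`. -/
def ConjTo (H S : Strip ≃ₜ Strip) : Prop := ∀ z, S (H z) = H (deckT z)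

theorem ConjTo.map_shift {S : Strip ≃ₜ Strip} (h : ConjTo H S) (m : ℤ) (z : Strip) :
    H (affineX 1 m z) = (S ^ m) (H z) := by
  have h1 : SemiconjBy H deckT S := Homeomorph.ext fun z => (h z).symm
  have h2 := (h1.zpow_right m).eq
  rw [← deckT_zpow_apply, ← mul_apply_homeo, h2, mul_apply_homeo]

/-- The reflection turns T into T⁻¹, so `H * reflJ` conjugates T to S⁻¹. -/
theorem ConjTo.mul_reflJ_shift {S : Strip ≃ₜ Strip} (h : ConjTo H S) (m : ℤ) (z : Strip) :
    (H * reflJ) (affineX 1 m z) = (S ^ (-m)) ((H * reflJ) z) := by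
  rw [mul_apply_homeo, mul_apply_homeo, ← h.map_shift, reflJ_apply, reflJ_apply]
  congr 1
  simp [affineX, add_comm]

/-- Equivariance carries the boundary conditions from the unit square to the whole strip;
nonvanishing of the Jacobian keeps interior points interior. -/
theorem ConjTo.mem_bdryGroup {S : Strip ≃ₜ Strip} (h : ConjTo H S) (hS : S ∈ bdryGroup)
    (hs : ∀ z, SmoothAt H z) (hj : ∀ z, jac H z ≠ 0)
    (h0 : ∀ z ∈ square, z.2 = 0 → (H z).2 = 0) (h1 : ∀ z ∈ square, z.2 = 1 → (H z).2 = 1) :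
    H ∈ bdryGroup := by
  have h0' : ∀ z : Strip, z.2 = 0 → (H z).2 = 0 := fun z hz => by
    obtain ⟨m, w, hw, rfl⟩ := exists_mem_square z
    rw [h.map_shift]
    exact ((zpow_mem hS m) _).1.2 (h0 w hw hz)
  have h1' : ∀ z : Strip, z.2 = 1 → (H z).2 = 1 := fun z hz => by
    obtain ⟨m, w, hw, rfl⟩ := exists_mem_square z
    rw [h.map_shift]
    exact ((zpow_mem hS m) _).2.2 (h1 w hw hz)
  refine fun z => ⟨⟨fun hz => ?_, h0' z⟩, ⟨fun hz => ?_, h1' z⟩⟩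
  · by_contra hne
    have hne1 : z.2 ≠ 1 := fun h => by rw [h1' z h] at hz; exact one_ne_zero hz
    exact ((hs z).interior_of_jac_ne_zero (hj z) ⟨unitInterval.pos_iff_ne_zero.2 hne,
      unitInterval.lt_one_iff_ne_one.2 hne1⟩).1.ne' hz
  · by_contra hne
    have hne0 : z.2 ≠ 0 := fun h => by rw [h0' z h] at hz; exact zero_ne_one hz
    exact ((hs z).interior_of_jac_ne_zero (hj z) ⟨unitInterval.pos_iff_ne_zero.2 hne0,
      unitInterval.lt_one_iff_ne_one.2 hne⟩).2.ne hz

theorem mul_reflJ_renormLift (a b : ℤ) (z : Strip) :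
    (H * reflJ) (renormLift F H a b z) = liftPow F a b ((H * reflJ) z) :=
  apply_inv_self_homeo (H * reflJ) (liftPow F a b ((H * reflJ) z))

theorem renormLift_comm (hcomm : ∀ z, F (deckT z) = deckT (F z)) {a' b' : ℤ}
    (h : ConjTo H (liftPow F a' b')) (a b : ℤ) (z : Strip) :
    renormLift F H a b (deckT z) = deckT (renormLift F H a b z) := by
  have h1 : ∀ z, deckT z = affineX 1 (1 : ℤ) z := fun z => by rw [deckT_apply, Int.cast_one]
  apply (H * reflJ).injective
  rw [mul_reflJ_renormLift, h1, h1, h.mul_reflJ_shift, h.mul_reflJ_shift, mul_reflJ_renormLift,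
    liftPow_zpow hcomm, liftPow_mul_apply hcomm, liftPow_mul_apply hcomm, add_comm a, add_comm b]

theorem isLift_renorm (hcomm : ∀ z, F (deckT z) = deckT (F z)) {a' b' : ℤ}
    (h : ConjTo H (liftPow F a' b')) (a b : ℤ) : IsLift (renormLift F H a b) (renorm F H a b) :=
  isLift_descend (renormLift_comm hcomm h a b)

theorem renorm_iterate (hcomm : ∀ z, F (deckT z) = deckT (F z)) {a' b' : ℤ}
    (h : ConjTo H (liftPow F a' b')) (a b : ℤ) (j : ℕ) (z : Strip) :
    (renorm F H a b)^[j] (proj z) =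
      proj ((H * reflJ)⁻¹ (liftPow F (j * a) (j * b) ((H * reflJ) z))) := by
  induction j generalizing z with
  | zero => simp [liftPow_zero]
  | succ j ih =>
    rw [Function.iterate_succ_apply, ← isLift_renorm hcomm h a b z, ih, mul_reflJ_renormLift,
      liftPow_mul_apply hcomm]
    push_cast
    rw [add_one_mul, add_one_mul]

/-- In the coordinate HJ, powers of F^{Q',-P'} are deck translations. Hence a point of γ̃ ∩
F^{kQ'+jQ, -kP'-jP}(γ̃) projects to a point of γ' on its j-th image under the renormalization; for j
= 0 injectivity of the projection on `γt'` forces k = 0. -/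
theorem GoodLift.disjointLifts_of_renorm (hF : GoodLift f F α) {Q Q' A : ℕ} {P P' : ℤ}
    (hconj : ConjTo H (liftPow F Q' (-P'))) (hH : H ∈ bdryGroup)
    (hdet : P * Q' - P' * Q = 1) (hQ' : 0 < Q') (hA : 1 ≤ A)
    (hneg : (Q : ℝ) * α - P < 0) (hpos : 0 < (Q' : ℝ) * α - P')
    {γ' : Set Annulus} {γt' : Set Strip}
    (hγ' : IsGoodBrouwerCurve (renorm F H Q (-P)) A γ') (hγt' : IsCurveLift γt' γ') :
    DisjointLifts F (Q' + Q * A) ((H * reflJ) '' γt') := by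
  refine hF.disjointLifts (hγt'.1.image (mul_mem hH reflJ_mem_bdryGroup)) hdet hQ' hA hneg hpos
    fun k j hkj hj hjA => disjoint_left.2 ?_
  rintro _ ⟨z, hz, rfl⟩ ⟨_, ⟨w, hw, rfl⟩, hzw⟩
  obtain ⟨i, rfl⟩ := Int.eq_ofNat_of_zero_le hj
  have h1 : z = affineX 1 ((-k : ℤ) : ℝ)
      ((H * reflJ)⁻¹ (liftPow F (i * Q) (i * -P) ((H * reflJ) w))) := by
    apply (H * reflJ).injective
    rw [hconj.mul_reflJ_shift, apply_inv_self_homeo, liftPow_zpow hF.comm,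
      liftPow_mul_apply hF.comm, ← hzw]
    ring_nf
  have h2 : proj z = (renorm F H Q (-P))^[i] (proj w) := by
    rw [renorm_iterate hF.comm hconj]
    conv_lhs => rw [h1, proj_affineX_one]
  rcases Nat.eq_zero_or_pos i with rfl | hi
  · have h3 : z = w := hγt'.injOn hγ'.1.1 hz hw h2
    rw [← h3] at h1
    have h4 := congrArg Prod.fst h1
    simp [affineX, liftPow_zero] at h4
    simp [h4] at hkj
  · have h3 : IsBrouwerCurve (renorm F H Q (-P))^[i] γ' := by
      rcases lt_or_ge i A with hiA | hiA
      · exact hγ'.2 i hi hiA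
      -- This occurs only for A = 1, where the case i = 1 is the Brouwer property itself.
      · have : i = 1 := by
          have hjA' : i < max A 2 := by exact_mod_cast hjA
          have := lt_max_iff.1 hjA'
          omega
        rw [this, Function.iterate_one]; exact hγ'.1
    refine disjoint_left.1 h3.2 (?_ : proj z ∈ γ') ?_
    · rw [← hγt'.2]; exact mem_image_of_mem _ hz
    · rw [h2, ← hγt'.2]; exact mem_image_of_mem _ (mem_image_of_mem _ hw)

end

/-! ### Charts between a curve and its image -/

theorem shift_mem_leftSide {γ : Set Strip} {z : Strip} (m : ℝ) (h : z ∈ leftSide γ) :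
    affineX 1 m z ∈ leftSide (affineX 1 m '' γ) := by
  refine ⟨fun hz => h.1 ((affineX_one_injective m).mem_set_image.1 hz), fun M => ?_⟩
  obtain ⟨w, hw, hM⟩ := h.2 (M - m)
  refine ⟨affineX 1 m w, ?_, ?_⟩
  · refine (isPreconnected_connectedComponentIn.image _
      (continuous_affineX 1 m).continuousOn).subset_connectedComponentIn
      (mem_image_of_mem _ (mem_connectedComponentIn h.1)) ?_ (mem_image_of_mem _ hw)
    rintro _ ⟨v, hv, rfl⟩ hv'
    exact connectedComponentIn_subset _ _ hv ((affineX_one_injective m).mem_set_image.1 hv')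
  · simp only [affineX]; linarith

theorem shift_mem_rightSide {γ : Set Strip} {z : Strip} (m : ℝ) (h : z ∈ rightSide γ) :
    affineX 1 m z ∈ rightSide (affineX 1 m '' γ) := by
  refine ⟨fun hz => h.1 ((affineX_one_injective m).mem_set_image.1 hz), fun M => ?_⟩
  obtain ⟨w, hw, hM⟩ := h.2 (M - m)
  refine ⟨affineX 1 m w, ?_, ?_⟩
  · refine (isPreconnected_connectedComponentIn.image _
      (continuous_affineX 1 m).continuousOn).subset_connectedComponentIn
      (mem_image_of_mem _ (mem_connectedComponentIn h.1)) ?_ (mem_image_of_mem _ hw)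
    rintro _ ⟨v, hv, rfl⟩ hv'
    exact connectedComponentIn_subset _ _ hv ((affineX_one_injective m).mem_set_image.1 hv')
  · simp only [affineX]; linarith

/-- The open neighbourhood `(-ε, 1 + ε) × [0,1]` of the unit square. -/
def squareNhd (ε : ℝ) : Set Strip := {z | z.1 ∈ Ioo (-ε) (1 + ε)}

theorem isOpen_squareNhd (ε : ℝ) : IsOpen (squareNhd ε) := isOpen_Ioo.preimage continuous_fst

theorem square_subset_squareNhd {ε : ℝ} (hε : 0 < ε) : square ⊆ squareNhd ε := fun z hz =>
  ⟨by linarith [hz.1], by linarith [hz.2]⟩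

/-- A map from a neighbourhood of the unit square to the strip whose image lies between `S γ` and
`γ`, and that is equivariant with respect to `T` and `S⁻¹`. -/
structure StripChart (S : Strip ≃ₜ Strip) (γ : Set Strip) (ε : ℝ) (Φ : Strip → Strip) : Prop where
  eps_pos : 0 < ε
  continuous : Continuous Φ
  injOn : InjOn Φ (squareNhd ε)
  isOpen_image : ∀ U, IsOpen U → U ⊆ squareNhd ε → IsOpen (Φ '' U)
  left : Φ '' {z | z.1 = 0} = S '' γ
  right : Φ '' {z | z.1 = 1} = γ
  equivariant : ∀ z : Strip, z.1 ∈ Ioo (-ε) ε → S (Φ (deckT z)) = Φ z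
  bottom : ∀ z ∈ square, z.2 = 0 → (Φ z).2 = 0
  strictMono : StrictMonoOn (fun x : ℝ => (Φ (x, 0)).1) (Icc 0 1)

theorem isPreconnected_slab {s : Set ℝ} (hs : IsPreconnected s) :
    IsPreconnected {z : Strip | z.1 ∈ s} := by
  have : {z : Strip | z.1 ∈ s} = s ×ˢ univ := by ext z; simp
  rw [this]; exact hs.prod isPreconnected_univ

namespace StripChart
variable {S : Strip ≃ₜ Strip} {γ : Set Strip} {ε : ℝ} {Φ : Strip → Strip}
  (h : StripChart S γ ε Φ) (hS : S ∈ bdryGroup)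
  (hmono : StrictMono fun x : ℝ => (S (x, 0)).1) (hγ : IsSimpleCurve γ)
include h

theorem apply_bottom {x : ℝ} (hx : x ∈ Icc (0 : ℝ) 1) : Φ (x, 0) = ((Φ (x, 0)).1, 0) :=
  Prod.ext rfl (h.bottom (x, 0) hx rfl)

include hγ in
theorem base_right : base γ = (Φ (1, 0)).1 := by
  have h1 : Φ (1, 0) ∈ γ := by rw [← h.right]; exact ⟨(1, 0), rfl, rfl⟩
  rw [h.apply_bottom (right_mem_Icc.2 zero_le_one)] at h1
  exact (hγ.mem_iff.1 h1).symm

include hγ hS in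
theorem base_left : base (S '' γ) = (Φ (0, 0)).1 := by
  have h1 : Φ (0, 0) ∈ S '' γ := by rw [← h.left]; exact ⟨(0, 0), rfl, rfl⟩
  rw [h.apply_bottom (left_mem_Icc.2 zero_le_one)] at h1
  exact ((hγ.image hS).mem_iff.1 h1).symm

theorem disjoint_left {s : Set ℝ} (hs : s ⊆ Ioo (-ε) (1 + ε)) (h0 : (0 : ℝ) ∉ s) :
    Disjoint (Φ '' {z | z.1 ∈ s}) (S '' γ) := by
  rw [← h.left]
  refine Set.disjoint_left.2 ?_
  rintro _ ⟨z, hz, rfl⟩ ⟨w, hw, hwz⟩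
  have hw0 : w.1 = 0 := hw
  have : w = z := h.injOn ⟨by linarith [h.eps_pos], by linarith [h.eps_pos]⟩ (hs hz) hwz
  rw [← this] at hz
  exact h0 (hw0 ▸ hz)

theorem disjoint_right {s : Set ℝ} (hs : s ⊆ Ioo (-ε) (1 + ε)) (h1 : (1 : ℝ) ∉ s) :
    Disjoint (Φ '' {z | z.1 ∈ s}) γ := by
  conv => arg 2; rw [← h.right]
  refine Set.disjoint_left.2 ?_
  rintro _ ⟨z, hz, rfl⟩ ⟨w, hw, hwz⟩
  have hw0 : w.1 = 1 := hw
  have : w = z := h.injOn ⟨by linarith [h.eps_pos], by linarith [h.eps_pos]⟩ (hs hz) hwz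
  rw [← this] at hz
  exact h1 (hw0 ▸ hz)

theorem image_slab_isPreconnected {s : Set ℝ} (hs : IsPreconnected s) :
    IsPreconnected (Φ '' {z | z.1 ∈ s}) :=
  (isPreconnected_slab hs).image _ h.continuous.continuousOn

-- Without its left edge the square is connected and, by injectivity, its image avoids S γ; one
-- bottom point decides the side.
include hγ hS in
theorem image_square_subset_right : Φ '' square ⊆ rightSide (S '' γ) ∪ S '' γ := by
  have hε := h.eps_pos
  have h1 : Φ '' {z | z.1 ∈ Ioc (0 : ℝ) 1} ⊆ rightSide (S '' γ) := by
    refine subset_rightSide (h.image_slab_isPreconnected isPreconnected_Ioc)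
      (h.disjoint_left (fun x hx => ⟨by linarith [hx.1], by linarith [hx.2]⟩) (by simp))
      (z := Φ (1, 0)) ⟨(1, 0), ⟨zero_lt_one, le_rfl⟩, rfl⟩ ?_
    rw [h.apply_bottom (right_mem_Icc.2 zero_le_one)]
    refine (hγ.image hS).mem_rightSide ?_
    rw [h.base_left hS hγ]
    exact h.strictMono (left_mem_Icc.2 zero_le_one) (right_mem_Icc.2 zero_le_one) zero_lt_one
  rintro _ ⟨z, hz, rfl⟩
  rcases hz.1.eq_or_lt with h0 | h0
  · right; rw [← h.left]; exact ⟨z, h0.symm, rfl⟩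
  · left; exact h1 ⟨z, ⟨h0, hz.2⟩, rfl⟩

include hγ in
theorem image_square_subset_left : Φ '' square ⊆ leftSide γ ∪ γ := by
  have hε := h.eps_pos
  have h1 : Φ '' {z | z.1 ∈ Ico (0 : ℝ) 1} ⊆ leftSide γ := by
    refine subset_leftSide (h.image_slab_isPreconnected isPreconnected_Ico)
      (h.disjoint_right (fun x hx => ⟨by linarith [hx.1], by linarith [hx.2]⟩) (by simp))
      (z := Φ (0, 0)) ⟨(0, 0), ⟨le_rfl, zero_lt_one⟩, rfl⟩ ?_
    rw [h.apply_bottom (left_mem_Icc.2 zero_le_one)]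
    refine hγ.mem_leftSide ?_
    rw [h.base_right hγ]
    exact h.strictMono (left_mem_Icc.2 zero_le_one) (right_mem_Icc.2 zero_le_one) zero_lt_one
  rintro _ ⟨z, hz, rfl⟩
  rcases hz.2.eq_or_lt with h0 | h0
  · right; rw [← h.right]; exact ⟨z, h0, rfl⟩
  · left; exact h1 ⟨z, ⟨hz.1, h0⟩, rfl⟩

-- Equivariance sends the bottom point at -s to S Φ(1-s, 0), which precedes the base of S γ because
-- S is increasing on the bottom line. Connectedness extends this to the collar.
include hγ hS hmono in
theorem left_collar : Φ '' {z | z.1 ∈ Ioo (-ε) 0} ⊆ leftSide (S '' γ) := by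
  have hε := h.eps_pos
  obtain ⟨s, hs0, hs⟩ := exists_between (lt_min hε zero_lt_one)
  obtain ⟨hs1, hs2⟩ := lt_min_iff.1 hs
  refine subset_leftSide (h.image_slab_isPreconnected isPreconnected_Ioo)
    (h.disjoint_left (fun x hx => ⟨by linarith [hx.1], by linarith [hx.2]⟩) (by simp))
    (z := Φ (-s, 0)) ⟨(-s, 0), ⟨by linarith, by linarith⟩, rfl⟩ ?_
  have hm : 1 - s ∈ Icc (0 : ℝ) 1 := ⟨by linarith, by linarith⟩
  have h1 := h.equivariant (-s, 0) ⟨by linarith, by linarith⟩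
  have h2 : deckT (-s, 0) = (1 - s, (0 : unitInterval)) := by
    rw [deckT_apply]; exact Prod.ext (by simp [affineX]; ring) rfl
  rw [h2, h.apply_bottom hm] at h1
  rw [← h1]
  have h3 : S ((Φ (1 - s, 0)).1, 0) = ((S ((Φ (1 - s, 0)).1, 0)).1, 0) :=
    Prod.ext rfl ((hS _).1.2 rfl)
  rw [h3]
  refine (hγ.image hS).mem_leftSide ?_
  rw [base_image hS hγ, h.base_right hγ]
  exact hmono (h.strictMono hm (right_mem_Icc.2 zero_le_one) (by linarith))

include hγ hS hmono in
theorem right_collar : Φ '' {z | z.1 ∈ Ioo 1 (1 + ε)} ⊆ rightSide γ := by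
  have hε := h.eps_pos
  obtain ⟨s, hs0, hs⟩ := exists_between (lt_min hε zero_lt_one)
  obtain ⟨hs1, hs2⟩ := lt_min_iff.1 hs
  refine subset_rightSide (h.image_slab_isPreconnected isPreconnected_Ioo)
    (h.disjoint_right (fun x hx => ⟨by linarith [hx.1], by linarith [hx.2]⟩) (by simp))
    (z := Φ (1 + s, 0)) ⟨(1 + s, 0), ⟨by linarith, by linarith⟩, rfl⟩ ?_
  have hm : s ∈ Icc (0 : ℝ) 1 := ⟨by linarith, by linarith⟩
  have h1 := h.equivariant (s, 0) ⟨by linarith, by linarith⟩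
  have h2 : deckT (s, 0) = (1 + s, (0 : unitInterval)) := by
    rw [deckT_apply]; exact Prod.ext (by simp [affineX]; ring) rfl
  rw [h2] at h1
  have h3 : Φ (1 + s, 0) = ((Φ (1 + s, 0)).1, 0) :=
    Prod.ext rfl ((hS _).1.1 (by rw [h1]; exact h.bottom (s, 0) hm rfl))
  rw [h3] at h1 ⊢
  refine hγ.mem_rightSide ?_
  refine hmono.lt_iff_lt.1 ?_
  simp only [h1]
  rw [← base_image hS hγ, h.base_left hS hγ]
  exact h.strictMono (left_mem_Icc.2 zero_le_one) hm hs0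

-- The left side of S γ, the image of the square and the right side of γ together fill the strip.
-- Their union is closed with the closed square and open with its neighbourhood, and the collars
-- show that both descriptions give the same set; the strip is connected.
include hγ hS hmono in
theorem stripRegion_subset : stripRegion (S '' γ) γ ⊆ Φ '' square := by
  have hε := h.eps_pos
  have hcl := (hγ.image hS).isCompact.isClosed
  have hcr := hγ.isCompact.isClosed
  set W := leftSide (S '' γ) ∪ Φ '' squareNhd ε ∪ rightSide γ with hW
  have hWo : IsOpen W := ((isOpen_leftSide hcl).union
    (h.isOpen_image _ (isOpen_squareNhd ε) Subset.rfl)).union (isOpen_rightSide hcr)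
  have hWc : W = leftSide (S '' γ) ∪ Φ '' square ∪ rightSide γ := by
    apply Subset.antisymm
    · rintro z ((hz | ⟨w, hw, rfl⟩) | hz)
      · exact Or.inl (Or.inl hz)
      · rcases lt_or_ge w.1 0 with h0 | h0
        · exact Or.inl (Or.inl (h.left_collar hS hmono hγ ⟨w, ⟨hw.1, h0⟩, rfl⟩))
        rcases le_or_gt w.1 1 with h1 | h1
        · exact Or.inl (Or.inr ⟨w, ⟨h0, h1⟩, rfl⟩)
        · exact Or.inr (h.right_collar hS hmono hγ ⟨w, ⟨h1, hw.2⟩, rfl⟩)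
      · exact Or.inr hz
    · exact union_subset_union (union_subset_union Subset.rfl
        (image_mono (square_subset_squareNhd hε))) Subset.rfl
  have hLsq : S '' γ ⊆ Φ '' square := by
    rw [← h.left]
    exact image_mono fun z (hz : z.1 = 0) => ⟨hz.ge, by rw [hz]; exact zero_le_one⟩
  have hRsq : γ ⊆ Φ '' square := by
    conv_lhs => rw [← h.right]
    exact image_mono fun z (hz : z.1 = 1) => ⟨by rw [hz]; exact zero_le_one, hz.le⟩
  have hclosed : IsClosed W := by
    have : W = closure (leftSide (S '' γ)) ∪ Φ '' square ∪ closure (rightSide γ) := by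
      rw [hWc]
      apply Subset.antisymm
      · exact union_subset_union (union_subset_union subset_closure Subset.rfl) subset_closure
      · rintro z ((hz | hz) | hz)
        · rcases closure_leftSide_subset hcl hz with hz | hz
          · exact Or.inl (Or.inl hz)
          · exact Or.inl (Or.inr (hLsq hz))
        · exact Or.inl (Or.inr hz)
        · rcases closure_rightSide_subset hcr hz with hz | hz
          · exact Or.inr hz
          · exact Or.inl (Or.inr (hRsq hz))
    rw [this]
    exact (isClosed_closure.union (isCompact_square.image h.continuous).isClosed).union
      isClosed_closure
  have huniv : W = univ := by
    refine IsClopen.eq_univ ⟨hclosed, hWo⟩ ⟨Φ (0, 0), ?_⟩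
    rw [hWc]
    exact Or.inl (Or.inr ⟨(0, 0), ⟨le_rfl, zero_le_one⟩, rfl⟩)
  intro z hz
  have : z ∈ W := huniv ▸ mem_univ z
  rw [hWc] at this
  rcases this with (h1 | h1) | h1
  · exact absurd h1 hz.1
  · exact h1
  · exact absurd h1 hz.2

-- If z and T^{-m} z were both in the image, then T^{-m} z would lie on or left of T^{-m} γ, since z
-- lies on or left of γ; but it also lies on or right of S γ, hence strictly right of T^{-m} γ.
include hγ hS in
theorem injOn_proj (hleft : ∀ m : ℕ, 0 < m → LeftOf (affineX 1 (-m) '' γ) (S '' γ)) :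
    InjOn proj (Φ '' square) := by
  have key : ∀ m : ℕ, 0 < m → ∀ z ∈ Φ '' square, affineX 1 (-m) z ∉ Φ '' square := by
    intro m hm z hz hz'
    have hsimple : IsSimpleCurve (affineX 1 (-m) '' γ) := by
      have h1 : affineX 1 (-m) = ⇑(deckT ^ (-m : ℤ)) := funext fun z => by
        rw [deckT_zpow_apply]; push_cast; rfl
      rw [h1]; exact hγ.image (zpow_mem deckT_mem_bdryGroup _)
    have h1 : affineX 1 (-m) z ∈ rightSide (affineX 1 (-m) '' γ) := by
      rcases h.image_square_subset_right hS hγ hz' with h2 | h2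
      · exact (hleft m hm).rightSide_subset (hγ.image hS) h2
      · exact (hleft m hm).subset_rightSide hsimple (hγ.image hS) h2
    rcases h.image_square_subset_left hγ hz with h2 | h2
    · exact Set.disjoint_left.1 hsimple.disjoint_sides (shift_mem_leftSide _ h2) h1
    · exact h1.1 (mem_image_of_mem _ h2)
  intro z hz w hw hzw
  obtain ⟨m, hm⟩ := exists_int_of_proj_eq hzw
  rcases lt_trichotomy m 0 with h0 | rfl | h0
  · obtain ⟨k, rfl⟩ : ∃ k : ℕ, m = -k := ⟨m.natAbs, by omega⟩
    push_cast at hm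
    exact absurd (hm ▸ hz) (key k (by omega) w hw)
  · rwa [Int.cast_zero, affineX_one_zero] at hm
  · obtain ⟨k, rfl⟩ := Int.eq_ofNat_of_zero_le h0.le
    have : w = affineX 1 (-k) z := by
      rw [hm]; exact (congrFun (affineX_neg_comp_self _) w).symm
    exact absurd (this ▸ hw) (key k (by omega) z hz)

end StripChart

/-! ### Lifting charts to the strip -/

theorem eq_of_proj_eq_of_abs_lt {z w : Strip} (h : proj z = proj w) (hd : |z.1 - w.1| < 1) :
    z = w := by
  obtain ⟨m, hm⟩ := exists_int_of_proj_eq h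
  have h1 : z.1 - w.1 = m := by
    have := congrArg Prod.fst hm
    simp only [affineX, one_mul] at this
    linarith
  have h2 : |m| < 1 := by
    rw [h1] at hd; exact_mod_cast hd
  rw [Int.abs_lt_one_iff.1 h2, Int.cast_zero, affineX_one_zero] at hm
  exact hm

theorem exists_squareNhd_subset {U : Set Strip} (hU : IsOpen U) (h : square ⊆ U) :
    ∃ ε > 0, squareNhd ε ⊆ U := by
  obtain ⟨ε, hε, hsub⟩ := isCompact_square.exists_thickening_subset_open hU h
  refine ⟨ε, hε, fun z hz => hsub ?_⟩
  rw [Metric.mem_thickening_iff]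
  have hz1 := hz.1
  have hz2 := hz.2
  refine ⟨(max 0 (min z.1 1), z.2), ⟨le_max_left _ _, max_le zero_le_one (min_le_right _ _)⟩, ?_⟩
  rw [Prod.dist_eq, dist_self]
  refine max_lt ?_ hε
  rw [Real.dist_eq, abs_lt]
  rcases le_total z.1 1 with h1 | h1
  · rw [min_eq_left h1]
    rcases le_total 0 z.1 with h0 | h0
    · rw [max_eq_right h0]; constructor <;> linarith
    · rw [max_eq_left h0]; constructor <;> linarith
  · rw [min_eq_right h1, max_eq_right zero_le_one]; constructor <;> linarith

theorem exists_collar_subset {U : Set Strip} (hU : IsOpen U) (h : {z : Strip | z.1 = 0} ⊆ U) :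
    ∃ ε > 0, ∀ z : Strip, z.1 ∈ Ioo (-ε) ε → z ∈ U := by
  have hc : IsCompact {z : Strip | z.1 = 0} := by
    have : {z : Strip | z.1 = 0} = {(0 : ℝ)} ×ˢ univ := by ext z; simp
    rw [this]; exact isCompact_singleton.prod isCompact_univ
  obtain ⟨ε, hε, hsub⟩ := hc.exists_thickening_subset_open hU h
  refine ⟨ε, hε, fun z hz => hsub ?_⟩
  rw [Metric.mem_thickening_iff]
  refine ⟨(0, z.2), rfl, ?_⟩
  rw [Prod.dist_eq, dist_self, Real.dist_eq, sub_zero]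
  exact max_lt (abs_lt.2 hz) hε

/-- `Ψ` is a lift to the strip of the admissible coordinate `φ`, on a neighbourhood of the unit
square; it maps the left edge to `γt`. -/
structure LiftedChart (G : Strip → Strip) (φ : OpenPartialHomeomorph Strip Annulus) (γt : Set Strip)
    (ε : ℝ) (Ψ : Strip → Strip) : Prop where
  eps_pos : 0 < ε
  continuous : Continuous Ψ
  source : squareNhd ε ⊆ φ.source
  proj_eq : ∀ z ∈ squareNhd ε, proj (Ψ z) = φ z
  smooth : ∀ z ∈ squareNhd ε, SmoothAt Ψ z
  jacobian : ∃ c : ℝ, 0 < c ∧ ∀ z ∈ squareNhd ε, jac Ψ z = c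
  left : Ψ '' {z | z.1 = 0} = γt
  bottom : ∀ z ∈ square, z.2 = 0 → (Ψ z).2 = 0
  top : ∀ z ∈ square, z.2 = 1 → (Ψ z).2 = 1
  equivariant : ∃ m : ℤ, ∀ z : Strip, z.1 ∈ Ioo (-ε) ε → Ψ (deckT z) = affineX 1 m (G (Ψ z))

/-- The conjugacy relation is known only in the annulus, so its lift holds up to a constant integer
translation, which is left undetermined here. -/
theorem IsAdmissible.exists_liftedChart {g : Annulus → Annulus} {γ : Set Annulus}
    {φ : OpenPartialHomeomorph Strip Annulus} (h : IsAdmissible g γ φ) {G : Strip → Strip}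
    (hG : Continuous G) (hGg : IsLift G g) {γt : Set Strip} (hγt : IsCurveLift γt γ) :
    ∃ ε Ψ, LiftedChart G φ γt ε Ψ := by
  obtain ⟨ε₁, hε₁, hsub⟩ := exists_squareNhd_subset φ.open_source h.square_subset
  obtain ⟨UL, hULo, hUL0, -, -, hULe⟩ := h.equivariant
  obtain ⟨ε₂, hε₂, hcol⟩ := exists_collar_subset hULo hUL0
  obtain ⟨ε, hε, hεlt⟩ := exists_between (lt_min (lt_min hε₁ hε₂) zero_lt_one)
  have hεlt1 : ε < ε₁ := (hεlt.trans_le (min_le_left _ _)).trans_le (min_le_left _ _)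
  have hεlt2 : ε < ε₂ := (hεlt.trans_le (min_le_left _ _)).trans_le (min_le_right _ _)
  have hεone : ε < 1 := hεlt.trans_le (min_le_right _ _)
  -- Clamping to a closed slab inside the source gives a globally continuous map to lift without
  -- changing φ near the square.
  let κ : Strip → Strip := fun z => (max (-ε) (min z.1 (1 + ε)), z.2)
  have hκ : Continuous κ := by fun_prop
  have hκmem : ∀ z, κ z ∈ φ.source := fun z => hsub
    ⟨(neg_lt_neg hεlt1).trans_le (le_max_left _ _),
      max_lt (by linarith) ((min_le_right _ _).trans_lt (by linarith))⟩
  have hκid : ∀ z ∈ squareNhd ε, κ z = z := fun z hz =>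
    Prod.ext (by simp only [κ]; rw [min_eq_left hz.2.le, max_eq_right hz.1.le]) rfl
  have hsq := square_subset_squareNhd hε
  have h00 : ((0 : ℝ), (0 : unitInterval)) ∈ square := ⟨le_rfl, zero_le_one⟩
  obtain ⟨w₀, hw₀, hw₀'⟩ : φ (0, 0) ∈ proj '' γt := by
    rw [hγt.2, ← h.left_edge]; exact ⟨(0, 0), rfl, rfl⟩
  obtain ⟨Ψ, hΨ, hΨ0, hΨp⟩ := exists_lift_strip (φ := fun z => φ (κ z))
    (φ.continuousOn.comp_continuous hκ hκmem) (z₀ := (0, 0)) (w₀ := w₀)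
    (by rw [hκid _ (hsq h00)]; exact hw₀')
  have hproj : ∀ z ∈ squareNhd ε, proj (Ψ z) = φ z := fun z hz => by rw [hΨp, hκid z hz]
  have hsrc : squareNhd ε ⊆ φ.source := fun z hz =>
    hsub ⟨by linarith [hz.1], by linarith [hz.2]⟩
  have hev : ∀ z ∈ squareNhd ε, φ =ᶠ[𝓝 z] proj ∘ Ψ := fun z hz => by
    filter_upwards [(isOpen_squareNhd ε).mem_nhds hz] with w hw
    exact (hproj w hw).symm
  have hsm : ∀ z ∈ squareNhd ε, SmoothAt Ψ z := fun z hz =>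
    (smoothAtA_iff hΨ.continuousAt (hev z hz)).1 (h.smooth z (hsrc hz))
  obtain ⟨c, hc, hcj⟩ := h.jacobian
  have hjac : ∀ z ∈ squareNhd ε, jac Ψ z = c := fun z hz => by
    rw [← jacA_eq hΨ.continuousAt (hev z hz)]; exact hcj z (hsrc hz)
  have hbot : ∀ z ∈ square, z.2 = 0 → (Ψ z).2 = 0 := fun z hz h0 => by
    have := h.bottom_edge z hz h0
    rwa [← hproj z (hsq hz)] at this
  have htop : ∀ z ∈ square, z.2 = 1 → (Ψ z).2 = 1 := fun z hz h0 => by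
    have := h.top_edge z hz h0
    rwa [← hproj z (hsq hz)] at this
  have hmem : ∀ t : unitInterval, ((0 : ℝ), t) ∈ square := fun t => ⟨le_rfl, zero_le_one⟩
  have hrange : Ψ '' {z | z.1 = 0} = range fun t : unitInterval => Ψ (0, t) := by
    ext w; constructor
    · rintro ⟨⟨x, t⟩, hx, rfl⟩
      have hx' : x = 0 := hx
      exact ⟨t, by rw [hx']⟩
    · rintro ⟨t, rfl⟩; exact ⟨(0, t), rfl, rfl⟩
  have hlift : IsCurveLift (Ψ '' {z | z.1 = 0}) γ := by
    refine ⟨⟨fun t => Ψ (0, t), by fun_prop, fun s t hst => ?_, hbot _ (hmem 0) rfl,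
      htop _ (hmem 1) rfl, fun t ht => ?_, hrange⟩, ?_⟩
    · have h1 : φ (0, s) = φ (0, t) := by
        rw [← hproj _ (hsq (hmem s)), ← hproj _ (hsq (hmem t))]; exact congrArg proj hst
      exact congrArg Prod.snd (φ.injOn (hsrc (hsq (hmem s))) (hsrc (hsq (hmem t))) h1)
    · refine (hsm _ (hsq (hmem t))).interior_of_jac_ne_zero ?_ ht
      rw [hjac _ (hsq (hmem t))]; exact hc.ne'
    · rw [← h.left_edge, ← image_comp]
      refine image_congr fun z (hz : z.1 = 0) => hproj z (hsq ⟨hz.ge, hz.trans_le zero_le_one⟩)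
  -- The left edge is sent to some lift of γ. It shares the point w₀ with `γt`, so the translation
  -- between them is trivial.
  have hleft : Ψ '' {z | z.1 = 0} = γt := by
    obtain ⟨m, hm⟩ := hγt.exists_eq_shift hlift h.brouwer.1
    have h1 : w₀ ∈ affineX 1 m '' γt := by rw [← hm, ← hΨ0]; exact ⟨(0, 0), rfl, rfl⟩
    obtain ⟨v, hv, hvw⟩ := h1
    have h2 : v = w₀ := hγt.injOn h.brouwer.1 hv hw₀ (by rw [← hvw, proj_affineX_one])
    rw [h2] at hvw
    have h3 := congrArg Prod.fst hvw
    simp only [affineX, one_mul, add_eq_left] at h3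
    rw [hm, h3, affineX_one_zero, image_id]
  refine ⟨ε, Ψ, hε, hΨ, hsrc, hproj, hsm, ⟨c, hc, hjac⟩, hleft, hbot, htop, ?_⟩
  refine exists_int_shift_on (isPreconnected_slab isPreconnected_Ioo)
    (hΨ.comp deckT.continuous).continuousOn (hG.comp hΨ).continuousOn fun z (hz : z.1 ∈ Ioo (-ε) ε) => ?_
  have hz1 : z ∈ squareNhd ε := ⟨hz.1, by linarith [hz.2]⟩
  have hz2 : deckT z ∈ squareNhd ε := by
    rw [deckT_apply]
    exact ⟨by simp only [affineX]; linarith [hz.1], by simp only [affineX]; linarith [hz.2]⟩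
  rw [hproj _ hz2, hGg, hproj _ hz1]
  exact (hULe z (hcol z ⟨by linarith [hz.1], by linarith [hz.2]⟩)).symm

namespace LiftedChart
variable {G : Strip → Strip} {φ : OpenPartialHomeomorph Strip Annulus} {γt : Set Strip}
  {ε : ℝ} {Ψ : Strip → Strip} (h : LiftedChart G φ γt ε Ψ)
include h

theorem eventuallyEq {z : Strip} (hz : z ∈ squareNhd ε) : φ =ᶠ[𝓝 z] proj ∘ Ψ := by
  filter_upwards [(isOpen_squareNhd ε).mem_nhds hz] with w hw
  exact (h.proj_eq w hw).symm

theorem injOn_proj : InjOn (fun z => proj (Ψ z)) (squareNhd ε) := fun z hz w hw hzw => by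
  simp only [h.proj_eq z hz, h.proj_eq w hw] at hzw
  exact φ.injOn (h.source hz) (h.source hw) hzw

theorem injOn : InjOn Ψ (squareNhd ε) := fun _ hz _ hw hzw =>
  h.injOn_proj hz hw (congrArg proj hzw)

/-- On a slab of width 1 the projection is injective, so openness of the image under φ can be lifted
there. -/
theorem isOpen_image {U : Set Strip} (hU : IsOpen U) (hsub : U ⊆ squareNhd ε) :
    IsOpen (Ψ '' U) := by
  refine isOpen_iff_mem_nhds.2 ?_
  rintro _ ⟨z, hz, rfl⟩
  let V : Set Strip := {w | w.1 ∈ Ioo ((Ψ z).1 - 1 / 2) ((Ψ z).1 + 1 / 2)}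
  have hV : IsOpen V := isOpen_Ioo.preimage continuous_fst
  have hzV : Ψ z ∈ V := ⟨by linarith, by linarith⟩
  have hU' : IsOpen (U ∩ Ψ ⁻¹' V) := hU.inter (hV.preimage h.continuous)
  have hφ : IsOpen (φ '' (U ∩ Ψ ⁻¹' V)) :=
    φ.isOpen_image_of_subset_source hU' fun w hw => h.source (hsub hw.1)
  have hW : IsOpen (proj ⁻¹' (φ '' (U ∩ Ψ ⁻¹' V)) ∩ V) := (hφ.preimage continuous_proj).inter hV
  refine mem_of_superset (hW.mem_nhds ⟨⟨z, ⟨hz, hzV⟩, (h.proj_eq z (hsub hz)).symm⟩, hzV⟩) ?_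
  rintro w ⟨⟨u, ⟨huU, huV⟩, huw⟩, hwV⟩
  refine ⟨u, huU, eq_of_proj_eq_of_abs_lt ?_ ?_⟩
  · rw [h.proj_eq u (hsub huU), huw]
  · have h1 : (Ψ u).1 ∈ Ioo _ _ := huV
    have h2 : w.1 ∈ Ioo _ _ := hwV
    rw [abs_lt]
    constructor <;> linarith [h1.1, h1.2, h2.1, h2.2]

end LiftedChart

/-- The reflection `(x, y) ↦ (1 - x, y)`. -/
theorem affineX_neg_one_comp_self (z : Strip) : affineX (-1) 1 (affineX (-1) 1 z) = z := by
  simp [affineX]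

theorem affineX_neg_one_image_squareNhd {ε : ℝ} {z : Strip} (hz : z ∈ squareNhd ε) :
    affineX (-1) 1 z ∈ squareNhd ε :=
  ⟨by simp only [affineX]; linarith [hz.2], by simp only [affineX]; linarith [hz.1]⟩

theorem affineX_neg_one_mem_square {z : Strip} (hz : z ∈ square) : affineX (-1) 1 z ∈ square :=
  ⟨by simp only [affineX]; linarith [hz.2], by simp only [affineX]; linarith [hz.1]⟩

section
variable {f : Annulus ≃ₜ Annulus} {F H : Strip ≃ₜ Strip} {α : ℝ} {Q Q' : ℕ} {P P' : ℤ}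
  {φ : OpenPartialHomeomorph Strip Annulus} {γt : Set Strip} {ε : ℝ} {Ψ : Strip → Strip}

theorem smoothAt_mul_reflJ (hs : ∀ z, SmoothAt H z) (z : Strip) : SmoothAt ⇑(H * reflJ) z := by
  have : ⇑(H * reflJ) = H ∘ affineX (-1) 0 := funext fun z => congrArg H (reflJ_apply z)
  rw [this]
  exact (hs _).comp (smoothAt_affineX _ _ _)

theorem jac_mul_reflJ (hs : ∀ z, SmoothAt H z) (z : Strip) :
    jac ⇑(H * reflJ) z = -jac H (reflJ z) := by
  have : ⇑(H * reflJ) = H ∘ affineX (-1) 0 := funext fun z => congrArg H (reflJ_apply z)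
  rw [this, jac_comp (hs _) (smoothAt_affineX _ _ _), jac_affineX, ← reflJ_apply]
  ring

/-- The chart of the annulus bounded by `F^{Q,-P}(γ)` and `γ` that is obtained from the lift `Ψ` of a
chart of the renormalization. -/
theorem LiftedChart.stripChart (h : LiftedChart (renormLift F H Q (-P)) φ γt ε Ψ)
    (hF : GoodLift f F α) (hconj : ConjTo H (liftPow F Q' (-P'))) (hH : H ∈ bdryGroup)
    (hs : ∀ z, SmoothAt H z) (hj : ∀ z, 0 < jac H z)
    (hneg : (Q : ℝ) * α - P < 0) (hpos : 0 < (Q' : ℝ) * α - P')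
    (hlt : -((Q : ℝ) * α - P) < Q' * α - P') :
    (∀ z ∈ squareNhd ε, SmoothAt (⇑(H * reflJ) ∘ Ψ ∘ affineX (-1) 1) z) ∧
    (∀ z ∈ squareNhd ε, jac (⇑(H * reflJ) ∘ Ψ ∘ affineX (-1) 1) z =
      jac H (reflJ (Ψ (affineX (-1) 1 z))) * jac Ψ (affineX (-1) 1 z)) ∧
    StripChart (liftPow F Q (-P)) (⇑(H * reflJ) '' γt) ε (⇑(H * reflJ) ∘ Ψ ∘ affineX (-1) 1) := by
  have hε := h.eps_pos
  set K := H * reflJ with hK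
  set Φ : Strip → Strip := K ∘ Ψ ∘ affineX (-1) 1 with hΦ
  have hKb : K ∈ bdryGroup := mul_mem hH reflJ_mem_bdryGroup
  have hsq := square_subset_squareNhd hε
  have hcont : Continuous Φ := K.continuous.comp (h.continuous.comp (continuous_affineX _ _))
  have hΨρ : ∀ z ∈ squareNhd ε, SmoothAt (Ψ ∘ affineX (-1) 1) z := fun z hz =>
    (h.smooth _ (affineX_neg_one_image_squareNhd hz)).comp (smoothAt_affineX _ _ _)
  have hsm : ∀ z ∈ squareNhd ε, SmoothAt Φ z := fun z hz =>
    (smoothAt_mul_reflJ hs _).comp (hΨρ z hz)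
  have hjac : ∀ z ∈ squareNhd ε, jac Φ z =
      jac H (reflJ (Ψ (affineX (-1) 1 z))) * jac Ψ (affineX (-1) 1 z) := fun z hz => by
    rw [hΦ, jac_comp (smoothAt_mul_reflJ hs _) (hΨρ z hz),
      jac_comp (h.smooth _ (affineX_neg_one_image_squareNhd hz)) (smoothAt_affineX _ _ _),
      jac_mul_reflJ hs, jac_affineX, Function.comp]
    ring
  have hρ0 : ∀ {x : ℝ}, affineX (-1) 1 (x, (0 : unitInterval)) = (1 - x, 0) := fun {x} =>
    Prod.ext (by simp only [affineX]; ring) rfl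
  have hbot : ∀ z ∈ square, z.2 = 0 → (Φ z).2 = 0 := fun z hz h0 =>
    (hKb _).1.2 (h.bottom _ (affineX_neg_one_mem_square hz) h0)
  have hb : ∀ x ∈ Icc (0 : ℝ) 1, Φ (x, 0) = ((Φ (x, 0)).1, 0) := fun x hx =>
    Prod.ext rfl (hbot (x, 0) hx rfl)
  -- The two reflections cancel, so Φ has positive Jacobian and positive derivative along the bottom
  -- edge.
  have hmono : StrictMonoOn (fun x : ℝ => (Φ (x, 0)).1) (Icc 0 1) := by
    refine strictMonoOn_of_deriv_pos (convex_Icc 0 1) (by fun_prop) fun x hx => ?_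
    rw [interior_Icc] at hx
    have hx' : ((x, 0) : Strip) ∈ square := ⟨hx.1.le, hx.2.le⟩
    obtain ⟨c, hc, hcj⟩ := h.jacobian
    obtain ⟨d, hd, hd'⟩ := (hsm _ (hsq hx')).exists_deriv_pos (by
      rw [hjac _ (hsq hx'), hcj _ (affineX_neg_one_image_squareNhd (hsq hx'))]
      exact mul_pos (hj _) hc) (hbot _ hx' rfl)
    rw [hd'.deriv]; exact hd
  obtain ⟨m, hm⟩ := h.equivariant
  -- A translation by m in the renormalized strip becomes the power -m of F^{Q',-P'}, while ρ
  -- exchanges the roles of z and T z.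
  have hpt : ∀ z : Strip, z.1 ∈ Ioo (-ε) ε →
      Φ z = liftPow F (-m * Q' + Q) (m * P' - P) (Φ (deckT z)) := fun z hz => by
    have h1 := hm (affineX (-1) 0 z) ⟨by simp only [affineX]; linarith [hz.2],
      by simp only [affineX]; linarith [hz.1]⟩
    have h2 : deckT (affineX (-1) 0 z) = affineX (-1) 1 z := by
      rw [deckT_apply]; exact Prod.ext (by simp [affineX]) rfl
    have h3 : affineX (-1) 1 (deckT z) = affineX (-1) 0 z := by
      rw [deckT_apply]; exact Prod.ext (by simp [affineX]) rfl
    simp only [hΦ, Function.comp]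
    rw [h3, ← h2, h1, hK, hconj.mul_reflJ_shift, mul_reflJ_renormLift, liftPow_zpow hF.comm,
      liftPow_mul_apply hF.comm]
    ring_nf
  have h0m : (0 : ℝ) ∈ Icc (0 : ℝ) 1 := left_mem_Icc.2 zero_le_one
  have h1m : (1 : ℝ) ∈ Icc (0 : ℝ) 1 := right_mem_Icc.2 zero_le_one
  have hT0 : deckT ((0 : ℝ), (0 : unitInterval)) = (1, 0) := by
    rw [deckT_apply]; exact Prod.ext (by simp [affineX]) rfl
  have h01 : Φ (0, 0) = liftPow F (-m * Q' + Q) (m * P' - P) ((Φ (1, 0)).1, 0) := by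
    rw [hpt _ ⟨by simpa using hε, by simpa using hε⟩, hT0, ← hb 1 h1m]
  have hlt01 : (Φ (0, 0)).1 < (Φ (1, 0)).1 := hmono h0m h1m zero_lt_one
  have hm0 : m = 0 := by
    rcases lt_trichotomy m 0 with h0 | h0 | h0
    -- For m < 0 the map taking Φ(1,0) to Φ(0,0) has positive translation number, because the
    -- displacement of F^{Q',-P'} exceeds that of F^{Q,-P}.
    · exfalso
      have h2 := hF.pos (-m * Q' + Q) (m * P' - P) (by
        have : (m : ℝ) ≤ -1 := by exact_mod_cast Int.le_sub_one_of_lt h0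
        push_cast
        nlinarith) (Φ (1, 0)).1
      rw [← h01] at h2
      exact lt_asymm h2 hlt01
    · exact h0
    -- For m > 0 the bottom edge of the image is long enough to contain F^{Q',-P'}(Φ(0,0)). This
    -- point and Φ(0,0) represent the same point of the renormalized annulus, against injectivity of
    -- the chart φ.
    · exfalso
      have h2 := hF.neg (Q' + (-m * Q' + Q)) (-P' + (m * P' - P)) (by
        have : (1 : ℝ) ≤ m := by exact_mod_cast h0
        push_cast
        nlinarith) (Φ (1, 0)).1
      rw [← liftPow_mul_apply hF.comm, ← h01] at h2
      have h3 := hF.pos Q' (-P') (by push_cast; linarith) (Φ (0, 0)).1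
      rw [← hb 0 h0m] at h3
      obtain ⟨t, ht, ht'⟩ := intermediate_value_Icc (zero_le_one' ℝ)
        (f := fun x : ℝ => (Φ (x, 0)).1) (by fun_prop) ⟨h3.le, h2.le⟩
      have h4 : Φ (t, 0) = liftPow F Q' (-P') (Φ (0, 0)) := by
        refine Prod.ext ht' ?_
        rw [hbot (t, 0) ht rfl]
        exact (((liftPow_mem_bdryGroup hF.bdry _ _) _).1.2 (hbot (0, 0) h0m rfl)).symm
      have h5 : Ψ (affineX (-1) 1 (t, 0)) =
          affineX 1 ((-1 : ℤ) : ℝ) (Ψ (affineX (-1) 1 (0, 0))) := by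
        apply K.injective
        rw [hK, hconj.mul_reflJ_shift, neg_neg, zpow_one]
        exact h4
      have h6 := h.injOn_proj (affineX_neg_one_image_squareNhd (hsq (show (t, 0) ∈ square from ht)))
        (affineX_neg_one_image_squareNhd (hsq (show ((0 : ℝ), (0 : unitInterval)) ∈ square from h0m)))
        (by simp only; rw [h5, proj_affineX_one])
      have h7 := congrArg Prod.fst h6
      simp only [affineX] at h7
      have : t = 0 := by linarith
      rw [this] at ht'
      simp only at ht'
      linarith
  have hρleft : affineX (-1) 1 '' {z | z.1 = 1} = {z | z.1 = 0} := by
    ext z; constructor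
    · rintro ⟨w, hw, rfl⟩
      have : w.1 = 1 := hw
      simp [affineX, this]
    · intro hz
      have : z.1 = 0 := hz
      exact ⟨affineX (-1) 1 z, by simp [affineX, this], affineX_neg_one_comp_self z⟩
  have hright : Φ '' {z | z.1 = 1} = K '' γt := by
    rw [hΦ, image_comp, image_comp, hρleft, h.left]
  have hequiv : ∀ z : Strip, z.1 ∈ Ioo (-ε) ε → liftPow F Q (-P) (Φ (deckT z)) = Φ z :=
    fun z hz => by
      rw [hpt z hz, hm0]; simp
  refine ⟨hsm, hjac, hε, hcont, ?_, ?_, ?_, hright, hequiv, hbot, hmono⟩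
  · intro z hz w hw hzw
    have h1 := h.injOn (affineX_neg_one_image_squareNhd hz) (affineX_neg_one_image_squareNhd hw)
      (K.injective hzw)
    rw [← affineX_neg_one_comp_self z, h1, affineX_neg_one_comp_self]
  · intro U hU hsub
    rw [hΦ, image_comp, image_comp]
    refine K.isOpenMap _ (h.isOpen_image ?_ ?_)
    · have : affineX (-1) 1 '' U = affineX (-1) 1 ⁻¹' U :=
        congrFun (image_eq_preimage_of_inverse affineX_neg_one_comp_self
          affineX_neg_one_comp_self) U
      rw [this]; exact hU.preimage (continuous_affineX _ _)
    · rintro _ ⟨z, hz, rfl⟩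
      exact affineX_neg_one_image_squareNhd (hsub hz)
  · rw [← hright, ← image_comp]
    ext w; constructor
    · rintro ⟨z, hz, rfl⟩
      have hz0 : z.1 = 0 := hz
      refine ⟨deckT z, ?_, hequiv z ⟨by rw [hz0]; linarith, by rw [hz0]; exact hε⟩⟩
      simp [deckT_apply, affineX, hz0]
    · rintro ⟨z, hz, rfl⟩
      have hz1 : z.1 = 1 := hz
      have h2 : deckT (affineX 1 (-1) z) = z := by
        rw [deckT_apply, affineX_one_add]; simp [affineX_one_zero]
      refine ⟨affineX 1 (-1) z, by simp [affineX, hz1], ?_⟩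
      rw [← hequiv _ ⟨by simp [affineX, hz1, hε], by simp [affineX, hz1, hε]⟩, h2]
      rfl

end

/-! ### Charts of the annulus -/

theorem isOpenMap_proj : IsOpenMap proj :=
  (QuotientAddGroup.isOpenMap_coe (N := AddSubgroup.zmultiples (1 : ℝ))).prodMap IsOpenMap.id

/-- Injectivity on the compact square together with local injectivity gives injectivity on a
neighbourhood, and openness of the maps makes the restriction a chart. -/
theorem exists_openPartialHomeomorph {Φ : Strip → Strip} {ε : ℝ} (hε : 0 < ε) (hc : Continuous Φ)
    (hinj : InjOn Φ (squareNhd ε)) (hopen : ∀ U, IsOpen U → U ⊆ squareNhd ε → IsOpen (Φ '' U))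
    (hproj : InjOn proj (Φ '' square)) :
    ∃ e : OpenPartialHomeomorph Strip Annulus, square ⊆ e.source ∧ e.source ⊆ squareNhd ε ∧
      ∀ z, e z = proj (Φ z) := by
  have h1 : InjOn (proj ∘ Φ) square := fun z hz w hw hzw =>
    hinj (square_subset_squareNhd hε hz) (square_subset_squareNhd hε hw)
      (hproj (mem_image_of_mem _ hz) (mem_image_of_mem _ hw) hzw)
  obtain ⟨t, ht, htinj⟩ := h1.exists_mem_nhdsSet isCompact_square
    (fun z _ => (continuous_proj.comp hc).continuousAt) fun z hz => by
      let V : Set Strip := {w | w.1 ∈ Ioo ((Φ z).1 - 1 / 2) ((Φ z).1 + 1 / 2)}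
      have hV : IsOpen V := isOpen_Ioo.preimage continuous_fst
      refine ⟨squareNhd ε ∩ Φ ⁻¹' V, ((isOpen_squareNhd ε).inter (hV.preimage hc)).mem_nhds
        ⟨square_subset_squareNhd hε hz, ⟨by linarith, by linarith⟩⟩, ?_⟩
      rintro u ⟨hu, huV⟩ v ⟨hv, hvV⟩ huv
      refine hinj hu hv (eq_of_proj_eq_of_abs_lt huv ?_)
      have h1 : (Φ u).1 ∈ Ioo _ _ := huV
      have h2 : (Φ v).1 ∈ Ioo _ _ := hvV
      rw [abs_lt]
      constructor <;> linarith [h1.1, h1.2, h2.1, h2.2]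
  obtain ⟨U, hUo, hsU, hUt⟩ := mem_nhdsSet_iff_exists.1 ht
  have hVo : IsOpen (U ∩ squareNhd ε) := hUo.inter (isOpen_squareNhd ε)
  have hVinj : InjOn (proj ∘ Φ) (U ∩ squareNhd ε) := htinj.mono fun z hz => hUt hz.1
  let e := OpenPartialHomeomorph.ofContinuousOpenRestrict
    (hVinj.toPartialEquiv (proj ∘ Φ) (U ∩ squareNhd ε))
    (continuous_proj.comp hc).continuousOn (by
      intro W hW
      obtain ⟨W', hW', rfl⟩ := hW
      have : (U ∩ squareNhd ε).domRestrict (proj ∘ Φ) '' (Subtype.val ⁻¹' W') =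
          proj '' (Φ '' (W' ∩ (U ∩ squareNhd ε))) := by
        ext a; constructor
        · rintro ⟨⟨z, hz⟩, hzW, rfl⟩
          exact ⟨_, ⟨z, ⟨hzW, hz⟩, rfl⟩, rfl⟩
        · rintro ⟨_, ⟨z, ⟨hzW, hz⟩, rfl⟩, rfl⟩
          exact ⟨⟨z, hz⟩, hzW, rfl⟩
      exact this ▸ isOpenMap_proj _ (hopen _ (hW'.inter hVo) fun z hz => hz.2.2)) hVo
  exact ⟨e, fun z hz => ⟨hsU hz, square_subset_squareNhd hε hz⟩, fun z hz => hz.2, fun z => rfl⟩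

/-- A formula for the inverse of a chart of the annulus that is obtained from a chart `φ` of the
renormalization. -/
theorem LiftedChart.symm_eventuallyEq {G : Strip → Strip} {φ e : OpenPartialHomeomorph Strip Annulus}
    {γt : Set Strip} {ε : ℝ} {Ψ : Strip → Strip} (h : LiftedChart G φ γt ε Ψ) (K : Strip ≃ₜ Strip)
    (he : e.source ⊆ squareNhd ε) (heq : ∀ z, e z = proj (K (Ψ (affineX (-1) 1 z)))) {w : Strip}
    (hw : w ∈ e.source) (k : ℤ) {z : Strip} (hz : z = affineX 1 k (K (Ψ (affineX (-1) 1 w)))) :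
    e.symm ∘ proj =ᶠ[𝓝 z]
      affineX (-1) 1 ∘ (φ.symm ∘ proj) ∘ ⇑K⁻¹ ∘ affineX 1 ((-k : ℤ) : ℝ) := by
  have hρw := affineX_neg_one_image_squareNhd (he hw)
  have hv : K⁻¹ (affineX 1 ((-k : ℤ) : ℝ) z) = Ψ (affineX (-1) 1 w) := by
    rw [hz, affineX_one_add]; push_cast
    rw [neg_add_cancel, affineX_one_zero, id, inv_apply_self_homeo]
  let v : Strip → Strip := fun z => K⁻¹ (affineX 1 ((-k : ℤ) : ℝ) z)
  have hvc : Continuous v := (K⁻¹).continuous.comp (continuous_affineX _ _)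
  have hpv : proj (v z) = φ (affineX (-1) 1 w) := by
    rw [← h.proj_eq _ hρw]; exact congrArg proj hv
  have htgt : proj (v z) ∈ φ.target := by rw [hpv]; exact φ.map_source (h.source hρw)
  have hsymm : φ.symm (proj (v z)) = affineX (-1) 1 w := by
    rw [hpv, φ.left_inv (h.source hρw)]
  have hφc : ContinuousAt (fun z => φ.symm (proj (v z))) z :=
    ContinuousAt.comp (f := fun z => proj (v z)) (φ.continuousAt_symm htgt)
      (continuous_proj.comp hvc).continuousAt
  have hΨc : ContinuousAt (fun z => (Ψ (φ.symm (proj (v z)))).1 - (v z).1) z :=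
    (continuousAt_fst.comp (h.continuous.continuousAt.comp hφc)).sub
      (continuous_fst.comp hvc).continuousAt
  have hRc : ContinuousAt (fun z => affineX (-1) 1 (φ.symm (proj (v z)))) z :=
    (continuous_affineX _ _).continuousAt.comp hφc
  have e1 : ∀ᶠ z' in 𝓝 z, proj (v z') ∈ φ.target :=
    (continuous_proj.comp hvc).continuousAt.eventually (φ.open_target.mem_nhds htgt)
  have e2 : ∀ᶠ z' in 𝓝 z, φ.symm (proj (v z')) ∈ squareNhd ε :=
    hφc.eventually ((isOpen_squareNhd ε).mem_nhds (by
      show φ.symm (proj (v z)) ∈ _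
      rw [hsymm]; exact hρw))
  have e3 : ∀ᶠ z' in 𝓝 z, affineX (-1) 1 (φ.symm (proj (v z'))) ∈ e.source :=
    hRc.eventually (e.open_source.mem_nhds (by
      show affineX (-1) 1 (φ.symm (proj (v z))) ∈ _
      rw [hsymm, affineX_neg_one_comp_self]; exact hw))
  -- Ψ φ⁻¹ π v and v have the same projection; a difference of first coordinates below 1 identifies
  -- them.
  have e4 : ∀ᶠ z' in 𝓝 z, (Ψ (φ.symm (proj (v z')))).1 - (v z').1 ∈ Ioo (-1 : ℝ) 1 :=
    hΨc.eventually (isOpen_Ioo.mem_nhds (by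
      show (Ψ (φ.symm (proj (v z)))).1 - (v z).1 ∈ _
      rw [hsymm, show v z = _ from hv, sub_self]; constructor <;> norm_num))
  filter_upwards [e1, e2, e3, e4] with z' h1 h2 h3 h4
  have h5 : Ψ (φ.symm (proj (v z'))) = v z' :=
    eq_of_proj_eq_of_abs_lt (by rw [h.proj_eq _ h2, φ.right_inv h1]) (abs_lt.2 h4)
  have h6 : e (affineX (-1) 1 (φ.symm (proj (v z')))) = proj z' := by
    rw [heq, affineX_neg_one_comp_self, h5, apply_inv_self_homeo, proj_affineX_one]
  show e.symm (proj z') = _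
  rw [← h6, e.left_inv h3]
  rfl

theorem image_affineX_eq (m : ℤ) (γ : Set Strip) : affineX 1 m '' γ = ⇑(deckT ^ m) '' γ :=
  image_congr fun z _ => (deckT_zpow_apply m z).symm

theorem IsSimpleCurve.image_shift {γ : Set Strip} (h : IsSimpleCurve γ) (m : ℤ) :
    IsSimpleCurve (affineX 1 m '' γ) := by
  rw [image_affineX_eq]; exact h.image (zpow_mem deckT_mem_bdryGroup m)

theorem base_image_shift {γ : Set Strip} (h : IsSimpleCurve γ) (m : ℤ) :
    base (affineX 1 m '' γ) = base γ + m := by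
  rw [image_affineX_eq, base_image (zpow_mem deckT_mem_bdryGroup m) h, deckT_zpow_apply]
  simp [affineX]

/-- Any lifts admitted in `annulusRegion` are translates of γ₁ and γ₂ by integers l and k; the order
of the base points forces k = l. -/
theorem annulusRegion_subset {γ₁ γ₂ : Set Strip} (h₁ : IsSimpleCurve γ₁) (h₂ : IsSimpleCurve γ₂)
    (hi₁ : InjOn proj γ₁) (hi₂ : InjOn proj γ₂) (hlt : base γ₁ < base γ₂)
    (hlt' : base γ₂ < base γ₁ + 1) :
    annulusRegion (proj '' γ₁) (proj '' γ₂) ⊆ proj '' stripRegion γ₁ γ₂ := by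
  rintro a ⟨δ₁, δ₂, hδ₁, hδ₂, hl, hl', z, hz, rfl⟩
  have hb := hl.base_lt hδ₁.1 hδ₂.1
  have hb' := hl'.base_lt hδ₂.1 (hδ₁.1.image deckT_mem_bdryGroup)
  rw [base_image deckT_mem_bdryGroup hδ₁.1, deckT_apply] at hb'
  obtain ⟨l, rfl⟩ := IsCurveLift.exists_eq_shift ⟨h₁, rfl⟩ hδ₁ (h₁.isSimpleCurveA hi₁)
  obtain ⟨k, rfl⟩ := IsCurveLift.exists_eq_shift ⟨h₂, rfl⟩ hδ₂ (h₂.isSimpleCurveA hi₂)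
  simp only [affineX, one_mul] at hb'
  rw [base_image_shift h₁, base_image_shift h₂] at hb
  rw [base_image_shift h₁, base_image_shift h₂] at hb'
  have hkl : k = l := by
    have h3 : (k : ℝ) < l + 1 := by linarith
    have h4 : (l : ℝ) < k + 1 := by linarith
    have h5 : k < l + 1 := by exact_mod_cast h3
    have h6 : l < k + 1 := by exact_mod_cast h4
    omega
  subst hkl
  have hz' : affineX 1 k (affineX 1 (-k) z) = z := by
    rw [affineX_one_add, add_neg_cancel, affineX_one_zero, id]
  refine ⟨affineX 1 (-k) z, ⟨fun h => hz.1 ?_, fun h => hz.2 ?_⟩, ?_⟩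
  · rw [← hz']; exact shift_mem_leftSide _ h
  · rw [← hz']; exact shift_mem_rightSide _ h
  · conv_rhs => rw [← hz', proj_affineX_one]

section
variable {f : Annulus ≃ₜ Annulus} {F : Strip ≃ₜ Strip} {α : ℝ} {Q N : ℕ} {P : ℤ} {γ : Set Strip}
  (hF : GoodLift f F α) (hγ : DisjointLifts F N γ) (hQ : 1 ≤ Q) (hQN : Q < N)
  (hneg : (Q : ℝ) * α - P < 0) (hneg' : -1 < (Q : ℝ) * α - P)

include hF in
theorem GoodLift.image_proj (S : Set Strip) :
    (f ^ Q) '' (proj '' S) = proj '' (liftPow F Q (-P) '' S) := by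
  rw [← image_comp, ← image_comp]
  refine image_congr fun z _ => ?_
  rw [Function.comp, Function.comp, proj_liftPow hF.lift, homeo_pow_apply]

include hF hγ hQN in
theorem GoodLift.injOn_image : InjOn proj (liftPow F Q (-P) '' γ) := by
  rintro _ ⟨z, hz, rfl⟩ _ ⟨w, hw, rfl⟩ hzw
  rw [proj_liftPow hF.lift, proj_liftPow hF.lift, ← homeo_pow_apply, ← homeo_pow_apply] at hzw
  rw [hγ.injOn (by omega) hz hw ((f ^ Q).injective hzw)]

-- As Q α - P > -1, the map F^{-Q,P-m} moves γ to the left; applying F^{Q,-P} gives the claim.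
include hF hγ hQ hQN hneg' in
theorem GoodLift.leftOf_shift (m : ℕ) (hm : 0 < m) :
    LeftOf (affineX 1 (-m) '' γ) (liftPow F Q (-P) '' γ) := by
  have h1 := hγ.disjoint (-Q) (P - m) (by simp; omega) (by simpa using hQN)
  have hm1 : (1 : ℝ) ≤ m := by exact_mod_cast hm
  have h2 := hF.leftOf_of_neg hγ.simple h1 (by push_cast; linarith)
  have h3 := hF.leftOf_image (hγ.simple.image (liftPow_mem_bdryGroup hF.bdry _ _)) hγ.simple h2
    Q (-P)
  rw [← image_comp] at h3
  have h4 : ⇑(liftPow F Q (-P)) ∘ ⇑(liftPow F (-Q) (P - m)) = affineX 1 (-m) := funext fun z => by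
    rw [Function.comp, liftPow_mul_apply hF.comm, add_neg_cancel,
      show -P + (P - m) = -(m : ℤ) by ring, liftPow, zpow_zero, mul_one, deckT_zpow_apply]
    push_cast; rfl
  rwa [h4] at h3

include hF hγ hQ hQN hneg hneg' in
/-- The admissible coordinate for `(f^Q(γ), γ)` that is obtained from a chart of the strip. -/
theorem GoodLift.isAdmissible {ε : ℝ} {Φ : Strip → Strip}
    (hΦ : StripChart (liftPow F Q (-P)) γ ε Φ)
    (hsm : ∀ z ∈ squareNhd ε, SmoothAt Φ z) (hjac : ∃ c : ℝ, 0 < c ∧ ∀ z ∈ squareNhd ε, jac Φ z = c)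
    (htop : ∀ z ∈ square, z.2 = 1 → (Φ z).2 = 1) {e : OpenPartialHomeomorph Strip Annulus}
    (hsq : square ⊆ e.source) (hsrc : e.source ⊆ squareNhd ε) (he : ∀ z, e z = proj (Φ z))
    (hsymm : ∀ z, proj z ∈ e.target → SmoothAt (e.symm ∘ proj) z) :
    IsAdmissible ⇑((f ^ Q)⁻¹) ((f ^ Q) '' (proj '' γ)) e := by
  have hS := liftPow_mem_bdryGroup hF.bdry Q (-P)
  have hinv : ⇑((f ^ Q)⁻¹) '' ((f ^ Q) '' (proj '' γ)) = proj '' γ :=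
    (f ^ Q).toEquiv.symm_image_image _
  have hev : ∀ z : Strip, e =ᶠ[𝓝 z] proj ∘ Φ := fun z => Eventually.of_forall he
  have hbr := hγ.isBrouwerCurve hF.lift (j := Q) (by omega) hQN
  have hedge : ∀ s : Set Strip, e '' s = proj '' (Φ '' s) := fun s => by
    rw [← image_comp]; exact image_congr fun z _ => he z
  refine
    { brouwer := ⟨?_, ?_⟩
      square_subset := hsq
      region_subset := ?_
      smooth := fun z hz => (smoothAtA_iff hΦ.continuous.continuousAt (hev z)).2 (hsm z (hsrc hz))
      smooth_symm := hsymm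
      jacobian := ?_
      left_edge := ?_
      right_edge := ?_
      bottom_edge := fun z hz h0 => by rw [he]; exact hΦ.bottom z hz h0
      top_edge := fun z hz h0 => by rw [he]; exact htop z hz h0
      equivariant := ?_ }
  · rw [hF.image_proj]
    exact (hγ.simple.image hS).isSimpleCurveA (hF.injOn_image hγ hQN)
  · rw [hinv]
    have h1 := hbr.2.symm
    rwa [image_congr fun x _ => (homeo_pow_apply f Q x).symm] at h1
  · rw [hinv, hF.image_proj (P := P)]
    have hbase := (hF.leftOf_of_neg hγ.simple (hγ.disjoint Q (-P) (by simp; omega)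
      (by simpa using hQN)) (by push_cast; linarith)).base_lt (hγ.simple.image hS) hγ.simple
    have hbase' := (hF.leftOf_shift hγ hQ hQN hneg' 1 one_pos).base_lt
      (by simpa using hγ.simple.image_shift (-1)) (hγ.simple.image hS)
    have h1 := base_image_shift hγ.simple (-1)
    simp only [Nat.cast_one] at hbase'
    push_cast at h1
    rw [h1] at hbase'
    refine (annulusRegion_subset (hγ.simple.image hS) hγ.simple (hF.injOn_image hγ hQN)
      (hγ.injOn (by omega)) hbase (by linarith)).trans ?_
    refine (image_mono (hΦ.stripRegion_subset hS
      (strictMono_bottom (liftPow_comm hF.comm _ _) hS) hγ.simple)).trans ?_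
    rw [← hedge]
    exact (image_mono hsq).trans e.image_source_eq_target.subset
  · obtain ⟨c, hc, hcj⟩ := hjac
    exact ⟨c, hc, fun z hz =>
      (jacA_eq hΦ.continuous.continuousAt (hev z)).trans (hcj z (hsrc hz))⟩
  · rw [hedge, hΦ.left, hF.image_proj]
  · rw [hedge, hΦ.right, hinv]
  · refine ⟨{z : Strip | z.1 ∈ Ioo (-ε) ε} ∩ (e.source ∩ deckT ⁻¹' e.source),
      (isOpen_Ioo.preimage continuous_fst).inter
        (e.open_source.inter (e.open_source.preimage deckT.continuous)), fun z hz => ?_,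
      fun z hz => hz.2.1, ?_, fun z hz => ?_⟩
    · have hz0 : z.1 = 0 := hz
      refine ⟨⟨by rw [hz0]; linarith [hΦ.eps_pos], by rw [hz0]; exact hΦ.eps_pos⟩,
        hsq ⟨hz0.ge, by rw [hz0]; exact zero_le_one⟩, hsq ?_⟩
      rw [deckT_apply]
      simp [affineX, hz0, square]
    · rintro _ ⟨z, hz, rfl⟩; exact hz.2.2
    · rw [he, he, ← hΦ.equivariant z hz.1, proj_liftPow hF.lift, ← homeo_pow_apply]
      exact (f ^ Q).symm_apply_apply _

end

section
variable {f : Annulus ≃ₜ Annulus} {F H : Strip ≃ₜ Strip} {α : ℝ} {Q Q' N : ℕ} {P P' : ℤ}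
  {φ e : OpenPartialHomeomorph Strip Annulus} {γt : Set Strip} {ε : ℝ} {Ψ : Strip → Strip}

theorem mul_reflJ_inv_eq : ⇑(H * reflJ)⁻¹ = affineX (-1) 0 ∘ H.symm := by
  refine funext fun z => (H * reflJ).injective ?_
  rw [apply_inv_self_homeo, mul_apply_homeo, reflJ_apply, Function.comp]
  simp [affineX]

/-- The chart of the annulus that is obtained from a chart of the renormalization. -/
theorem GoodLift.exists_chart (hF : GoodLift f F α) (hconj : ConjTo H (liftPow F Q' (-P')))
    (hH : H ∈ bdryGroup) (hs : ∀ z, SmoothAt H z) (hs' : ∀ z, SmoothAt H.symm z)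
    (hj : ∃ c : ℝ, 0 < c ∧ ∀ z, jac H z = c)
    (hγ : DisjointLifts F N (⇑(H * reflJ) '' γt)) (hQ : 1 ≤ Q) (hQN : Q < N)
    (hneg : (Q : ℝ) * α - P < 0) (hneg' : -1 < (Q : ℝ) * α - P) (hpos : 0 < (Q' : ℝ) * α - P')
    (hlt : -((Q : ℝ) * α - P) < Q' * α - P')
    (h : LiftedChart (renormLift F H Q (-P)) φ γt ε Ψ)
    (hφ : ∀ z, proj z ∈ φ.target → SmoothAt (φ.symm ∘ proj) z) :
    ∃ e : OpenPartialHomeomorph Strip Annulus,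
      IsAdmissible ⇑((f ^ Q)⁻¹) ((f ^ Q) '' (proj '' (⇑(H * reflJ) '' γt))) e ∧
      square ⊆ e.source ∧ e.source ⊆ squareNhd ε ∧
      ∀ z, e z = proj ((H * reflJ) (Ψ (affineX (-1) 1 z))) := by
  obtain ⟨c, hc, hcj⟩ := hj
  obtain ⟨d, hd, hdj⟩ := h.jacobian
  obtain ⟨hsm, hjac, hSC⟩ := h.stripChart hF hconj hH hs (fun z => (hcj z).symm ▸ hc) hneg hpos hlt
  have hKb : H * reflJ ∈ bdryGroup := mul_mem hH reflJ_mem_bdryGroup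
  obtain ⟨e, hsq, hsrc, he⟩ := exists_openPartialHomeomorph h.eps_pos hSC.continuous hSC.injOn
    hSC.isOpen_image (hSC.injOn_proj (liftPow_mem_bdryGroup hF.bdry _ _) hγ.simple
      (hF.leftOf_shift hγ hQ hQN hneg'))
  refine ⟨e, hF.isAdmissible hγ hQ hQN hneg hneg' hSC hsm ⟨c * d, mul_pos hc hd, fun z hz => ?_⟩
    (fun z hz h1 => ?_) hsq hsrc he (fun z hz => ?_), hsq, hsrc, he⟩
  · rw [hjac z hz, hcj, hdj _ (affineX_neg_one_image_squareNhd hz)]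
  · exact (hKb _).2.2 (h.top _ (affineX_neg_one_mem_square hz) h1)
  · have hw := e.map_target hz
    have h1 : proj z = proj ((H * reflJ) (Ψ (affineX (-1) 1 (e.symm (proj z))))) := by
      conv_lhs => rw [← e.right_inv hz]
      exact he _
    obtain ⟨k, hk⟩ := exists_int_of_proj_eq h1
    refine SmoothAt.congr ?_ (h.symm_eventuallyEq (H * reflJ) hsrc he hw k hk)
    have hρw := affineX_neg_one_image_squareNhd (hsrc hw)
    refine (smoothAt_affineX _ _ _).comp (SmoothAt.comp (hφ _ ?_)
      (SmoothAt.comp ?_ (smoothAt_affineX _ _ _)))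
    · rw [Function.comp]
      nth_rw 1 [hk]
      rw [affineX_one_add]; push_cast
      rw [neg_add_cancel, affineX_one_zero, id, inv_apply_self_homeo, h.proj_eq _ hρw]
      exact φ.map_source (h.source hρw)
    · rw [mul_reflJ_inv_eq]
      exact (smoothAt_affineX _ _ _).comp (hs' _)

end

/-! ### Bounds -/

section
variable {f : Annulus ≃ₜ Annulus} {F H : Strip ≃ₜ Strip} {α : ℝ} {Q' r : ℕ} {P' : ℤ}
  {G : Strip → Strip} {φ e : OpenPartialHomeomorph Strip Annulus} {γt : Set Strip} {ε : ℝ}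
  {Ψ : Strip → Strip} {A B D : ℝ≥0}

theorem diffSizeStrip_ne_top (hs : ∀ z, SmoothAt H z) (hs' : ∀ z, SmoothAt H.symm z) :
    diffSizeStrip r H ≠ ⊤ := by
  obtain ⟨C, hC⟩ := exists_derivBound r isCompact_square fun z _ => hs z
  obtain ⟨D, hD⟩ := exists_derivBound r (isCompact_square.image H.continuous) fun z _ => hs' z
  exact (max_lt ((crSize_le hC).trans_lt ENNReal.coe_lt_top)
    ((crSize_le hD).trans_lt ENNReal.coe_lt_top)).ne

theorem exists_derivBound_of_comm {G : Strip ≃ₜ Strip} (hs : ∀ z, SmoothAt G z)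
    (h : ∀ z, G (deckT z) = deckT (G z)) : ∃ C, ∀ z, DerivBound r C G z := by
  obtain ⟨C, hC⟩ := exists_derivBound r isCompact_square fun z _ => hs z
  refine ⟨compBound r C 1, fun z => ?_⟩
  obtain ⟨m, w, hw, rfl⟩ := exists_mem_square z
  have h1 : ∀ z, G (affineX 1 m z) = affineX 1 m (G z) :=
    fun z => by
      have := lift_shift (F := G) (d := 1) (fun z => by rw [h, deckT_apply, Int.cast_one]) m z
      simpa using this
  have h2 : ∀ z, affineX 1 m (affineX 1 (-m) z) = z := fun z => by
    rw [affineX_one_add, add_neg_cancel, affineX_one_zero, id]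
  have h3 : affineX 1 (-m) (affineX 1 m w) = w := congrFun (affineX_neg_comp_self _) w
  refine DerivBound.congr_shift (m := m) (G₂ := G ∘ affineX 1 (-m)) (DerivBound.comp ?_
    (derivBound_affineX abs_one _ _)) (Eventually.of_forall fun z => ?_)
  · rw [h3]; exact hC w hw
  · rw [Function.comp, Function.comp, ← h1, h2]

theorem diffSizeAnnulus_ne_top (hF : GoodLift f F α) : diffSizeAnnulus r f ≠ ⊤ := by
  obtain ⟨C, hC⟩ := exists_derivBound_of_comm (r := r) hF.smooth hF.comm
  obtain ⟨D, hD⟩ := exists_derivBound_of_comm (r := r) hF.smooth_symm (symm_comm hF.comm)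
  refine (max_lt ((crSizeA_le fun z _ => ⟨F, F.continuous.continuousAt, ?_, hC z⟩).trans_lt
    ENNReal.coe_lt_top) ((crSizeA_le fun z _ => ⟨F.symm, F.symm.continuous.continuousAt, ?_,
      hD z⟩).trans_lt ENNReal.coe_lt_top)).ne
  · exact Eventually.of_forall fun z => (hF.lift z).symm
  · exact Eventually.of_forall fun z => by
      have := hF.lift (F.symm z)
      rw [F.apply_symm_apply] at this
      simp [this]

theorem derivBound_of_diffSizeAnnulus (hF : GoodLift f F α) (h : diffSizeAnnulus r f ≤ D) (z : Strip) :
    DerivBound r (2 ^ r * D) F z ∧ DerivBound r (2 ^ r * D) F.symm z := by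
  refine ⟨derivBound_of_crSizeA_le ((le_max_left _ _).trans h) (mem_univ z)
    F.continuous.continuousAt ?_ (hF.smooth z), derivBound_of_crSizeA_le
    ((le_max_right _ _).trans h) (mem_univ z) F.symm.continuous.continuousAt ?_ (hF.smooth_symm z)⟩
  · exact Eventually.of_forall fun z => (hF.lift z).symm
  · exact Eventually.of_forall fun z => by
      have := hF.lift (F.symm z)
      rw [F.apply_symm_apply] at this
      simp [this]

theorem LiftedChart.diffSizeChart_ne_top (h : LiftedChart G φ γt ε Ψ)
    (hφ : ∀ z, proj z ∈ φ.target → SmoothAt (φ.symm ∘ proj) z) : diffSizeChart r φ ≠ ⊤ := by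
  have hsq := square_subset_squareNhd h.eps_pos
  obtain ⟨C, hC⟩ := exists_derivBound r isCompact_square fun z hz => h.smooth z (hsq hz)
  obtain ⟨D, hD⟩ := exists_derivBound r (G := φ.symm ∘ proj) (isCompact_square.image h.continuous)
    (by
      rintro _ ⟨z, hz, rfl⟩
      refine hφ _ ?_
      rw [h.proj_eq z (hsq hz)]; exact φ.map_source (h.source (hsq hz)))
  refine (max_lt ((crSizeA_le fun z hz => ⟨Ψ, h.continuous.continuousAt, h.eventuallyEq (hsq hz),
    hC z hz⟩).trans_lt ENNReal.coe_lt_top)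
    ((crSize_le (C := compBound r D 1) ?_).trans_lt ENNReal.coe_lt_top)).ne
  rintro z ⟨w, hw, hwz⟩
  rw [← h.proj_eq w (hsq hw)] at hwz
  obtain ⟨k, rfl⟩ := exists_int_of_proj_eq hwz.symm
  have h1 : φ.symm ∘ proj = (φ.symm ∘ proj) ∘ affineX 1 ((-k : ℤ) : ℝ) := funext fun z => by
    simp only [Function.comp, proj_affineX_one]
  rw [h1]
  refine DerivBound.comp ?_ (derivBound_affineX abs_one _ _)
  rw [affineX_one_add]; push_cast
  rw [neg_add_cancel, affineX_one_zero]
  exact hD _ (mem_image_of_mem _ hw)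

theorem LiftedChart.derivBound_of_diffSizeChart (h : LiftedChart G φ γt ε Ψ)
    (hφ : ∀ z, proj z ∈ φ.target → SmoothAt (φ.symm ∘ proj) z) (hA : diffSizeChart r φ ≤ A)
    {z : Strip} (hz : z ∈ square) :
    DerivBound r (2 ^ r * A) Ψ z ∧ DerivBound r (2 ^ r * A) (φ.symm ∘ proj) (Ψ z) := by
  have hsq := square_subset_squareNhd h.eps_pos
  refine ⟨derivBound_of_crSizeA_le ((le_max_left _ _).trans hA) hz h.continuous.continuousAt
    (h.eventuallyEq (hsq hz)) (h.smooth z (hsq hz)), derivBound_of_crSize_le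
    ((le_max_right _ _).trans hA) ?_ (hφ _ ?_)⟩
  · exact ⟨z, hz, (h.proj_eq z (hsq hz)).symm⟩
  · rw [h.proj_eq z (hsq hz)]; exact φ.map_source (h.source (hsq hz))

theorem derivBound_liftPow (hD : ∀ z, DerivBound r D F z) (hD' : ∀ z, DerivBound r D F.symm z)
    {a : ℤ} {M : ℕ} (ha : a.natAbs ≤ M) (b : ℤ) (z : Strip) :
    DerivBound r (iterBound r D M) (liftPow F a b) z := by
  refine DerivBound.congr_shift (m := b) (G₂ := ⇑(F ^ a)) ?_
    (Eventually.of_forall fun w => deckT_zpow_apply b ((F ^ a) w))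
  obtain ⟨i, rfl | rfl⟩ := a.eq_nat_or_neg
  · have : ⇑(F ^ (i : ℤ)) = F^[i] := funext fun w => by rw [zpow_natCast, homeo_pow_apply]
    rw [this]
    exact (DerivBound.iterate hD i z).mono (iterBound_mono r le_rfl (by simpa using ha))
  · have : ⇑(F ^ (-i : ℤ)) = F.symm^[i] := funext fun w => by
      rw [zpow_neg, zpow_natCast, ← inv_pow, homeo_pow_apply]; rfl
    rw [this]
    exact (DerivBound.iterate hD' i z).mono (iterBound_mono r le_rfl (by simpa using ha))

/-- H = S^k H T^{-k} and H⁻¹ = T^k H⁻¹ S^{-k} carry bounds on one unit square to its k-th translate,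
at the cost of |k| Q' iterations of F or F⁻¹. -/
theorem ConjTo.derivBound (hconj : ConjTo H (liftPow F Q' (-P')))
    (hcomm : ∀ z, F (deckT z) = deckT (F z))
    (hD : ∀ z, DerivBound r D F z) (hD' : ∀ z, DerivBound r D F.symm z)
    {u : Strip} (hB : DerivBound r B H u) (hB' : DerivBound r B H.symm (H u))
    {k : ℤ} {M : ℕ} (hk : k.natAbs ≤ M) :
    DerivBound r (compBound r (iterBound r D (M * Q')) (compBound r B 1)) H (affineX 1 k u) ∧
    DerivBound r (compBound r B (iterBound r D (M * Q'))) H.symm (H (affineX 1 k u)) := by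
  have hM : ∀ j : ℤ, j.natAbs ≤ M → (j * (Q' : ℤ)).natAbs ≤ M * Q' := fun j hj => by
    rw [Int.natAbs_mul, Int.natAbs_natCast]; gcongr
  have h1 : ∀ z : Strip, affineX 1 k (affineX 1 (-k) z) = z := fun z => by
    rw [affineX_one_add, add_neg_cancel, affineX_one_zero, id]
  have h2 : affineX 1 (-k) (affineX 1 k u) = u := congrFun (affineX_neg_comp_self _) u
  have h3 : ⇑H = ⇑(liftPow F (k * Q') (k * -P')) ∘ H ∘ affineX 1 (-k) := funext fun z => by
    conv_lhs => rw [← h1 z, hconj.map_shift, liftPow_zpow hcomm]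
    rfl
  have h4 : ⇑H.symm = affineX 1 k ∘ (H.symm ∘ ⇑(liftPow F (-k * Q') (-k * -P'))) :=
    funext fun z => by
      have h5 := hconj.map_shift (-k) (H.symm z)
      rw [H.apply_symm_apply, liftPow_zpow hcomm] at h5
      rw [Function.comp, Function.comp, ← h5, H.symm_apply_apply]
      push_cast
      rw [h1]
  constructor
  · rw [h3]
    refine (derivBound_liftPow hD hD' (hM k hk) _ _).comp (DerivBound.comp ?_
      (derivBound_affineX abs_one _ _))
    rw [h2]; exact hB
  · refine DerivBound.congr_shift (m := k) (DerivBound.comp ?_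
      (derivBound_liftPow hD hD' (hM (-k) (by simpa using hk)) (-k * -P') _))
      (Eventually.of_forall (congrFun h4))
    rw [hconj.map_shift, ← liftPow_zpow hcomm, ← mul_apply_homeo, ← zpow_add, neg_add_cancel,
      zpow_zero]
    exact hB'

theorem toPlane_image_square :
    toPlane '' square = {w : Plane | w 0 ∈ Icc (0 : ℝ) 1} ∩ stripSet := by
  ext w; constructor
  · rintro ⟨z, hz, rfl⟩; exact ⟨hz, toPlane_mem z⟩
  · rintro ⟨hw, z, rfl⟩; exact ⟨z, hw, rfl⟩

theorem convex_toPlane_image_square : Convex ℝ (toPlane '' square) := by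
  rw [toPlane_image_square]
  exact ((convex_Icc (0 : ℝ) 1).linear_preimage (EuclideanSpace.proj (𝕜 := ℝ) 0).toLinearMap).inter
    convex_stripSet

/-- Mean value inequality on the convex unit square, whose diameter is at most 2; this is where r ≥
1 enters. -/
theorem abs_fst_sub_le (hr : 1 ≤ r) (h : ∀ z ∈ square, DerivBound r A G z) {z w : Strip}
    (hz : z ∈ square) (hw : w ∈ square) : |(G z).1 - (G w).1| ≤ 2 * A := by
  have h1 := convex_toPlane_image_square.norm_image_sub_le_of_norm_hasFDerivWithin_le
    (f := coordRep G) (f' := fun v => der G (ofPlane v)) (C := A) (by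
      rintro _ ⟨v, hv, rfl⟩
      rw [ofPlane_toPlane]
      exact (h v hv).1.hasFDerivWithinAt.mono (by rw [toPlane_image_square]; exact inter_subset_right))
    (by
      rintro _ ⟨v, hv, rfl⟩
      rw [ofPlane_toPlane]
      have := (h v hv).2 1 le_rfl hr
      rwa [itD, norm_iteratedFDerivWithin_one _ (uniqueDiffOn_stripSet _ (toPlane_mem v))] at this)
    (mem_image_of_mem _ hw) (mem_image_of_mem _ hz)
  rw [coordRep_toPlane, coordRep_toPlane] at h1
  have h2 : |(G z).1 - (G w).1| ≤ ‖toPlane (G z) - toPlane (G w)‖ :=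
    PiLp.norm_apply_le (toPlane (G z) - toPlane (G w)) 0
  have h3 : ‖toPlane z - toPlane w‖ ≤ 2 := by
    rw [EuclideanSpace.norm_eq, Fin.sum_univ_two, Real.sqrt_le_left (by norm_num)]
    have h4 : (toPlane z - toPlane w) 0 = z.1 - w.1 := rfl
    have h5 : (toPlane z - toPlane w) 1 = (z.2 : ℝ) - w.2 := rfl
    rw [h4, h5, Real.norm_eq_abs, Real.norm_eq_abs, sq_abs, sq_abs]
    have h6 : (z.1 - w.1) ^ 2 ≤ 1 := by
      rw [sq_le_one_iff_abs_le_one, abs_le]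
      constructor <;> linarith [hz.1, hz.2, hw.1, hw.2]
    have h7 : ((z.2 : ℝ) - w.2) ^ 2 ≤ 1 := by
      rw [sq_le_one_iff_abs_le_one, abs_le]
      constructor <;> linarith [z.2.2.1, z.2.2.2, w.2.2.1, w.2.2.2]
    linarith
  calc _ ≤ _ := h2
    _ ≤ _ := h1
    _ ≤ A * 2 := by gcongr
    _ = 2 * A := mul_comm _ _

/-- A bound for the number of unit squares that are met by the image of the unit square. -/
noncomputable def squareCount (A : ℝ≥0) : ℕ := ⌈2 * A + 2⌉₊

/-- The bound for the chart of the annulus. -/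
noncomputable def chartBound (r : ℕ) (A B D : ℝ≥0) (q : ℕ) : ℝ≥0 :=
  max (compBound r (compBound r (iterBound r D (squareCount A * q)) (compBound r B 1))
      (compBound r 1 (compBound r A 1)))
    (compBound r 1 (compBound r A (compBound r (compBound r 1
      (compBound r B (iterBound r D (squareCount A * q)))) 1)))

theorem chartBound_mono (r : ℕ) {A A' B B' D D' : ℝ≥0} {q q' : ℕ} (hA : A ≤ A') (hB : B ≤ B')
    (hD : D ≤ D') (hq : q ≤ q') : chartBound r A B D q ≤ chartBound r A' B' D' q' := by
  have h1 : iterBound r D (squareCount A * q) ≤ iterBound r D' (squareCount A' * q') :=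
    iterBound_mono r hD (Nat.mul_le_mul (Nat.ceil_mono (by gcongr)) hq)
  refine max_le_max (compBound_mono r (compBound_mono r h1 (compBound_mono r hB le_rfl))
    (compBound_mono r le_rfl (compBound_mono r hA le_rfl))) ?_
  exact compBound_mono r le_rfl (compBound_mono r hA (compBound_mono r (compBound_mono r le_rfl
    (compBound_mono r hB h1)) le_rfl))

/-- The normalization `hγt` is essential: a deck translation of the lift would move JΨ to a remote
translate of the square, where the bound for H degenerates. -/
theorem LiftedChart.diffSizeChart_le (hr : 1 ≤ r) (h : LiftedChart G φ γt ε Ψ)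
    (hcomm : ∀ z, F (deckT z) = deckT (F z)) (hconj : ConjTo H (liftPow F Q' (-P')))
    (hD : ∀ z, DerivBound r D F z ∧ DerivBound r D F.symm z)
    (hB : ∀ u ∈ square, DerivBound r B H u ∧ DerivBound r B H.symm (H u))
    (hA : ∀ w ∈ square, DerivBound r A Ψ w ∧ DerivBound r A (φ.symm ∘ proj) (Ψ w))
    (hsq : square ⊆ e.source) (hsrc : e.source ⊆ squareNhd ε)
    (he : ∀ z, e z = proj ((H * reflJ) (Ψ (affineX (-1) 1 z))))
    (hγt : ∃ z ∈ γt, z.2 = 0 ∧ z.1 ∈ Icc (0 : ℝ) 1) :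
    diffSizeChart r e ≤ chartBound r A B D Q' := by
  obtain ⟨_, hv₀, -, hv⟩ := hγt
  rw [← h.left] at hv₀
  obtain ⟨v, hv0, rfl⟩ := hv₀
  have hvsq : v ∈ square := ⟨(show v.1 = 0 from hv0).ge, (show v.1 = 0 from hv0).trans_le zero_le_one⟩
  have key : ∀ w ∈ square,
      DerivBound r (compBound r (iterBound r D (squareCount A * Q')) (compBound r B 1)) H
        (affineX (-1) 0 (Ψ w)) ∧
      DerivBound r (compBound r B (iterBound r D (squareCount A * Q'))) H.symm
        (H (affineX (-1) 0 (Ψ w))) := fun w hw => by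
    obtain ⟨k, u, hu, hku⟩ := exists_mem_square (affineX (-1) 0 (Ψ w))
    rw [hku]
    refine hconj.derivBound hcomm (fun z => (hD z).1) (fun z => (hD z).2) (hB u hu).1 (hB u hu).2 ?_
    have h1 := abs_le.1 (abs_fst_sub_le hr (fun z hz => (hA z hz).1) hw hvsq)
    have h2 := congrArg Prod.fst hku
    simp only [affineX, one_mul, neg_mul, add_zero] at h2
    -- Ψ(w) is within 2A of a point with first coordinate in [0,1], which accounts for 2A + 1; the
    -- offset of u in the unit square adds 1.
    have h3 : |(k : ℝ)| ≤ 2 * A + 2 := by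
      rw [abs_le]
      constructor <;> linarith [hu.1, hu.2, hv.1, hv.2, h1.1, h1.2]
    have h4 : ((k.natAbs : ℝ≥0) : ℝ) ≤ ((2 * A + 2 : ℝ≥0) : ℝ) := by
      push_cast; rwa [Nat.cast_natAbs, Int.cast_abs]
    have h5 : (k.natAbs : ℝ≥0) ≤ 2 * A + 2 := NNReal.coe_le_coe.1 h4
    have h6 : (k.natAbs : ℝ≥0) ≤ (squareCount A : ℝ≥0) := h5.trans (Nat.le_ceil _)
    exact_mod_cast h6
  have hK : ⇑(H * reflJ) = H ∘ affineX (-1) 0 := funext fun z => congrArg H (reflJ_apply z)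
  rw [chartBound, ENNReal.coe_max]
  refine max_le_max (crSizeA_le fun w hw => ⟨H ∘ affineX (-1) 0 ∘ Ψ ∘ affineX (-1) 1, ?_, ?_, ?_⟩)
    (crSize_le ?_)
  · exact (H.continuous.comp ((continuous_affineX _ _).comp
      (h.continuous.comp (continuous_affineX _ _)))).continuousAt
  · refine Eventually.of_forall fun z => ?_
    rw [he, hK]; rfl
  · have hρ := affineX_neg_one_mem_square hw
    exact DerivBound.comp (F := affineX (-1) 0 ∘ Ψ ∘ affineX (-1) 1) (key _ hρ).1
      (DerivBound.comp (F := Ψ ∘ affineX (-1) 1) (derivBound_affineX (by simp) _ _)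
        ((hA _ hρ).1.comp (derivBound_affineX (by simp) _ _)))
  · rintro z ⟨w, hw, hwz⟩
    rw [he] at hwz
    obtain ⟨k, hk⟩ := exists_int_of_proj_eq hwz.symm
    have hρ := affineX_neg_one_mem_square hw
    refine DerivBound.congr ?_ (h.symm_eventuallyEq (H * reflJ) hsrc he (hsq hw) k hk)
    have h1 : affineX 1 ((-k : ℤ) : ℝ) z = H (affineX (-1) 0 (Ψ (affineX (-1) 1 w))) := by
      rw [hk, affineX_one_add, hK]; push_cast
      rw [neg_add_cancel, affineX_one_zero]; rfl
    have h2 : affineX (-1) 0 (H.symm (H (affineX (-1) 0 (Ψ (affineX (-1) 1 w))))) =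
        Ψ (affineX (-1) 1 w) := by
      rw [H.symm_apply_apply]; simp [affineX]
    rw [mul_reflJ_inv_eq]
    refine (derivBound_affineX (by simp) _ _).comp (DerivBound.comp ?_ (DerivBound.comp
      ((derivBound_affineX (by simp) _ _).comp ?_) (derivBound_affineX abs_one _ _)))
    · rw [Function.comp, Function.comp, h1, h2]; exact (hA _ hρ).2
    · rw [h1]; exact (key _ hρ).2

end

/-- The function that bounds the size of the chart of the annulus. -/
noncomputable def growth (r : ℕ) (p : ℝ≥0 × ℝ≥0 × ℝ≥0 × ℕ) : ℝ≥0 :=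
  chartBound r (2 ^ r * p.1) (2 ^ r * p.2.1) (2 ^ r * p.2.2.1) p.2.2.2 +
    (p.1 + (p.2.1 + (p.2.2.1 + p.2.2.2)))

/-- `chartBound` is only known to be monotone; the added sum of the four arguments supplies
strictness. -/
theorem strictMono_growth (r : ℕ) : StrictMono (growth r) := by
  rintro ⟨a, b, c, q⟩ ⟨a', b', c', q'⟩ h
  obtain ⟨ha, hb, hc, hq⟩ : a ≤ a' ∧ b ≤ b' ∧ c ≤ c' ∧ q ≤ q' := h.le
  refine add_lt_add_of_le_of_lt (chartBound_mono r (by gcongr) (by gcongr) (by gcongr) hq) ?_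
  have hq' : (q : ℝ≥0) ≤ q' := by exact_mod_cast hq
  rcases Prod.lt_iff.1 h with ⟨h1, -⟩ | ⟨-, h1⟩
  · exact add_lt_add_of_lt_of_le h1 (add_le_add hb (add_le_add hc hq'))
  refine add_lt_add_of_le_of_lt ha ?_
  rcases Prod.lt_iff.1 h1 with ⟨h2, -⟩ | ⟨-, h2⟩
  · exact add_lt_add_of_lt_of_le h2 (add_le_add hc hq')
  refine add_lt_add_of_le_of_lt hb ?_
  rcases Prod.lt_iff.1 h2 with ⟨h3, -⟩ | ⟨-, h3⟩
  · exact add_lt_add_of_lt_of_le h3 hq'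
  · exact add_lt_add_of_le_of_lt hc (by exact_mod_cast h3)

end PseudoRotation

/-! ### Assembly of the proof. -/

open PseudoRotation

theorem mainTheorem6 (r : ℕ) (hr : 1 ≤ r) :
    ∃ G : ℝ≥0 × ℝ≥0 × ℝ≥0 × ℕ → ℝ≥0, StrictMono G ∧
      ∀ (f : Annulus ≃ₜ Annulus)
        (F : Strip ≃ₜ Strip) (α : ℝ)
        (n : ℕ) (σ : Set Annulus) (σt : Set Strip)
        (H : Strip ≃ₜ Strip)
        (γ' : Set Annulus) (γt' : Set Strip),
        IsPseudoRotation f →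
        IsLift F f →
        HasRotationNumber F α → α ∈ Ioo (0 : ℝ) 1 →
        Odd n →
        IsRenormChart f F α (n - 1) σ σt H →
        IsGoodBrouwerCurve
          (renorm F H (qSeq α n) (-pSeq α n))
          (aSeq α (n + 1)) γ' →
        IsCurveLift γt' γ' →
        ∀ γ : Set Annulus,
          γ = proj '' ((H * reflJ) '' γt') →
          IsGoodBrouwerCurve f (qSeq α (n + 1)) γ ∧
          IsBrouwerCurve (⇑(f ^ qSeq α n)) γ ∧
          ∀ Φ' : OpenPartialHomeomorph Strip Annulus,
            IsAdmissible
              (renorm F H (qSeq α n) (-pSeq α n))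
              γ' Φ' →
            ∃ Φ : OpenPartialHomeomorph Strip Annulus,
              IsAdmissible ⇑((f ^ qSeq α n)⁻¹)
                ((f ^ qSeq α n) '' γ) Φ ∧
              ((∃ z ∈ γt', z.2 = 0 ∧ z.1 ∈ Icc (0 : ℝ) 1) →
                diffSizeChart r Φ ≤
                  (G ((diffSizeChart r Φ').toNNReal,
                    (diffSizeStrip r H).toNNReal,
                    (diffSizeAnnulus r f).toNNReal,
                    qSeq α (n - 1)) : ℝ≥0)) := by
  refine ⟨growth r, strictMono_growth r, ?_⟩
  intro f F α n σ σt H γ' γt' hf hFl hρ hα hn hH hγ' hγt' γ hγ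
  obtain ⟨k, rfl⟩ : ∃ k, n = k + 1 := ⟨n - 1, by obtain ⟨j, rfl⟩ := hn; omega⟩
  -- The level k = n - 1 is even, which fixes the signs: F^{q_k,-p_k} moves to the right,
  -- F^{q_n,-p_n} to the left, and the determinant is +1.
  have hk : Even k := by
    rcases Nat.even_or_odd k with h | h
    · exact h
    · exact absurd hn (Nat.not_odd_iff_even.2 h.add_one)
  rw [Nat.add_sub_cancel] at hH ⊢
  subst hγ
  have hF := goodLift_of_isPseudoRotation hf hFl hρ hα
  have hi := hF.irrational
  have hconj : ConjTo H (liftPow F (qSeq α k) (-pSeq α k)) := hH.conj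
  have hs : ∀ z, SmoothAt H z := fun z => hH.admissible.smooth z (mem_univ z)
  have hs' : ∀ z, SmoothAt H.symm z := fun z => hH.admissible.smooth_symm z (mem_univ z)
  obtain ⟨c, hc, hcj'⟩ := hH.admissible.jacobian
  have hcj : ∀ z, jac H z = c := fun z => hcj' z (mem_univ z)
  have hHb : H ∈ bdryGroup := hconj.mem_bdryGroup (liftPow_mem_bdryGroup hF.bdry _ _) hs
    (fun z => by rw [hcj]; exact hc.ne') hH.admissible.bottom_edge hH.admissible.top_edge
  have hβ : (qSeq α (k + 1) : ℝ) * α - pSeq α (k + 1) = -betaSeq α (k + 1) := by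
    rw [qSeq_mul_sub_pSeq hi hα, hn.neg_one_pow, neg_one_mul]
  have hβ' : (qSeq α k : ℝ) * α - pSeq α k = betaSeq α k := by
    rw [qSeq_mul_sub_pSeq hi hα, hk.neg_one_pow, one_mul]
  have hpos := betaSeq_pos hi hα k
  have hpos1 := betaSeq_pos hi hα (k + 1)
  have hlt1 := betaSeq_lt_one hi hα (k + 1)
  have hlt := betaSeq_succ_lt hi hα k
  have hdet : pSeq α (k + 1) * qSeq α k - pSeq α k * qSeq α (k + 1) = 1 := by
    rw [pSeq_mul_qSeq_sub hi hα, hk.neg_one_pow]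
  have hγD : DisjointLifts F (qSeq α (k + 1 + 1)) (⇑(H * reflJ) '' γt') :=
    hF.disjointLifts_of_renorm hconj hHb hdet (one_le_qSeq hi hα k) (one_le_aSeq hi hα (k + 1))
      (by rw [hβ]; linarith) (by rw [hβ']; exact hpos) hγ' hγt'
  have hQ := one_le_qSeq hi hα (k + 1)
  have hQN := qSeq_lt_succ hi hα (n := k + 1) (by omega)
  refine ⟨⟨?_, fun j hj hjN => hγD.isBrouwerCurve hFl (by omega) hjN⟩, ?_, fun Φ' hΦ' => ?_⟩
  · exact hγD.isBrouwerCurve hFl (j := 1) one_pos (by omega)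
  · have h1 : ⇑(f ^ qSeq α (k + 1)) = f^[qSeq α (k + 1)] := funext fun x => homeo_pow_apply _ _ _
    rw [h1]
    exact hγD.isBrouwerCurve hFl (by omega) hQN
  obtain ⟨ε, Ψ, hΨ⟩ := hΦ'.exists_liftedChart
    (renormLift F H (qSeq α (k + 1)) (-pSeq α (k + 1))).continuous
    (isLift_renorm hF.comm hconj _ _) hγt'
  obtain ⟨e, hadm, hsq, hsrc, he⟩ := hF.exists_chart hconj hHb hs hs' ⟨c, hc, hcj⟩ hγD hQ hQN
    (by rw [hβ]; linarith) (by rw [hβ]; linarith) (by rw [hβ']; exact hpos)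
    (by rw [hβ, hβ', neg_neg]; exact hlt) hΨ hΦ'.smooth_symm
  refine ⟨e, hadm, fun hbase => ?_⟩
  -- All three sizes are finite, so passing to `NNReal` keeps their values.
  have hA := (ENNReal.coe_toNNReal (hΨ.diffSizeChart_ne_top (r := r) hΦ'.smooth_symm)).ge
  have hB := (ENNReal.coe_toNNReal (diffSizeStrip_ne_top (r := r) hs hs')).ge
  have hD := (ENNReal.coe_toNNReal (diffSizeAnnulus_ne_top (r := r) hF)).ge
  refine (hΨ.diffSizeChart_le hr hF.comm hconj (fun z => derivBound_of_diffSizeAnnulus hF hD z)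
    (fun u hu => ⟨derivBound_of_crSize_le ((le_max_left _ _).trans hB) hu (hs u),
      derivBound_of_crSize_le ((le_max_right _ _).trans hB) (mem_image_of_mem _ hu) (hs' _)⟩)
    (fun w hw => hΨ.derivBound_of_diffSizeChart hΦ'.smooth_symm hA hw) hsq hsrc he hbase).trans ?_
  exact ENNReal.coe_le_coe.2 le_self_add
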